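/- **Setting.** Let $T>0$, $d\in\mathbb N$, $N\ge 2$, $r\ge 0$. Let $(\Omega,\mathcal F,\mathbf P)$ be a probability space with the augmented filtration $\mathbb F=(\mathcal F(t))_{t\in[0,T]}$ generated by a standard $d$-dimensional Brownian motion $W$. Let $\Sigma=\sigma\sigma'\in\mathbb R^{d\times d}$ be positive definite, $\Lambda\in\mathbb R^{d\times d}$ diagonal and positive definite, and let all $N$ investors have the same risk tolerance $\delta_m=\bar\delta>0$. Processes are identified if they agree $dt\otimes\mathbf P$-a.e.; $\mathcal H^2$ (resp. $\mathcal H^\infty$) is the space of optional $\mathbb R^d$-valued processes $X$ on $[0,T]$ with $\mathbf E\int_0^T\|X(t)\|_2^2dt<\infty$ (resp. essentially bounded). Let $\mathcal A$ be the set of continuous semimartingales $X\in\mathcal H^\infty$ with $dX=a^X\,dt+dM^X$, $X(T)=0$, $a^X\in\mathcal H^\infty$, and $M^X$ an $\mathbb F$-martingale in $\mathcal H^\infty$; and let $\mathcal W_{\mathcal A}=\{\int_0^{\cdot}u(s)\,ds: u\in\mathcal A\}$. The investors' exposures satisfy $\zeta_m\in\mathcal H^\infty$ ($1\le m\le N$),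 and the demand of the noise traders is $\psi=\int_0^\cdot\dot\psi(s)ds\in\mathcal W_{\mathcal A}$, where $\dot\psi\in\mathcal A$ has drift $a^{\dot\psi}$. **Objectives.** For exposure $z$ and returns $\nu$, investor $m$ has the objective $$\mathcal F_{\Lambda,m}(\phi;\nu,z)=\mathbf E\Big[\int_0^Te^{-rt}\Big(\phi'\nu-\tfrac1{2\delta_m}(\phi+z)'\Sigma(\phi+z)-\dot\phi'\Lambda\dot\phi\Big)dt\Big],\qquad \phi=\int_0^\cdot\dot\phi(s)\,ds,$$ with transaction costs, and the same objective without the last term, for $\phi\in\mathcal H^2$, in the frictionless market. A *price taker* maximizes it for fixed $\nu$: over $\phi\in\mathcal H^2$ in the frictionless market, over $\dot\phi\in\mathcal H^2$ with costs. **Nash equilibrium returns.** Given exposures $(z_i)$, the *price impact* of investor $n$ is the map $\phi\mapsto\nu_n(\phi)$, where the returns $\nu_n(\phi)$ are such that $\phi+\sum_{i\ne n}\phi_i+\psi=0$ when every $i\neq n$ chooses the optimal demand $\phi_i$ of a price taker with exposure $z_i$ at the returns $\nu_n(\phi)$; a *best response* of $n$ to $(z_i)_{i\ne n}$ is a maximizer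 of her objective, with exposure $z_n$, evaluated at the returns $\nu_n(\phi)$. In the frictionless market $\phi$ and $\nu_n(\phi)$ range over $\mathcal H^2$; with costs $\phi\in\mathcal W_{\mathcal A}$ and $\nu_n(\phi)\in\mathcal H^\infty$. At returns $\nu$, a demand $\phi_i$ of investor $i$ *reveals* the exposure $\delta_i\Sigma^{-1}\nu-\phi_i$. Returns $\nu$ (in $\mathcal H^2$, resp. in $\mathcal H^\infty$) are *Nash equilibrium returns* if there are demands $\phi_1,\dots,\phi_N$ (in $\mathcal H^2$, resp. in $\mathcal W_{\mathcal A}$) such that $\sum_{m}\phi_m+\psi=0$ and, for every $m$, $\phi_m$ is a best response of investor $m$, having her true exposure $\zeta_m$, to the exposures $\delta_i\Sigma^{-1}\nu-\phi_i$, $i\neq m$, revealed by the others at $\nu$. **Theorem.** The frictionless Nash equilibrium returns exist and are unique, namely $$\breve\nu=\frac{\Sigma}{\delta}\,\frac{(\zeta-\psi)-\sum_{m=1}^N\lambda_m\zeta_m}{1-\sum_{m=1}^N\lambda_m^2},\qquad \zeta=\sum_m\zeta_m,\quad \delta=\sum_m\delta_m,\quad \lambda_m=\frac{\delta_m}{\delta}=\frac1N.$$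 In the market with quadratic transaction costs, Nash equilibrium returns exist, are unique, belong to $\mathcal H^\infty$, and are given by $$\breve\nu_\Lambda=\breve\nu+\frac{2\Lambda}{N(N-1)}\big(a^{\dot\psi}-r\dot\psi\big).$$ In particular, if there are no noise traders ($\psi=0$), the Nash equilibrium returns with transaction costs and the frictionless ones are the same. -/

import Mathlib

open MeasureTheory ProbabilityTheory Filter
open scoped Topology ENNReal

noncomputable section

/-! ### Time, vectors, processes -/

/-- The trading horizon `[0, T]`. -/
abbrev Horizon (T : ℝ) : Type := Set.Icc (0 : ℝ) T

/-- `ℝ^d` with the Euclidean norm. -/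
abbrev Vec (d : ℕ) : Type := EuclideanSpace ℝ (Fin d)

/-- `ℝ^d`-valued processes `X : [0,T] × Ω → ℝ^d` (curried). -/
abbrev VProc (T : ℝ) (Ω : Type*) (d : ℕ) : Type _ := Horizon T → Ω → Vec d

/-- Lebesgue measure on `[0, T]`. -/
def timeMeasure (T : ℝ) : Measure (Horizon T) :=
  Measure.comap (Subtype.val : Horizon T → ℝ) volume

instance timeMeasure_finite (T : ℝ) : IsFiniteMeasure (timeMeasure T) := by
  constructor
  rw [timeMeasure, (MeasurableEmbedding.subtype_coe measurableSet_Icc).comap_apply,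
    Set.image_univ, Subtype.range_coe]
  exact measure_Icc_lt_top

/-- The action of a `d × d` matrix on `ℝ^d`. -/
def act {d : ℕ} (A : Matrix (Fin d) (Fin d) ℝ) (x : Vec d) : Vec d :=
  Matrix.toEuclideanCLM (n := Fin d) (𝕜 := ℝ) A x

/-- The product measure `dt ⊗ P`. -/
def dtP (T : ℝ) {Ω : Type*} [MeasurableSpace Ω] (P : Measure Ω) : Measure (Horizon T × Ω) :=
  (timeMeasure T).prod P

/-- `dt ⊗ P`-almost everywhere equality of processes. -/
def AEEqProc {T : ℝ} {Ω : Type*} [MeasurableSpace Ω] {d : ℕ} (P : Measure Ω)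
    (X Y : VProc T Ω d) : Prop :=
  ∀ᵐ p ∂(dtP T P), X p.1 p.2 = Y p.1 p.2

/-- The process `t ↦ ∫_0^t u(s) ds`. -/
def cumul {T : ℝ} {Ω : Type*} {d : ℕ} (u : VProc T Ω d) : VProc T Ω d :=
  fun t ω => ∫ s in Set.Iic t, u s ω ∂(timeMeasure T)

/-! ### Brownian motion and its augmented filtration -/

/-- `W` is a standard `d`-dimensional Brownian motion on `[0, T]`. -/
structure IsStdBrownian {T : ℝ} {Ω : Type*} [MeasurableSpace Ω] {d : ℕ}
    (P : Measure Ω) (W : VProc T Ω d) : Prop where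
  measurable : ∀ t, Measurable (W t)
  start_zero : ∀ t : Horizon T, (t : ℝ) = 0 → ∀ᵐ ω ∂P, W t ω = 0
  continuous_paths : ∀ᵐ ω ∂P, Continuous fun t => W t ω
  indep_past : ∀ s t : Horizon T, s ≤ t →
    Indep (MeasurableSpace.comap (fun ω => W t ω - W s ω) inferInstance)
      (⨆ u : Set.Iic s, MeasurableSpace.comap (W u) inferInstance) P
  increment_law : ∀ s t : Horizon T, s ≤ t →
    HasLaw (fun ω => W t ω - W s ω)
      ((stdGaussian (Vec d)).map fun x => Real.sqrt ((t : ℝ) - s) • x) P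

/-- The filtration generated by `W`, augmented by the null sets of `P`. -/
def augFiltration {T : ℝ} {Ω : Type*} [mΩ : MeasurableSpace Ω] {d : ℕ}
    (P : Measure Ω) (W : VProc T Ω d) (hW : ∀ t, Measurable (W t)) :
    Filtration (Horizon T) mΩ where
  seq t := (⨆ u : Set.Iic t, MeasurableSpace.comap (W u) inferInstance) ⊔
    MeasurableSpace.generateFrom {A | MeasurableSet A ∧ P A = 0}
  mono' s t hst := by
    refine sup_le_sup_right (iSup_le fun u => ?_) _
    exact le_iSup (fun u : Set.Iic t => MeasurableSpace.comap (W u) inferInstance)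
      ⟨u.1, le_trans u.2 hst⟩
  le' t := by
    refine sup_le (iSup_le fun u => (hW u).comap_le) ?_
    exact MeasurableSpace.generateFrom_le fun A hA => hA.1

/-! ### Optional processes and the spaces of processes -/

/-- The optional σ-algebra on `[0,T] × Ω`: generated by the adapted càdlàg real processes. -/
@[reducible] def optionalSigma {T : ℝ} {Ω : Type*} [mΩ : MeasurableSpace Ω]
    (𝓕 : Filtration (Horizon T) mΩ) : MeasurableSpace (Horizon T × Ω) :=
  ⨆ X : {X : Horizon T → Ω → ℝ // (∀ t, Measurable[𝓕 t] (X t)) ∧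
      ∀ ω t, ContinuousWithinAt (fun s => X s ω) (Set.Ici t) t ∧
        ∃ l, Tendsto (fun s => X s ω) (𝓝[<] t) (𝓝 l)},
    MeasurableSpace.comap (fun p : Horizon T × Ω => X.1 p.1 p.2) inferInstance

/-- `X` is optional (as an element of a space of `dt ⊗ P`-classes of processes). -/
def IsOptional {T : ℝ} {Ω : Type*} [mΩ : MeasurableSpace Ω] {d : ℕ}
    (𝓕 : Filtration (Horizon T) mΩ) (P : Measure Ω) (X : VProc T Ω d) : Prop :=
  AEStronglyMeasurable[optionalSigma 𝓕] (fun p : Horizon T × Ω => X p.1 p.2) (dtP T P)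

/-- The space `H²`: optional with `E ∫_0^T ‖X(t)‖² dt < ∞`. -/
def InH2 {T : ℝ} {Ω : Type*} [mΩ : MeasurableSpace Ω] {d : ℕ}
    (𝓕 : Filtration (Horizon T) mΩ) (P : Measure Ω) (X : VProc T Ω d) : Prop :=
  IsOptional 𝓕 P X ∧ MemLp (fun p : Horizon T × Ω => X p.1 p.2) 2 (dtP T P)

/-- The space `H^∞`: optional and essentially bounded. -/
def InHInf {T : ℝ} {Ω : Type*} [mΩ : MeasurableSpace Ω] {d : ℕ}
    (𝓕 : Filtration (Horizon T) mΩ) (P : Measure Ω) (X : VProc T Ω d) : Prop :=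
  IsOptional 𝓕 P X ∧ ∃ C : ℝ, ∀ᵐ p ∂(dtP T P), ‖X p.1 p.2‖ ≤ C

/-- `X` is a continuous semimartingale of the class `𝒜`, with drift `a` and martingale part `M`:
`dX = a dt + dM`, `X(T) = 0`, `a ∈ H^∞`, and `M` is a martingale in `H^∞`. -/
structure IsClassA {T : ℝ} {Ω : Type*} [mΩ : MeasurableSpace Ω] {d : ℕ}
    (𝓕 : Filtration (Horizon T) mΩ) (P : Measure Ω) (X a M : VProc T Ω d) : Prop where
  mem : InHInf 𝓕 P X
  continuous_paths : ∀ᵐ ω ∂P, Continuous fun t => X t ω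
  drift_mem : InHInf 𝓕 P a
  mart_mem : InHInf 𝓕 P M
  mart : Martingale M 𝓕 P
  decomposition : ∀ᵐ ω ∂P, ∀ s t : Horizon T, s ≤ t →
    X t ω - X s ω = (∫ τ in Set.Ioc s t, a τ ω ∂(timeMeasure T)) + (M t ω - M s ω)
  terminal : ∀ᵐ ω ∂P, ∀ t : Horizon T, (t : ℝ) = T → X t ω = 0

/-- Admissible trading rates `u ∈ 𝒜`. The corresponding demand, an element of `𝒲_𝒜`, is
`cumul u`. -/
def InClassA {T : ℝ} {Ω : Type*} [mΩ : MeasurableSpace Ω] {d : ℕ}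
    (𝓕 : Filtration (Horizon T) mΩ) (P : Measure Ω) (u : VProc T Ω d) : Prop :=
  ∃ a M : VProc T Ω d, IsClassA 𝓕 P u a M

/-! ### The market -/

/-- The exogenous data of the market with `d` risky assets and `N` investors. -/
structure Market (T : ℝ) (Ω : Type*) (d N : ℕ) where
  /-- time discount rate -/
  r : ℝ
  /-- volatility matrix `σ` of the returns -/
  vol : Matrix (Fin d) (Fin d) ℝ
  /-- transaction cost matrix `Λ` -/
  cost : Matrix (Fin d) (Fin d) ℝ
  /-- risk tolerances `δ_m` -/
  tol : Fin N → ℝ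
  /-- true risk exposures `ζ_m` -/
  expo : Fin N → VProc T Ω d
  /-- demand `ψ` of the noise traders -/
  noise : VProc T Ω d

/-- The covariance matrix `Σ = σ σ'`. -/
def Market.cov {T : ℝ} {Ω : Type*} {d N : ℕ} (K : Market T Ω d N) :
    Matrix (Fin d) (Fin d) ℝ :=
  K.vol * K.vol.transpose

/-- Instantaneous mean-variance payoff of investor `m` with demand `x`, local returns `v` and
exposure `z`. -/
def Market.payoff {T : ℝ} {Ω : Type*} {d N : ℕ} (K : Market T Ω d N) (m : Fin N)
    (x v z : Vec d) : ℝ :=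
  inner ℝ x v - 1 / (2 * K.tol m) * inner ℝ (x + z) (act K.cov (x + z))

/-- Frictionless objective of investor `m` with exposure `z`, for the demand `φ` and returns `ν`. -/
def Market.objective {T : ℝ} {Ω : Type*} [MeasurableSpace Ω] {d N : ℕ}
    (K : Market T Ω d N) (P : Measure Ω) (m : Fin N) (z ν φ : VProc T Ω d) : ℝ :=
  ∫ p, Real.exp (-K.r * (p.1 : ℝ)) *
    K.payoff m (φ p.1 p.2) (ν p.1 p.2) (z p.1 p.2) ∂(dtP T P)

/-- Objective under quadratic transaction costs, for the trading rate `u` and its demand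
`cumul u`. -/
def Market.costObjective {T : ℝ} {Ω : Type*} [MeasurableSpace Ω] {d N : ℕ}
    (K : Market T Ω d N) (P : Measure Ω) (m : Fin N) (z ν u : VProc T Ω d) : ℝ :=
  ∫ p, Real.exp (-K.r * (p.1 : ℝ)) *
    (K.payoff m (cumul u p.1 p.2) (ν p.1 p.2) (z p.1 p.2)
      - inner ℝ (u p.1 p.2) (act K.cost (u p.1 p.2))) ∂(dtP T P)

/-- The exposure revealed by the demand `φ` of investor `m` at returns `ν`:
`δ_m Σ⁻¹ ν - φ`. -/
def Market.revealed {T : ℝ} {Ω : Type*} {d N : ℕ} (K : Market T Ω d N) (m : Fin N)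
    (ν φ : VProc T Ω d) : VProc T Ω d :=
  fun t ω => K.tol m • act K.cov⁻¹ (ν t ω) - φ t ω

/-- The exposures in the best-response problem of the strategic investor `m`: she keeps her true
exposure, the others are represented by the exposures that their demands `φ` reveal. -/
def Market.facedExpo {T : ℝ} {Ω : Type*} {d N : ℕ} (K : Market T Ω d N) (ν : VProc T Ω d)
    (φ : Fin N → VProc T Ω d) (m : Fin N) : Fin N → VProc T Ω d :=
  fun i => if i = m then K.expo m else K.revealed i ν (φ i)

/-! ### The game without transaction costs -/

/-- `φ` is the optimal demand in `H²` of a price-taking investor `m` with exposure `z` at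
returns `ν`. -/
def Market.PriceTaking {T : ℝ} {Ω : Type*} [mΩ : MeasurableSpace Ω] {d N : ℕ}
    (K : Market T Ω d N) (𝓕 : Filtration (Horizon T) mΩ) (P : Measure Ω) (m : Fin N)
    (z ν φ : VProc T Ω d) : Prop :=
  InH2 𝓕 P φ ∧ ∀ θ, InH2 𝓕 P θ → K.objective P m z ν θ ≤ K.objective P m z ν φ

/-- Price impact of investor `n`: with her demand `φ`, the returns `ν` clear the market if all the
other investors, having exposures `z i`, are price takers. -/
def Market.PriceImpact {T : ℝ} {Ω : Type*} [mΩ : MeasurableSpace Ω] {d N : ℕ}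
    (K : Market T Ω d N) (𝓕 : Filtration (Horizon T) mΩ) (P : Measure Ω)
    (z : Fin N → VProc T Ω d) (n : Fin N) (φ ν : VProc T Ω d) : Prop :=
  InH2 𝓕 P ν ∧ ∃ χ : Fin N → VProc T Ω d,
    (∀ i, i ≠ n → K.PriceTaking 𝓕 P i (z i) ν (χ i)) ∧
    ∀ᵐ p ∂(dtP T P), φ p.1 p.2 + ∑ i ∈ Finset.univ.erase n, χ i p.1 p.2
      + K.noise p.1 p.2 = 0

/-- `φ` is a best response of investor `n`, who takes into account her price impact. -/
def Market.BestResponse {T : ℝ} {Ω : Type*} [mΩ : MeasurableSpace Ω] {d N : ℕ}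
    (K : Market T Ω d N) (𝓕 : Filtration (Horizon T) mΩ) (P : Measure Ω)
    (z : Fin N → VProc T Ω d) (n : Fin N) (φ : VProc T Ω d) : Prop :=
  InH2 𝓕 P φ ∧ ∃ μ, K.PriceImpact 𝓕 P z n φ μ ∧
    ∀ θ κ, InH2 𝓕 P θ → K.PriceImpact 𝓕 P z n θ κ →
      K.objective P n (z n) κ θ ≤ K.objective P n (z n) μ φ

/-- `ν` are Nash equilibrium returns in the market without transaction costs: at `ν` there are
demands that clear the market, each of which is a best response to the exposures revealed by the
others. -/
def Market.IsNashReturns {T : ℝ} {Ω : Type*} [mΩ : MeasurableSpace Ω] {d N : ℕ}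
    (K : Market T Ω d N) (𝓕 : Filtration (Horizon T) mΩ) (P : Measure Ω)
    (ν : VProc T Ω d) : Prop :=
  InH2 𝓕 P ν ∧ ∃ φ : Fin N → VProc T Ω d,
    (∀ m, K.BestResponse 𝓕 P (K.facedExpo ν φ m) m (φ m)) ∧
    ∀ᵐ p ∂(dtP T P), ∑ m, φ m p.1 p.2 + K.noise p.1 p.2 = 0

/-- The closed form
`(Σ/δ) ((ζ - ψ) - ∑ λ_m ζ_m) / (1 - ∑ λ_m²)`, with `ζ = ∑ ζ_m`, `δ = ∑ δ_m`, `λ_m = δ_m / δ`. -/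
def Market.nashFormula {T : ℝ} {Ω : Type*} {d N : ℕ} (K : Market T Ω d N) : VProc T Ω d :=
  fun t ω =>
    ((∑ m, K.tol m)⁻¹ * (1 - ∑ m, (K.tol m / ∑ i, K.tol i) ^ 2)⁻¹) •
      act K.cov (∑ m, K.expo m t ω - K.noise t ω
        - ∑ m, (K.tol m / ∑ i, K.tol i) • K.expo m t ω)

/-! ### The game with quadratic transaction costs -/

/-- `u ∈ H²` is the optimal trading rate of a price-taking investor `m` with exposure `z` at
returns `ν`, under transaction costs. -/
def Market.CostPriceTaking {T : ℝ} {Ω : Type*} [mΩ : MeasurableSpace Ω] {d N : ℕ}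
    (K : Market T Ω d N) (𝓕 : Filtration (Horizon T) mΩ) (P : Measure Ω) (m : Fin N)
    (z ν u : VProc T Ω d) : Prop :=
  InH2 𝓕 P u ∧ ∀ v, InH2 𝓕 P v → K.costObjective P m z ν v ≤ K.costObjective P m z ν u

/-- Price impact under transaction costs: with the trading rate `u` of investor `n`, the returns
`ν ∈ H^∞` clear the market if all the other investors, having exposures `z i`, are price takers. -/
def Market.CostPriceImpact {T : ℝ} {Ω : Type*} [mΩ : MeasurableSpace Ω] {d N : ℕ}
    (K : Market T Ω d N) (𝓕 : Filtration (Horizon T) mΩ) (P : Measure Ω)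
    (z : Fin N → VProc T Ω d) (n : Fin N) (u ν : VProc T Ω d) : Prop :=
  InHInf 𝓕 P ν ∧ ∃ v : Fin N → VProc T Ω d,
    (∀ i, i ≠ n → K.CostPriceTaking 𝓕 P i (z i) ν (v i)) ∧
    ∀ᵐ ω ∂P, ∀ t, cumul u t ω + ∑ i ∈ Finset.univ.erase n, cumul (v i) t ω
      + K.noise t ω = 0

/-- `u ∈ 𝒜` is a best-response trading rate of investor `n`, who takes into account her price
impact. -/
def Market.CostBestResponse {T : ℝ} {Ω : Type*} [mΩ : MeasurableSpace Ω] {d N : ℕ}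
    (K : Market T Ω d N) (𝓕 : Filtration (Horizon T) mΩ) (P : Measure Ω)
    (z : Fin N → VProc T Ω d) (n : Fin N) (u : VProc T Ω d) : Prop :=
  InClassA 𝓕 P u ∧ ∃ μ, K.CostPriceImpact 𝓕 P z n u μ ∧
    ∀ v κ, InClassA 𝓕 P v → K.CostPriceImpact 𝓕 P z n v κ →
      K.costObjective P n (z n) κ v ≤ K.costObjective P n (z n) μ u

/-- `ν` are Nash equilibrium returns in the market with transaction costs: at `ν` there are
demands in `𝒲_𝒜` that clear the market, each of which is a best response to the exposures revealed
by the others. -/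
def Market.IsCostNashReturns {T : ℝ} {Ω : Type*} [mΩ : MeasurableSpace Ω] {d N : ℕ}
    (K : Market T Ω d N) (𝓕 : Filtration (Horizon T) mΩ) (P : Measure Ω)
    (ν : VProc T Ω d) : Prop :=
  InHInf 𝓕 P ν ∧ ∃ u : Fin N → VProc T Ω d,
    (∀ m, K.CostBestResponse 𝓕 P (K.facedExpo ν (fun i => cumul (u i)) m) m (u m)) ∧
    ∀ᵐ ω ∂P, ∀ t, ∑ m, cumul (u m) t ω + K.noise t ω = 0

end

/-! Everything takes place in the Hilbert space `HilbertProc` of square integrable optional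
processes modulo `dt ⊗ P`, with three bounded operators: the primitive C (`opC`), a matrix acting
pointwise (`opA`), and multiplication by a function of time (`opMul`). Each objective is a concave
quadratic functional for the discounted pairing `discForm`, so being optimal means satisfying a
linear first-order condition (`quadratic_max_iff`).

Without costs the condition of a price taker is ν = Σ(φ + z)/δ. Since tolerances are equal, adding
it over the rivals of n gives her price impact as an affine function of her own demand; substituting
this into her objective gives another concave quadratic and hence her best response. Inserting the
revealed exposures and using clearing, the condition for investor m becomes N φ_m = (N-1)(δ Σ⁻¹ν -
ζ_m). The sum over m, together with clearing, determines ν, and conversely these formulas define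
demands that clear (`Market.isNashReturns_iff`).

With costs the condition of a price taker holds only in weak form, tested against primitives Cw,
because an optimal rate in H² need not have a drift. The sum of the rivals' rates, however, is minus
an element of 𝒜. Integration by parts for 𝒜 (`HasDrift.inner_eq`, `HasDrift.discForm_eq`) and
density of the range of C (`opC_adjoint_injective`) turn the summed weak condition into an explicit
formula for the price impact (`Market.costPriceImpact_iff`); it contains the drift of the strategic
rate. A further integration by parts removes that drift from the objective, and since primitives of
elements of 𝒜 are still dense, a best response is characterised by a linear forward-backward
equation (`Market.costBestResponse_iff`). Adding these equations over m, clearing cancels every term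
in the individual rates and drifts: what is left is the formula for the returns, hence uniqueness.

For existence the forward-backward equation must be solved in 𝒜. Diagonalising Λ⁻¹Σ reduces it to
scalar coefficients, where an explicit positive solution of a linear second order equation gives u
in terms of one conditional expectation (`IsStdBrownian.exists_hasDrift_scalar`). Continuity of u
requires martingales of the Brownian filtration to have continuous versions
(`IsStdBrownian.hasContVersion_of_memLp`): this is explicit for exponentials of finitely many values
of W, survives limits by Doob's inequality, and an orthogonality argument shows that nothing else is
missing. Clearing is then automatic, because the excess rate solves a homogeneous coercive equation.
If ψ = 0, injectivity of C and uniqueness of the drift make the correction term vanish. -/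

noncomputable section

/-! ### Lebesgue measure on the horizon and pathwise primitives -/

section TimeMeasure

variable {T : ℝ}

lemma map_val_timeMeasure (T : ℝ) :
    (timeMeasure T).map Subtype.val = volume.restrict (Set.Icc (0 : ℝ) T) := by
  rw [timeMeasure, (MeasurableEmbedding.subtype_coe measurableSet_Icc).map_comap,
    Subtype.range_coe]

instance timeMeasure_nullSingletonClass (T : ℝ) : NullSingletonClass (timeMeasure T) := by
  constructor
  intro x
  rw [timeMeasure, (MeasurableEmbedding.subtype_coe measurableSet_Icc).comap_apply,
    Set.image_singleton]
  simp

/-- Any point of [0, T], endpoints included, is a limit of interior points, so a relatively open set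
contains a nonempty open set of reals. This lets a continuous path that vanishes a.e. vanish
everywhere. -/
lemma timeMeasure_isOpenPosMeasure (hT : 0 < T) : (timeMeasure T).IsOpenPosMeasure := by
  constructor
  rintro U hU ⟨x, hx⟩
  obtain ⟨V, hV, rfl⟩ := isOpen_induced_iff.1 hU
  rw [timeMeasure, (MeasurableEmbedding.subtype_coe measurableSet_Icc).comap_apply,
    Subtype.image_preimage_coe]
  have hx' : (x : ℝ) ∈ closure (Set.Ioo (0 : ℝ) T) := by
    rw [closure_Ioo hT.ne]; exact x.2
  have hne : (V ∩ Set.Ioo (0 : ℝ) T).Nonempty := mem_closure_iff.1 hx' V hV hx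
  have hpos := (hV.inter isOpen_Ioo).measure_pos (μ := volume) hne
  refine (hpos.trans_le (measure_mono ?_)).ne'
  exact fun y hy => ⟨⟨hy.2.1.le, hy.2.2.le⟩, hy.1⟩

lemma setIntegral_Ioc_timeMeasure {E : Type*} [NormedAddCommGroup E] [NormedSpace ℝ E]
    (f : ℝ → E) (s t : Horizon T) (hst : s ≤ t) :
    ∫ τ in Set.Ioc s t, f τ ∂(timeMeasure T) = ∫ τ in (s : ℝ)..t, f τ := by
  have hemb := MeasurableEmbedding.subtype_coe (measurableSet_Icc (a := (0 : ℝ)) (b := T))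
  have hpre : Set.Ioc s t = (Subtype.val : Horizon T → ℝ) ⁻¹' Set.Ioc (s : ℝ) t := by
    ext x; simp [Set.mem_Ioc]
  rw [intervalIntegral.integral_of_le hst, hpre, ← hemb.setIntegral_map, map_val_timeMeasure,
    Measure.restrict_restrict measurableSet_Ioc, Set.inter_eq_left.2]
  exact fun y hy => ⟨s.2.1.trans hy.1.le, hy.2.trans t.2.2⟩

/-- The last instant of the horizon. -/
def lastTime (hT : 0 < T) : Horizon T := ⟨T, hT.le, le_rfl⟩

lemma le_lastTime (hT : 0 < T) (t : Horizon T) : t ≤ lastTime hT := t.2.2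

lemma Iic_lastTime (hT : 0 < T) : Set.Iic (lastTime hT) = Set.univ :=
  Set.eq_univ_of_forall fun t => le_lastTime hT t

variable {E F G : Type*} [NormedAddCommGroup E] [NormedSpace ℝ E]
  [NormedAddCommGroup F] [NormedSpace ℝ F] [NormedAddCommGroup G] [NormedSpace ℝ G]

lemma integrable_bilin_prod {α β : Type*} [MeasurableSpace α] [MeasurableSpace β]
    {μ : Measure α} {ν : Measure β} [SFinite μ] [SFinite ν] (B : E →L[ℝ] F →L[ℝ] G)
    {v : α → E} {x : β → F} (hv : Integrable v μ) (hx : Integrable x ν) :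
    Integrable (fun p : α × β => B (v p.1) (x p.2)) (μ.prod ν) := by
  refine ((hv.norm.mul_prod hx.norm).const_mul ‖B‖).mono'
    (B.aestronglyMeasurable_comp₂ hv.1.comp_fst hx.1.comp_snd) (ae_of_all _ fun p => ?_)
  calc ‖B (v p.1) (x p.2)‖ ≤ ‖B‖ * ‖v p.1‖ * ‖x p.2‖ := B.le_opNorm₂ _ _
    _ = _ := by ring

/-- Fubini on a triangle. -/
lemma integral_bilin_primitive [CompleteSpace E] [CompleteSpace F] (μ : Measure (Horizon T))
    [SFinite μ] (B : E →L[ℝ] F →L[ℝ] G)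
    {v : Horizon T → E} {x : Horizon T → F} (hv : Integrable v μ) (hx : Integrable x μ) :
    ∫ t, B (∫ s in Set.Iic t, v s ∂μ) (x t) ∂μ = ∫ s, B (v s) (∫ t in Set.Ici s, x t ∂μ) ∂μ := by
  -- The Bochner integral is zero by convention in an incomplete space, so only the left side needs
  -- an argument there when G is complete; otherwise both sides are 0 or integrals of `G`-valued
  -- maps, hence 0.
  by_cases hG : CompleteSpace G
  swap
  · simp [integral, hG]
  have hint := integrable_bilin_prod B hv hx
  have hle : MeasurableSet {p : Horizon T × Horizon T | p.1 ≤ p.2} :=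
    measurableSet_le measurable_fst measurable_snd
  have hswap := integral_integral_swap
    (f := fun s t => {p : Horizon T × Horizon T | p.1 ≤ p.2}.indicator
      (fun p => B (v p.1) (x p.2)) (s, t)) (μ := μ) (ν := μ) (hint.indicator hle)
  refine Eq.trans ?_ (hswap.symm.trans ?_)
  · refine integral_congr_ae (ae_of_all _ fun t => ?_)
    have h1 : B (∫ s in Set.Iic t, v s ∂μ) (x t) = ∫ s in Set.Iic t, B (v s) (x t) ∂μ :=
      ((B.flip (x t)).integral_comp_comm hv.integrableOn).symm
    simp only [h1]
    rw [← integral_indicator measurableSet_Iic]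
    rfl
  · refine integral_congr_ae (ae_of_all _ fun s => ?_)
    have h1 : B (v s) (∫ t in Set.Ici s, x t ∂μ) = ∫ t in Set.Ici s, B (v s) (x t) ∂μ :=
      ((B (v s)).integral_comp_comm hx.integrableOn).symm
    simp only [h1]
    rw [← integral_indicator measurableSet_Ici]
    rfl

/-- The primitive of a path on the horizon. -/
def primitive (x : Horizon T → E) (t : Horizon T) : E :=
  ∫ s in Set.Iic t, x s ∂(timeMeasure T)

lemma primitive_sub_primitive {x : Horizon T → E} (hx : Integrable x (timeMeasure T))
    {s t : Horizon T} (hst : s ≤ t) :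
    primitive x t - primitive x s = ∫ τ in Set.Ioc s t, x τ ∂(timeMeasure T) := by
  rw [primitive, primitive, ← Set.Iic_union_Ioc_eq_Iic hst,
    setIntegral_union (Set.Iic_disjoint_Ioc le_rfl) measurableSet_Ioc hx.integrableOn
      hx.integrableOn, add_sub_cancel_left]

lemma setIntegral_Ici_eq {x : Horizon T → E} (hx : Integrable x (timeMeasure T))
    (s : Horizon T) :
    ∫ t in Set.Ici s, x t ∂(timeMeasure T) = (∫ t, x t ∂(timeMeasure T)) - primitive x s := by
  rw [integral_Ici_eq_integral_Ioi, primitive, ← Set.compl_Iic,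
    ← integral_add_compl (measurableSet_Iic (a := s)) hx, add_sub_cancel_left]

/-- Dominated convergence: for fixed s, the indicator of s ≤ t is locally constant in t away from t
= s, and single points are null. -/
lemma continuous_primitive {x : Horizon T → E} (hx : Integrable x (timeMeasure T)) :
    Continuous (primitive x) := by
  have h : primitive x = fun t => ∫ s, (Set.Iic t).indicator x s ∂(timeMeasure T) := by
    funext t; rw [primitive, integral_indicator measurableSet_Iic]
  rw [h, continuous_iff_continuousAt]
  intro t
  refine continuousAt_of_dominated (bound := fun s => ‖x s‖)
    (Eventually.of_forall fun t => hx.1.indicator measurableSet_Iic)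
    (Eventually.of_forall fun t => ae_of_all _ fun s => norm_indicator_le_norm_self _ _)
    hx.norm ?_
  have hne : ∀ᵐ s ∂(timeMeasure T), s ≠ t := by
    rw [ae_iff]; simp
  filter_upwards [hne] with s hs
  rcases lt_or_gt_of_ne hs with h | h
  · refine continuousAt_const.congr (f := fun _ => x s) ?_
    filter_upwards [lt_mem_nhds h] with u hu
    rw [Set.indicator_of_mem (show s ∈ Set.Iic u from hu.le)]
  · refine continuousAt_const.congr (f := fun _ => (0 : E)) ?_
    filter_upwards [gt_mem_nhds h] with u hu
    rw [Set.indicator_of_notMem (by simpa using hu)]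

lemma norm_primitive_le {x : Horizon T → E} (hx : Integrable x (timeMeasure T))
    (t : Horizon T) : ‖primitive x t‖ ≤ ∫ s, ‖x s‖ ∂(timeMeasure T) :=
  (norm_integral_le_integral_norm _).trans
    (setIntegral_le_integral hx.norm (ae_of_all _ fun _ => norm_nonneg _))

lemma primitive_lastTime (hT : 0 < T) (x : Horizon T → E) :
    primitive x (lastTime hT) = ∫ s, x s ∂(timeMeasure T) := by
  rw [primitive, Iic_lastTime, setIntegral_univ]

/-- The half-lines form a π-system generating the Borel sets, so vanishing integrals propagate to
all of them. The value at the last instant gives the total integral, which handles complements. -/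
lemma ae_eq_zero_of_primitive_eq_zero [CompleteSpace E] (hT : 0 < T) {x : Horizon T → E}
    (hx : Integrable x (timeMeasure T)) (h : ∀ t, primitive x t = 0) :
    x =ᵐ[timeMeasure T] 0 := by
  have huniv : ∫ s, x s ∂(timeMeasure T) = 0 := by rw [← primitive_lastTime hT, h]
  have key : ∀ s, MeasurableSet s → ∫ u in s, x u ∂(timeMeasure T) = 0 := by
    intro s hs
    induction s, hs using MeasurableSpace.induction_on_inter
      (h_eq := (BorelSpace.measurable_eq (α := Horizon T)).trans (borel_eq_generateFrom_Iic _))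
      isPiSystem_Iic with
    | empty => simp
    | basic s hs =>
      obtain ⟨t, rfl⟩ := hs
      exact h t
    | compl s hs ih =>
      rw [setIntegral_compl hs hx, huniv, ih, sub_zero]
    | iUnion f hd hf ih =>
      rw [integral_iUnion hf hd hx.integrableOn]
      simp [ih]
  exact hx.ae_eq_zero_of_forall_setIntegral_eq_zero fun s hs _ => key s hs

lemma ae_eq_zero_of_primitive_ae_eq_zero [CompleteSpace E] (hT : 0 < T) {x : Horizon T → E}
    (hx : Integrable x (timeMeasure T)) (h : primitive x =ᵐ[timeMeasure T] 0) :
    x =ᵐ[timeMeasure T] 0 := by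
  have := timeMeasure_isOpenPosMeasure hT
  have h0 : primitive x = 0 :=
    Measure.eq_of_ae_eq h (continuous_primitive hx) continuous_zero
  exact ae_eq_zero_of_primitive_eq_zero hT hx fun t => congrFun h0 t

/-- `α` is absolutely continuous with integrable derivative `α'`. -/
structure HasRate (α α' : Horizon T → ℝ) : Prop where
  integrable : Integrable α' (timeMeasure T)
  sub_eq : ∀ s t, s ≤ t → α t - α s = ∫ τ in Set.Ioc s t, α' τ ∂(timeMeasure T)

lemma HasRate.of_hasDerivAt {α α' : ℝ → ℝ} (h : ∀ t, HasDerivAt α (α' t) t)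
    (hc : Continuous α') : HasRate (fun t : Horizon T => α t) (fun t => α' t) where
  integrable := by
    have hc' : Continuous fun t : Horizon T => α' t := hc.comp continuous_subtype_val
    obtain ⟨C, hC⟩ := isCompact_univ.exists_bound_of_continuousOn
      (s := (Set.univ : Set (Horizon T))) hc'.continuousOn
    exact Integrable.of_bound hc'.aestronglyMeasurable C
      (ae_of_all _ fun t => hC t (Set.mem_univ _))
  sub_eq := fun s t hst => by
    rw [setIntegral_Ioc_timeMeasure α' s t hst,
      intervalIntegral.integral_eq_sub_of_hasDerivAt (fun x _ => h x)
        (hc.intervalIntegrable _ _)]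

lemma HasRate.continuous (hT : 0 < T) {α α' : Horizon T → ℝ} (h : HasRate α α') :
    Continuous α := by
  have : α = fun t => α ⟨0, le_rfl, hT.le⟩ + (primitive α' t
      - primitive α' ⟨0, le_rfl, hT.le⟩) := by
    funext t
    have h0 : (⟨0, le_rfl, hT.le⟩ : Horizon T) ≤ t := t.2.1
    rw [primitive_sub_primitive h.integrable h0, ← h.sub_eq _ _ h0, add_sub_cancel]
  rw [this]
  exact continuous_const.add ((continuous_primitive h.integrable).sub continuous_const)

lemma HasRate.exists_bound (hT : 0 < T) {α α' : Horizon T → ℝ} (h : HasRate α α') :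
    ∃ C, ∀ t, |α t| ≤ C := by
  obtain ⟨C, hC⟩ := isCompact_univ.exists_bound_of_continuousOn
    (s := (Set.univ : Set (Horizon T))) (h.continuous hT).continuousOn
  exact ⟨C, fun t => hC t (Set.mem_univ _)⟩

lemma HasRate.integrable_smul (hT : 0 < T) {α α' : Horizon T → ℝ} (h : HasRate α α')
    {x : Horizon T → E} (hx : Integrable x (timeMeasure T)) :
    Integrable (fun s => α s • x s) (timeMeasure T) := by
  obtain ⟨C, hC⟩ := h.exists_bound hT
  exact hx.bdd_smul C (h.continuous hT).aestronglyMeasurable (ae_of_all _ hC)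

lemma HasRate.integrable_deriv_smul_primitive {α α' : Horizon T → ℝ} (h : HasRate α α')
    {x : Horizon T → E} (hx : Integrable x (timeMeasure T)) :
    Integrable (fun s => α' s • primitive x s) (timeMeasure T) :=
  h.integrable.smul_bdd _ (continuous_primitive hx).aestronglyMeasurable
    (ae_of_all _ fun t => norm_primitive_le hx t)

/-- The product rule. -/
lemma HasRate.smul_primitive [CompleteSpace E] (hT : 0 < T) {α α' : Horizon T → ℝ}
    (h : HasRate α α') {x : Horizon T → E} (hx : Integrable x (timeMeasure T)) (t : Horizon T) :
    α t • primitive x t = primitive (fun s => α s • x s + α' s • primitive x s) t := by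
  have hfub := integral_bilin_primitive ((timeMeasure T).restrict (Set.Iic t))
    (ContinuousLinearMap.lsmul ℝ ℝ (E := E)).flip hx.restrict h.integrable.restrict
  simp only [ContinuousLinearMap.flip_apply, ContinuousLinearMap.lsmul_apply] at hfub
  -- Fubini on the triangle below t: the inner integral of α' over (s, t] is α(t) - α(s).
  have h1 : ∫ s in Set.Iic t, α' s • primitive x s ∂(timeMeasure T)
      = ∫ s in Set.Iic t, (α t - α s) • x s ∂(timeMeasure T) := by
    refine Eq.trans ?_ (hfub.trans ?_)
    · refine setIntegral_congr_fun measurableSet_Iic fun s hs => ?_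
      simp only [primitive]
      rw [Measure.restrict_restrict measurableSet_Iic, Set.Iic_inter_Iic, min_eq_left hs]
    · refine setIntegral_congr_fun measurableSet_Iic fun s hs => ?_
      rw [Measure.restrict_restrict measurableSet_Ici, Set.Ici_inter_Iic,
        integral_Icc_eq_integral_Ioc, h.sub_eq s t hs]
  rw [primitive, primitive, integral_add (h.integrable_smul hT hx).integrableOn
    (h.integrable_deriv_smul_primitive hx).integrableOn, h1,
    ← integral_add (h.integrable_smul hT hx).integrableOn, ← integral_smul]
  · refine integral_congr_ae (ae_of_all _ fun s => ?_)
    simp [sub_smul]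
  · simp only [sub_smul]
    exact ((hx.smul (α t)).sub (h.integrable_smul hT hx)).integrableOn

end TimeMeasure

/-! ### The optional σ-algebra -/

section Optional

variable {T : ℝ} {Ω : Type*} {d : ℕ}

/-- Each time is rounded up to the grid of mesh 1/(n+1) and clipped to the horizon. Approximating
from the right suits right-continuous paths; monotonicity and finiteness of the grid serve Doob's
discrete inequality. -/
lemma exists_countable_approx_from_right (hT : 0 < T) :
    ∃ (g : ℕ → ℕ → Horizon T) (k : ℕ → Horizon T → ℕ), (∀ n, Measurable (k n)) ∧
      (∀ n t, t ≤ g n (k n t)) ∧ (∀ t, Tendsto (fun n => g n (k n t)) atTop (𝓝 t)) ∧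
      (∀ n, Monotone (g n)) ∧ ∀ n, ∃ m, ∀ t, k n t ≤ m := by
  refine ⟨fun n k => Set.projIcc 0 T hT.le ((k : ℝ) / (n + 1)),
    fun n t => ⌈(t : ℝ) * (n + 1)⌉₊, fun n => ?_, fun n t => ?_, fun t => ?_,
    fun n i j hij => Set.monotone_projIcc hT.le ?_, fun n => ⟨⌈T * (n + 1)⌉₊, fun t => ?_⟩⟩
  · exact Nat.measurable_ceil.comp (measurable_subtype_coe.mul_const _)
  · have h1 : (t : ℝ) ≤ (⌈(t : ℝ) * (n + 1)⌉₊ : ℝ) / (n + 1) := by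
      rw [le_div_iff₀ (by positivity)]
      exact Nat.le_ceil _
    have h2 : Set.projIcc 0 T hT.le (t : ℝ) = t := Set.projIcc_val hT.le t
    calc t = Set.projIcc 0 T hT.le (t : ℝ) := h2.symm
      _ ≤ _ := Set.monotone_projIcc hT.le h1
  · have h1 : Tendsto (fun n : ℕ => (⌈(t : ℝ) * (n + 1)⌉₊ : ℝ) / (n + 1)) atTop (𝓝 (t : ℝ)) := by
      have h0 : Tendsto (fun n : ℕ => (n : ℝ) + 1) atTop atTop :=
        tendsto_atTop_add_const_right _ _ tendsto_natCast_atTop_atTop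
      exact (tendsto_nat_ceil_mul_div_atTop (R := ℝ) t.2.1).comp h0
    have h2 : Set.projIcc 0 T hT.le (t : ℝ) = t := Set.projIcc_val hT.le t
    have h3 := ((continuous_projIcc (h := hT.le)).tendsto (t : ℝ)).comp h1
    rw [h2] at h3
    exact h3
  · gcongr
  · exact Nat.ceil_mono (mul_le_mul_of_nonneg_right t.2.2 (by positivity))

/-- By right-continuity the process is the pointwise limit of its values at the rounded-up times,
which are countably many and so jointly measurable. -/
lemma measurable_uncurry_of_continuousWithinAt_Ici (hT : 0 < T) [MeasurableSpace Ω]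
    {X : Horizon T → Ω → ℝ} (hX : ∀ t, Measurable (X t))
    (hc : ∀ ω t, ContinuousWithinAt (fun s => X s ω) (Set.Ici t) t) :
    Measurable fun p : Horizon T × Ω => X p.1 p.2 := by
  obtain ⟨g, k, hk, hle, hlim, -, -⟩ := exists_countable_approx_from_right hT
  refine measurable_of_tendsto_metrizable
    (f := fun n (p : Horizon T × Ω) => X (g n (k n p.1)) p.2) (fun n => ?_) ?_
  · have h1 : Measurable fun q : ℕ × Ω => X (g n q.1) q.2 :=
      measurable_from_prod_countable_right fun k => hX (g n k)
    exact h1.comp (((hk n).comp measurable_fst).prodMk measurable_snd)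
  · rw [tendsto_pi_nhds]
    rintro ⟨t, ω⟩
    exact (hc ω t).tendsto.comp (tendsto_nhdsWithin_iff.2
      ⟨hlim t, Eventually.of_forall fun n => hle n t⟩)

variable [mΩ : MeasurableSpace Ω] {𝓕 : Filtration (Horizon T) mΩ} {P : Measure Ω}

/-- It suffices to test on the generators, and only their right-continuity is ever needed, not their
left limits. -/
lemma measurable_optionalSigma {α : Type*} [MeasurableSpace α] {f : α → Horizon T × Ω}
    (h : ∀ X : Horizon T → Ω → ℝ, (∀ t, Measurable[𝓕 t] (X t)) →
      (∀ ω t, ContinuousWithinAt (fun s => X s ω) (Set.Ici t) t) →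
      Measurable fun a => X (f a).1 (f a).2) :
    Measurable[_, optionalSigma 𝓕] f := by
  rw [measurable_iff_comap_le, optionalSigma, MeasurableSpace.comap_iSup]
  refine iSup_le fun X => ?_
  rw [MeasurableSpace.comap_comp, ← measurable_iff_comap_le]
  exact h X.1 X.2.1 fun ω t => (X.2.2 ω t).1

lemma optionalSigma_le (hT : 0 < T) (𝓕 : Filtration (Horizon T) mΩ) :
    optionalSigma 𝓕 ≤ (inferInstance : MeasurableSpace (Horizon T × Ω)) := by
  have := measurable_optionalSigma (𝓕 := 𝓕) (f := (id : Horizon T × Ω → Horizon T × Ω))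
    fun X hX hc => measurable_uncurry_of_continuousWithinAt_Ici hT
      (fun t => (hX t).mono (𝓕.le t) le_rfl) hc
  rwa [measurable_iff_comap_le, MeasurableSpace.comap_id] at this

/-- This is progressive measurability of optional processes. It makes the integral of an optional
process up to t measurable for `𝓕 t`. -/
lemma measurable_stop_optionalSigma (hT : 0 < T) (t : Horizon T) :
    @Measurable _ _ (@Prod.instMeasurableSpace _ _ inferInstance (𝓕 t)) (optionalSigma 𝓕)
      fun p : Horizon T × Ω => (min p.1 t, p.2) := by
  refine @measurable_optionalSigma T Ω mΩ 𝓕 _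
    (@Prod.instMeasurableSpace _ _ inferInstance (𝓕 t)) _ fun X hX hc => ?_
  refine @measurable_uncurry_of_continuousWithinAt_Ici T Ω hT (𝓕 t) (fun s => X (min s t))
    (fun s => (hX _).mono (𝓕.mono (min_le_right s t)) le_rfl) fun ω s => ?_
  refine (hc ω (min s t)).comp (f := fun s : Horizon T => min s t)
    (continuous_id.min continuous_const).continuousWithinAt ?_
  exact fun u hu => min_le_min_right t hu

lemma measurable_section_optionalSigma (t : Horizon T) :
    @Measurable _ _ (𝓕 t) (optionalSigma 𝓕) fun ω : Ω => (t, ω) :=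
  @measurable_optionalSigma T Ω mΩ 𝓕 _ (𝓕 t) _ fun _ hX _ => hX t

lemma measurable_optional_of_continuous {X : Horizon T → Ω → ℝ}
    (hX : ∀ t, Measurable[𝓕 t] (X t)) (hc : ∀ ω, Continuous fun t => X t ω) :
    Measurable[optionalSigma 𝓕] fun p : Horizon T × Ω => X p.1 p.2 := by
  have h : ∀ ω t, ContinuousWithinAt (fun s => X s ω) (Set.Ici t) t ∧
        ∃ l, Tendsto (fun s => X s ω) (𝓝[<] t) (𝓝 l) := fun ω t =>
    ⟨(hc ω).continuousWithinAt, X t ω, (hc ω).continuousWithinAt⟩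
  rw [measurable_iff_comap_le]
  exact le_iSup (fun X : {X : Horizon T → Ω → ℝ // (∀ t, Measurable[𝓕 t] (X t)) ∧
      ∀ ω t, ContinuousWithinAt (fun s => X s ω) (Set.Ici t) t ∧
        ∃ l, Tendsto (fun s => X s ω) (𝓝[<] t) (𝓝 l)} =>
    MeasurableSpace.comap (fun p : Horizon T × Ω => X.1 p.1 p.2) inferInstance) ⟨X, hX, h⟩

/-- A process with continuous adapted paths. -/
structure IsContAdapted (𝓕 : Filtration (Horizon T) mΩ) (X : VProc T Ω d) : Prop where
  continuous : ∀ ω, Continuous fun t => X t ω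
  adapted : ∀ t, StronglyMeasurable[𝓕 t] (X t)

lemma IsContAdapted.stronglyMeasurable {X : VProc T Ω d} (h : IsContAdapted 𝓕 X) :
    StronglyMeasurable[optionalSigma 𝓕] fun p : Horizon T × Ω => X p.1 p.2 := by
  refine Measurable.stronglyMeasurable ?_
  have h1 : Measurable[optionalSigma 𝓕] fun (p : Horizon T × Ω) (i : Fin d) => X p.1 p.2 i := by
    refine @measurable_pi_lambda _ _ _ (optionalSigma 𝓕) _ _ fun i => ?_
    refine measurable_optional_of_continuous (X := fun t ω => X t ω i) (fun t => ?_) fun ω => ?_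
    · exact (measurable_pi_apply i |>.comp (MeasurableEquiv.toLp 2 (Fin d → ℝ)).symm.measurable).comp
        (h.adapted t).measurable
    · exact (EuclideanSpace.proj (𝕜 := ℝ) i).continuous.comp (h.continuous ω)
  exact (MeasurableEquiv.toLp 2 (Fin d → ℝ)).measurable.comp h1

lemma IsContAdapted.isOptional {X : VProc T Ω d} (h : IsContAdapted 𝓕 X) :
    IsOptional 𝓕 P X :=
  h.stronglyMeasurable.aestronglyMeasurable

lemma measurable_time_optional {α : Horizon T → ℝ} (hα : Continuous α) :
    Measurable[optionalSigma 𝓕] fun p : Horizon T × Ω => α p.1 :=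
  measurable_optional_of_continuous (X := fun t _ => α t) (fun _ => measurable_const)
    fun _ => hα

/-- Every event of the filtration is saturated with null events. -/
def ContainsNull (𝓕 : Filtration (Horizon T) mΩ) (P : Measure Ω) : Prop :=
  ∀ t A, MeasurableSet A → P A = 0 → MeasurableSet[𝓕 t] A

lemma containsNull_augFiltration (P : Measure Ω) (W : VProc T Ω d)
    (hW : ∀ t, Measurable (W t)) : ContainsNull (augFiltration P W hW) P := by
  intro t A hA hPA
  have h : MeasurableSpace.generateFrom {A | MeasurableSet A ∧ P A = 0}
      ≤ augFiltration P W hW t := le_sup_right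
  exact h _ (MeasurableSpace.measurableSet_generateFrom ⟨hA, hPA⟩)

lemma AEEqProc.of_forall {X Y : VProc T Ω d} (h : ∀ᵐ ω ∂P, ∀ t, X t ω = Y t ω) :
    AEEqProc P X Y := by
  have h2 : ∀ᵐ p : Horizon T × Ω ∂(dtP T P), ∀ t, X t p.2 = Y t p.2 :=
    Measure.quasiMeasurePreserving_snd.ae h
  filter_upwards [h2] with p hp using hp p.1

lemma AEEqProc.ae_ae [SFinite P] {X Y : VProc T Ω d} (h : AEEqProc P X Y) :
    ∀ᵐ ω ∂P, ∀ᵐ t ∂(timeMeasure T), X t ω = Y t ω := by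
  have h' : ∀ᵐ p ∂(timeMeasure T).prod P, X p.1 p.2 = Y p.1 p.2 := h
  rw [← Measure.prod_swap] at h'
  exact Measure.ae_ae_of_ae_prod (ae_of_ae_map measurable_swap.aemeasurable h')

lemma AEEqProc.cumul_eq [SFinite P] {X Y : VProc T Ω d} (h : AEEqProc P X Y) :
    ∀ᵐ ω ∂P, ∀ t, cumul X t ω = cumul Y t ω := by
  filter_upwards [h.ae_ae] with ω hω t
  exact setIntegral_congr_ae measurableSet_Iic (hω.mono fun s hs _ => hs)

lemma ae_integrable_path [SFinite P] {X : VProc T Ω d}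
    (h : Integrable (fun p : Horizon T × Ω => X p.1 p.2) (dtP T P)) :
    ∀ᵐ ω ∂P, Integrable (fun t => X t ω) (timeMeasure T) :=
  Integrable.prod_left_ae h

/-- Adaptedness comes from progressive measurability. Continuity for every ω, not just almost every
one, is obtained by putting 0 on the null event of non-integrable paths, which every `𝓕 t` contains.
-/
lemma exists_contAdapted_cumul (hT : 0 < T) [IsFiniteMeasure P] (hnull : ContainsNull 𝓕 P)
    {X : VProc T Ω d} (hX : IsOptional 𝓕 P X)
    (hint : Integrable (fun p : Horizon T × Ω => X p.1 p.2) (dtP T P)) :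
    ∃ Y : VProc T Ω d, IsContAdapted 𝓕 Y ∧ ∀ᵐ ω ∂P, ∀ t, cumul X t ω = Y t ω := by
  classical
  obtain ⟨X', hX', hXX'⟩ := hX
  have hX'm : StronglyMeasurable X' := hX'.mono (optionalSigma_le hT 𝓕)
  have hX'int : Integrable X' (dtP T P) := hint.congr hXX'
  have hA : MeasurableSet {ω | Integrable (fun t => X' (t, ω)) (timeMeasure T)} :=
    measurableSet_integrable (f := fun ω t => X' (t, ω)) (hX'm.comp_measurable measurable_swap)
  have hAae : ∀ᵐ ω ∂P, ω ∈ {ω | Integrable (fun t => X' (t, ω)) (timeMeasure T)} :=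
    Integrable.prod_left_ae hX'int
  set A := {ω | Integrable (fun t => X' (t, ω)) (timeMeasure T)} with hAdef
  have hA0 : ∀ t, MeasurableSet[𝓕 t] A := fun t =>
    (hnull t Aᶜ hA.compl (by rw [ae_iff] at hAae; exact hAae)).of_compl
  refine ⟨fun t => A.indicator fun ω => primitive (fun s => X' (s, ω)) t, ⟨fun ω => ?_, fun t => ?_⟩, ?_⟩
  · by_cases hω : ω ∈ A
    · simp only [Set.indicator_of_mem hω]
      exact continuous_primitive hω
    · simp only [Set.indicator_of_notMem hω]
      exact continuous_const
  · refine StronglyMeasurable.indicator ?_ (hA0 t)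
    -- Up to time t, stopping at t changes nothing, and the stopped integrand is jointly measurable
    -- with respect to `𝓕 t` in ω.
    have h1 : (fun ω => primitive (fun s => X' (s, ω)) t)
        = fun ω => ∫ s, X' (min s t, ω) ∂((timeMeasure T).restrict (Set.Iic t)) := by
      funext ω
      refine setIntegral_congr_fun measurableSet_Iic fun s hs => ?_
      simp only [min_eq_left (Set.mem_Iic.1 hs)]
    rw [h1]
    have h2 := hX'.comp_measurable (measurable_stop_optionalSigma (𝓕 := 𝓕) hT t)
    exact @StronglyMeasurable.integral_prod_left' _ _ _ _ (𝓕 t) _ _ _ _ _ h2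
  · have h1 := (AEEqProc.cumul_eq (P := P) (X := X) (Y := fun t ω => X' (t, ω)) hXX')
    filter_upwards [h1, hAae] with ω h1 hω t
    rw [h1 t, Set.indicator_of_mem hω]
    rfl

lemma IsOptional.cumul (hT : 0 < T) [IsFiniteMeasure P] (hnull : ContainsNull 𝓕 P)
    {X : VProc T Ω d} (hX : IsOptional 𝓕 P X)
    (hint : Integrable (fun p : Horizon T × Ω => X p.1 p.2) (dtP T P)) :
    IsOptional 𝓕 P (cumul X) := by
  obtain ⟨Y, hY, hXY⟩ := exists_contAdapted_cumul hT hnull hX hint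
  exact (hY.isOptional (P := P)).congr (Filter.EventuallyEq.symm (AEEqProc.of_forall hXY))

end Optional

/-! ### The Hilbert space of square integrable optional processes -/

section Hilbert

variable {T : ℝ} {Ω : Type*} {d : ℕ} [mΩ : MeasurableSpace Ω]

/-- Joint square integrability, without optionality. -/
abbrev IsL2 (P : Measure Ω) (X : VProc T Ω d) : Prop :=
  MemLp (fun p : Horizon T × Ω => X p.1 p.2) 2 (dtP T P)

instance dtP_isFiniteMeasure (P : Measure Ω) [IsFiniteMeasure P] : IsFiniteMeasure (dtP T P) := by
  unfold dtP; infer_instance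

lemma IsL2.integrable_inner {P : Measure Ω} {X Y : VProc T Ω d} (hX : IsL2 P X) (hY : IsL2 P Y) :
    Integrable (fun p : Horizon T × Ω => (inner ℝ (X p.1 p.2) (Y p.1 p.2) : ℝ)) (dtP T P) :=
  (MemLp.integrable_mul hX.norm hY.norm).mono' (hX.1.inner hY.1)
    (ae_of_all _ fun _ => norm_inner_le_norm _ _)

section L2

variable {P : Measure Ω} [IsFiniteMeasure P]

lemma IsL2.integrable {X : VProc T Ω d} (h : IsL2 P X) :
    Integrable (fun p : Horizon T × Ω => X p.1 p.2) (dtP T P) :=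
  MemLp.integrable one_le_two h

lemma sq_integral_norm_le {α E : Type*} [MeasurableSpace α] [NormedAddCommGroup E]
    {μ : Measure α} [IsFiniteMeasure μ] {x : α → E} (hx : MemLp x 2 μ) :
    (∫ s, ‖x s‖ ∂μ) ^ 2 ≤ μ.real Set.univ * ∫ s, ‖x s‖ ^ 2 ∂μ := by
  set c := μ.real Set.univ with hc
  set a := ∫ s, ‖x s‖ ∂μ with ha
  have hc0 : 0 ≤ c := measureReal_nonneg
  have h1 : Integrable (fun s => ‖x s‖) μ := (hx.integrable one_le_two).norm
  have h2 : Integrable (fun s => ‖x s‖ ^ 2) μ := hx.integrable_norm_pow (by norm_num)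
  rcases hc0.eq_or_lt with h0 | hpos
  · have : μ = 0 := by
      rw [eq_comm, hc, measureReal_eq_zero_iff, Measure.measure_univ_eq_zero] at h0
      exact h0
    simp [ha, this]
  -- Cauchy–Schwarz against the constant 1: the integral of (c‖x‖ - a)² is c(c∫‖x‖² - a²).
  have key : 0 ≤ ∫ s, (c ^ 2 * ‖x s‖ ^ 2 - 2 * c * a * ‖x s‖ + a ^ 2) ∂μ :=
    integral_nonneg fun s => by
      have : c ^ 2 * ‖x s‖ ^ 2 - 2 * c * a * ‖x s‖ + a ^ 2 = (c * ‖x s‖ - a) ^ 2 := by ring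
      simp only [Pi.zero_apply]
      rw [this]; positivity
  have h4 : Integrable (fun s => c ^ 2 * ‖x s‖ ^ 2 - 2 * c * a * ‖x s‖) μ :=
    (h2.const_mul _).sub (h1.const_mul _)
  rw [integral_add h4 (integrable_const _), integral_sub (h2.const_mul _) (h1.const_mul _), integral_const_mul, integral_const_mul,
    integral_const, ← ha, ← hc, smul_eq_mul] at key
  have h3 : 0 ≤ c * (c * (∫ s, ‖x s‖ ^ 2 ∂μ) - a ^ 2) := by linarith
  have := nonneg_of_mul_nonneg_right h3 hpos
  linarith

lemma IsL2.ae_path {X : VProc T Ω d} (h : IsL2 P X) :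
    ∀ᵐ ω ∂P, MemLp (fun t => X t ω) 2 (timeMeasure T) := by
  have h1 : Integrable (fun p : Horizon T × Ω => ‖X p.1 p.2‖ ^ 2) ((timeMeasure T).prod P) :=
    h.integrable_norm_pow (by norm_num)
  have h2 : Integrable (fun p : Horizon T × Ω => X p.1 p.2) ((timeMeasure T).prod P) :=
    h.integrable
  filter_upwards [h1.prod_left_ae, h2.prod_left_ae] with ω h1 h2
  exact (memLp_two_iff_integrable_sq_norm h2.1).2 h1

lemma IsL2.integrable_integral_sq {X : VProc T Ω d} (h : IsL2 P X) :
    Integrable (fun ω => ∫ t, ‖X t ω‖ ^ 2 ∂(timeMeasure T)) P := by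
  have h1 : Integrable (fun p : Horizon T × Ω => ‖X p.1 p.2‖ ^ 2) ((timeMeasure T).prod P) :=
    h.integrable_norm_pow (by norm_num)
  exact h1.integral_prod_right

/-- A process dominated by the total variation of the primitive of an `L²` process is `L²`. -/
lemma IsL2.of_norm_le {X Y : VProc T Ω d} (h : IsL2 P X)
    (hY : AEStronglyMeasurable (fun p : Horizon T × Ω => Y p.1 p.2) (dtP T P))
    (hle : ∀ᵐ ω ∂P, ∀ t, ‖Y t ω‖ ≤ ∫ s, ‖X s ω‖ ∂(timeMeasure T)) :
    IsL2 P Y ∧ ∫ p, ‖Y p.1 p.2‖ ^ 2 ∂(dtP T P)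
      ≤ (timeMeasure T).real Set.univ ^ 2 * ∫ p, ‖X p.1 p.2‖ ^ 2 ∂(dtP T P) := by
  set c := (timeMeasure T).real Set.univ
  have hb : Integrable (fun p : Horizon T × Ω => c * ∫ t, ‖X t p.2‖ ^ 2 ∂(timeMeasure T))
      (dtP T P) := (h.integrable_integral_sq.comp_snd (timeMeasure T)).const_mul c
  have hle2 : ∀ᵐ p ∂(dtP T P), ‖Y p.1 p.2‖ ^ 2 ≤ c * ∫ t, ‖X t p.2‖ ^ 2 ∂(timeMeasure T) := by
    have h1 : ∀ᵐ ω ∂P, ∀ t, ‖Y t ω‖ ^ 2 ≤ c * ∫ t, ‖X t ω‖ ^ 2 ∂(timeMeasure T) := by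
      filter_upwards [hle, h.ae_path] with ω h1 h2 t
      calc ‖Y t ω‖ ^ 2 ≤ (∫ s, ‖X s ω‖ ∂(timeMeasure T)) ^ 2 :=
            pow_le_pow_left₀ (norm_nonneg _) (h1 t) 2
        _ ≤ _ := sq_integral_norm_le h2
    have h2 : ∀ᵐ p : Horizon T × Ω ∂(dtP T P), ∀ t,
        ‖Y t p.2‖ ^ 2 ≤ c * ∫ t, ‖X t p.2‖ ^ 2 ∂(timeMeasure T) :=
      Measure.quasiMeasurePreserving_snd.ae h1
    filter_upwards [h2] with p hp using hp p.1
  have hint : Integrable (fun p : Horizon T × Ω => ‖Y p.1 p.2‖ ^ 2) (dtP T P) :=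
    hb.mono' (hY.norm.pow 2) (by
      filter_upwards [hle2] with p hp
      rwa [Real.norm_of_nonneg (by positivity)])
  refine ⟨(memLp_two_iff_integrable_sq_norm hY).2 hint, ?_⟩
  refine (integral_mono_ae hint hb hle2).trans_eq ?_
  have h1 : Integrable (fun p : Horizon T × Ω => ‖X p.1 p.2‖ ^ 2) ((timeMeasure T).prod P) :=
    h.integrable_norm_pow (by norm_num)
  -- The bound does not depend on time; integrating it over the horizon produces the second factor
  -- `c`, the first being due to Cauchy–Schwarz.
  rw [integral_const_mul, dtP, integral_fun_snd
    (fun ω => ∫ t, ‖X t ω‖ ^ 2 ∂(timeMeasure T)), integral_prod_symm _ h1, smul_eq_mul]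
  ring

/-- The primitive of a process and its adjoint, in mean. -/
lemma integral_inner_cumul {V X : VProc T Ω d} (hV : IsL2 P V) (hX : IsL2 P X)
    (hCV : IsL2 P (cumul V)) :
    ∫ p, (inner ℝ (cumul V p.1 p.2) (X p.1 p.2) : ℝ) ∂(dtP T P)
      = ∫ ω, ∫ s, (inner ℝ (V s ω) ((∫ t, X t ω ∂(timeMeasure T)) - cumul X s ω) : ℝ)
          ∂(timeMeasure T) ∂P := by
  have h1 : Integrable (fun p : Horizon T × Ω => (inner ℝ (cumul V p.1 p.2) (X p.1 p.2) : ℝ))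
    ((timeMeasure T).prod P) := hCV.integrable_inner hX
  rw [dtP, integral_prod_symm _ h1]
  refine integral_congr_ae ?_
  filter_upwards [ae_integrable_path hV.integrable, ae_integrable_path hX.integrable]
    with ω h1 h2
  refine (integral_bilin_primitive (timeMeasure T) (innerSL ℝ (E := Vec d)) h1 h2).trans ?_
  refine integral_congr_ae (ae_of_all _ fun s => ?_)
  exact congrArg (fun y => (inner ℝ (V s ω) y : ℝ)) (setIntegral_Ici_eq h2 s)

end L2

/-- The Hilbert space of `dt ⊗ P`-classes of square integrable optional processes. -/
abbrev HilbertProc (𝓕 : Filtration (Horizon T) mΩ) (P : Measure Ω) (d : ℕ) : Type _ :=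
  lpMeas (Vec d) ℝ (optionalSigma 𝓕) 2 (dtP T P)

variable {𝓕 : Filtration (Horizon T) mΩ} {P : Measure Ω}

/-- The process `X` belongs to the class `x`. -/
def HasClass (X : VProc T Ω d) (x : HilbertProc 𝓕 P d) : Prop :=
  (fun p : Horizon T × Ω => X p.1 p.2) =ᵐ[dtP T P]
    ((x : Lp (Vec d) 2 (dtP T P)) : Horizon T × Ω → Vec d)

lemma HasClass.inH2 {X : VProc T Ω d} {x : HilbertProc 𝓕 P d} (h : HasClass X x) : InH2 𝓕 P X :=
  ⟨(mem_lpMeas_iff_aestronglyMeasurable.1 x.2).congr (Filter.EventuallyEq.symm h),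
    (Lp.memLp (x : Lp (Vec d) 2 (dtP T P))).ae_eq (Filter.EventuallyEq.symm h)⟩

lemma InH2.exists_rep {X : VProc T Ω d} (h : InH2 𝓕 P X) :
    ∃ x : HilbertProc 𝓕 P d, HasClass X x :=
  ⟨⟨h.2.toLp _, mem_lpMeas_iff_aestronglyMeasurable.2 (h.1.congr h.2.coeFn_toLp.symm)⟩,
    h.2.coeFn_toLp.symm⟩

lemma exists_process (x : HilbertProc 𝓕 P d) : ∃ X : VProc T Ω d, HasClass X x :=
  ⟨fun t ω => (x : Lp (Vec d) 2 (dtP T P)) (t, ω), Filter.EventuallyEq.rfl⟩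

lemma HasClass.congr {X Y : VProc T Ω d} {x : HilbertProc 𝓕 P d} (h : HasClass X x)
    (hXY : AEEqProc P X Y) : HasClass Y x :=
  Filter.EventuallyEq.trans (Filter.EventuallyEq.symm hXY) h

lemma HasClass.aeEq {X Y : VProc T Ω d} {x : HilbertProc 𝓕 P d} (hX : HasClass X x) (hY : HasClass Y x) :
    AEEqProc P X Y :=
  Filter.EventuallyEq.trans hX (Filter.EventuallyEq.symm hY)

lemma HasClass.eq_of_aeEq {X Y : VProc T Ω d} {x y : HilbertProc 𝓕 P d} (hX : HasClass X x) (hY : HasClass Y y)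
    (h : AEEqProc P X Y) : x = y :=
  Subtype.ext (Lp.ext ((Filter.EventuallyEq.symm hX).trans (Filter.EventuallyEq.trans h hY)))

lemma HasClass.add {X Y : VProc T Ω d} {x y : HilbertProc 𝓕 P d} (hX : HasClass X x) (hY : HasClass Y y) :
    HasClass (fun t ω => X t ω + Y t ω) (x + y) := by
  have := Lp.coeFn_add (x : Lp (Vec d) 2 (dtP T P)) (y : Lp (Vec d) 2 (dtP T P))
  unfold HasClass at *
  filter_upwards [hX, hY, this] with p h1 h2 h3
  rw [h1, h2]; exact h3.symm

lemma HasClass.sub {X Y : VProc T Ω d} {x y : HilbertProc 𝓕 P d} (hX : HasClass X x) (hY : HasClass Y y) :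
    HasClass (fun t ω => X t ω - Y t ω) (x - y) := by
  have := Lp.coeFn_sub (x : Lp (Vec d) 2 (dtP T P)) (y : Lp (Vec d) 2 (dtP T P))
  unfold HasClass at *
  filter_upwards [hX, hY, this] with p h1 h2 h3
  rw [h1, h2]; exact h3.symm

lemma HasClass.smul {X : VProc T Ω d} {x : HilbertProc 𝓕 P d} (c : ℝ) (hX : HasClass X x) :
    HasClass (fun t ω => c • X t ω) (c • x) := by
  have := Lp.coeFn_smul c (x : Lp (Vec d) 2 (dtP T P))
  unfold HasClass at *
  filter_upwards [hX, this] with p h1 h3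
  rw [h1]; exact h3.symm

lemma HasClass.zero : HasClass (fun _ _ => 0 : VProc T Ω d) (0 : HilbertProc 𝓕 P d) :=
  (Lp.coeFn_zero (Vec d) 2 (dtP T P)).symm

lemma HasClass.sum {ι : Type*} (s : Finset ι) {X : ι → VProc T Ω d} {x : ι → HilbertProc 𝓕 P d}
    (h : ∀ i ∈ s, HasClass (X i) (x i)) :
    HasClass (fun t ω => ∑ i ∈ s, X i t ω) (∑ i ∈ s, x i) := by
  classical
  induction s using Finset.induction_on with
  | empty => simpa using HasClass.zero
  | insert i s hi ih =>
    simp only [Finset.sum_insert hi]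
    exact (h i (Finset.mem_insert_self i s)).add
      (ih fun j hj => h j (Finset.mem_insert_of_mem hj))

lemma HasClass.inner_eq {X Y : VProc T Ω d} {x y : HilbertProc 𝓕 P d} (hX : HasClass X x) (hY : HasClass Y y) :
    (inner ℝ x y : ℝ) = ∫ p, (inner ℝ (X p.1 p.2) (Y p.1 p.2) : ℝ) ∂(dtP T P) := by
  rw [Submodule.coe_inner, L2.inner_def]
  refine integral_congr_ae ?_
  unfold HasClass at *
  filter_upwards [hX, hY] with p h1 h2
  rw [h1, h2]

lemma HasClass.norm_sq_eq {X : VProc T Ω d} {x : HilbertProc 𝓕 P d} (hX : HasClass X x) :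
    ‖x‖ ^ 2 = ∫ p, ‖X p.1 p.2‖ ^ 2 ∂(dtP T P) := by
  rw [← real_inner_self_eq_norm_sq, hX.inner_eq hX]
  simp

/-- A bounded linear operation on processes acts on classes. -/
lemma exists_operator (Φ : VProc T Ω d → VProc T Ω d)
    (hcongr : ∀ X Y, AEEqProc P X Y → AEEqProc P (Φ X) (Φ Y))
    (hadd : ∀ X Y, InH2 𝓕 P X → InH2 𝓕 P Y →
      AEEqProc P (Φ fun t ω => X t ω + Y t ω) fun t ω => Φ X t ω + Φ Y t ω)
    (hsmul : ∀ (c : ℝ) X, InH2 𝓕 P X →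
      AEEqProc P (Φ fun t ω => c • X t ω) fun t ω => c • Φ X t ω)
    (K : ℝ) (hK : 0 ≤ K) (hbound : ∀ X, InH2 𝓕 P X → InH2 𝓕 P (Φ X) ∧
      ∫ p, ‖Φ X p.1 p.2‖ ^ 2 ∂(dtP T P) ≤ K ^ 2 * ∫ p, ‖X p.1 p.2‖ ^ 2 ∂(dtP T P)) :
    ∃ A : HilbertProc 𝓕 P d →L[ℝ] HilbertProc 𝓕 P d, ∀ X x, HasClass X x → HasClass (Φ X) (A x) := by
  have h1 : ∀ x : HilbertProc 𝓕 P d, ∃ y : HilbertProc 𝓕 P d, ∀ X, HasClass X x → HasClass (Φ X) y := by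
    intro x
    obtain ⟨X, hX⟩ := exists_process x
    obtain ⟨y, hy⟩ := (hbound X hX.inH2).1.exists_rep
    exact ⟨y, fun Z hZ => hy.congr (hcongr _ _ (hX.aeEq hZ))⟩
  choose f hf using h1
  let L : HilbertProc 𝓕 P d →ₗ[ℝ] HilbertProc 𝓕 P d :=
    { toFun := f
      map_add' := fun x y => by
        obtain ⟨X, hX⟩ := exists_process x
        obtain ⟨Y, hY⟩ := exists_process y
        exact (hf _ _ (hX.add hY)).eq_of_aeEq ((hf _ _ hX).add (hf _ _ hY))
          (hadd X Y hX.inH2 hY.inH2)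
      map_smul' := fun c x => by
        obtain ⟨X, hX⟩ := exists_process x
        exact (hf _ _ (hX.smul c)).eq_of_aeEq ((hf _ _ hX).smul c) (hsmul c X hX.inH2) }
  refine ⟨L.mkContinuous K fun x => ?_, fun X x hX => hf x X hX⟩
  obtain ⟨X, hX⟩ := exists_process x
  refine le_of_sq_le_sq ?_ (by positivity)
  have h2 : HasClass (Φ X) (L x) := hf x X hX
  rw [mul_pow, h2.norm_sq_eq, hX.norm_sq_eq]
  exact (hbound X hX.inH2).2

lemma cumul_add_ae [IsFiniteMeasure P] {X Y : VProc T Ω d} (hX : IsL2 P X) (hY : IsL2 P Y) :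
    ∀ᵐ ω ∂P, ∀ t, cumul (fun t ω => X t ω + Y t ω) t ω = cumul X t ω + cumul Y t ω := by
  filter_upwards [ae_integrable_path hX.integrable, ae_integrable_path hY.integrable]
    with ω h1 h2 t
  exact integral_add h1.integrableOn h2.integrableOn

lemma cumul_smul {Ω : Type*} (c : ℝ) (X : VProc T Ω d) (t : Horizon T) (ω : Ω) :
    cumul (fun t ω => c • X t ω) t ω = c • cumul X t ω :=
  integral_smul c _

lemma cumul_norm_le_ae [IsFiniteMeasure P] {X : VProc T Ω d} (hX : IsL2 P X) :
    ∀ᵐ ω ∂P, ∀ t, ‖cumul X t ω‖ ≤ ∫ s, ‖X s ω‖ ∂(timeMeasure T) := by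
  filter_upwards [ae_integrable_path hX.integrable] with ω h1 t
  exact norm_primitive_le h1 t

lemma InH2.cumul_bound (hT : 0 < T) [IsFiniteMeasure P] (hnull : ContainsNull 𝓕 P)
    {X : VProc T Ω d} (hX : InH2 𝓕 P X) :
    InH2 𝓕 P (cumul X) ∧ ∫ p, ‖cumul X p.1 p.2‖ ^ 2 ∂(dtP T P)
      ≤ (timeMeasure T).real Set.univ ^ 2 * ∫ p, ‖X p.1 p.2‖ ^ 2 ∂(dtP T P) := by
  have hopt : IsOptional 𝓕 P (cumul X) := hX.1.cumul hT hnull (IsL2.integrable hX.2)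
  have := IsL2.of_norm_le hX.2 (hopt.mono (optionalSigma_le hT 𝓕)) (cumul_norm_le_ae hX.2)
  exact ⟨⟨hopt, this.1⟩, this.2⟩

lemma exists_opC (hT : 0 < T) [IsFiniteMeasure P] (hnull : ContainsNull 𝓕 P) :
    ∃ C : HilbertProc 𝓕 P d →L[ℝ] HilbertProc 𝓕 P d, ∀ X x, HasClass X x → HasClass (cumul X) (C x) :=
  exists_operator cumul (fun _ _ h => AEEqProc.of_forall h.cumul_eq)
    (fun _ _ hX hY => AEEqProc.of_forall (cumul_add_ae hX.2 hY.2))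
    (fun c X _ => ae_of_all _ fun p => cumul_smul c X p.1 p.2) _ measureReal_nonneg
    fun _ hX => hX.cumul_bound hT hnull

lemma continuous_act (A : Matrix (Fin d) (Fin d) ℝ) : Continuous (act A) :=
  (Matrix.toEuclideanCLM (n := Fin d) (𝕜 := ℝ) A).continuous

lemma norm_act_le (A : Matrix (Fin d) (Fin d) ℝ) (x : Vec d) :
    ‖act A x‖ ≤ ‖Matrix.toEuclideanCLM (n := Fin d) (𝕜 := ℝ) A‖ * ‖x‖ :=
  (Matrix.toEuclideanCLM (n := Fin d) (𝕜 := ℝ) A).le_opNorm x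

lemma InH2.of_norm_le_mul (hT : 0 < T) {X Y : VProc T Ω d} (hX : InH2 𝓕 P X)
    (hY : IsOptional 𝓕 P Y) (K : ℝ) (h : ∀ᵐ p ∂(dtP T P), ‖Y p.1 p.2‖ ≤ K * ‖X p.1 p.2‖) :
    InH2 𝓕 P Y ∧ ∫ p, ‖Y p.1 p.2‖ ^ 2 ∂(dtP T P) ≤ K ^ 2 * ∫ p, ‖X p.1 p.2‖ ^ 2 ∂(dtP T P) := by
  have hY2 : IsL2 P Y := MemLp.of_le_mul (c := K) hX.2 (hY.mono (optionalSigma_le hT 𝓕)) h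
  refine ⟨⟨hY, hY2⟩, ?_⟩
  rw [← integral_const_mul]
  refine integral_mono_ae (hY2.integrable_norm_pow (by norm_num))
    ((MemLp.integrable_norm_pow hX.2 (by norm_num)).const_mul _) ?_
  filter_upwards [h] with p hp
  rw [← mul_pow]
  exact pow_le_pow_left₀ (norm_nonneg _) hp 2

lemma exists_opA (hT : 0 < T) (A : Matrix (Fin d) (Fin d) ℝ) :
    ∃ B : HilbertProc 𝓕 P d →L[ℝ] HilbertProc 𝓕 P d, ∀ X x, HasClass X x →
      HasClass (fun t ω => act A (X t ω)) (B x) :=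
  exists_operator (fun X t ω => act A (X t ω))
    (fun X Y h => by filter_upwards [h] with p hp; simp only [hp])
    (fun X Y _ _ => ae_of_all _ fun p => by simp [act])
    (fun c X _ => ae_of_all _ fun p => by simp [act])
    ‖Matrix.toEuclideanCLM (n := Fin d) (𝕜 := ℝ) A‖ (norm_nonneg _)
    fun X hX => hX.of_norm_le_mul hT (Y := fun t ω => act A (X t ω)) ((continuous_act A).comp_aestronglyMeasurable hX.1) _
      (ae_of_all _ fun p => norm_act_le A _)

lemma exists_opMul (hT : 0 < T) (α : C(Horizon T, ℝ)) :
    ∃ B : HilbertProc 𝓕 P d →L[ℝ] HilbertProc 𝓕 P d, ∀ X x, HasClass X x →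
      HasClass (fun t ω => α t • X t ω) (B x) :=
  exists_operator (fun X t ω => α t • X t ω)
    (fun X Y h => by filter_upwards [h] with p hp; simp only [hp])
    (fun X Y _ _ => ae_of_all _ fun p => by simp)
    (fun c X _ => ae_of_all _ fun p => smul_comm _ _ _)
    ‖α‖ (norm_nonneg _)
    fun X hX => hX.of_norm_le_mul hT (Y := fun t ω => α t • X t ω)
      (AEStronglyMeasurable.fun_smul (measurable_time_optional
        α.continuous).stronglyMeasurable.aestronglyMeasurable hX.1) _
      (ae_of_all _ fun p => by
        rw [norm_smul]
        exact mul_le_mul_of_nonneg_right (α.norm_coe_le_norm p.1) (norm_nonneg _))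

end Hilbert

/-! ### Operators on the Hilbert space -/

section Operators

variable {T : ℝ} {Ω : Type*} {d : ℕ} [mΩ : MeasurableSpace Ω]
  {𝓕 : Filtration (Horizon T) mΩ} {P : Measure Ω}

/-- The primitive, as an operator. -/
def opC (hT : 0 < T) [IsFiniteMeasure P] (hnull : ContainsNull 𝓕 P) :
    HilbertProc 𝓕 P d →L[ℝ] HilbertProc 𝓕 P d :=
  (exists_opC hT hnull).choose

/-- The action of a matrix, as an operator. -/
def opA (hT : 0 < T) (A : Matrix (Fin d) (Fin d) ℝ) :
    HilbertProc 𝓕 P d →L[ℝ] HilbertProc 𝓕 P d :=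
  (exists_opA hT A).choose

/-- The multiplication by a function of time, as an operator. -/
def opMul (hT : 0 < T) (α : C(Horizon T, ℝ)) : HilbertProc 𝓕 P d →L[ℝ] HilbertProc 𝓕 P d :=
  (exists_opMul hT α).choose

lemma HasClass.opC {hT : 0 < T} [IsFiniteMeasure P] {hnull : ContainsNull 𝓕 P}
    {X : VProc T Ω d} {x : HilbertProc 𝓕 P d} (h : HasClass X x) :
    HasClass (cumul X) (opC hT hnull x) :=
  (exists_opC hT hnull).choose_spec X x h

lemma HasClass.opA {hT : 0 < T} (A : Matrix (Fin d) (Fin d) ℝ)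
    {X : VProc T Ω d} {x : HilbertProc 𝓕 P d} (h : HasClass X x) :
    HasClass (fun t ω => act A (X t ω)) (opA hT A x) :=
  (exists_opA hT A).choose_spec X x h

lemma HasClass.opMul {hT : 0 < T} (α : C(Horizon T, ℝ))
    {X : VProc T Ω d} {x : HilbertProc 𝓕 P d} (h : HasClass X x) :
    HasClass (fun t ω => α t • X t ω) (opMul hT α x) :=
  (exists_opMul hT α).choose_spec X x h

variable {hT : 0 < T}

lemma act_mul (A B : Matrix (Fin d) (Fin d) ℝ) (x : Vec d) : act (A * B) x = act A (act B x) := by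
  simp [act]

lemma act_one (x : Vec d) : act 1 x = x := by
  simp [act]

lemma act_smul (A : Matrix (Fin d) (Fin d) ℝ) (c : ℝ) (x : Vec d) :
    act A (c • x) = c • act A x := by
  simp [act]

lemma act_add (A : Matrix (Fin d) (Fin d) ℝ) (x y : Vec d) :
    act A (x + y) = act A x + act A y := by
  simp [act]

lemma act_sub (A : Matrix (Fin d) (Fin d) ℝ) (x y : Vec d) :
    act A (x - y) = act A x - act A y := by
  simp [act]

lemma inner_act_left {A : Matrix (Fin d) (Fin d) ℝ} (hA : A.IsHermitian) (x y : Vec d) :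
    (inner ℝ (act A x) y : ℝ) = inner ℝ x (act A y) := by
  have h : star (Matrix.toEuclideanCLM (n := Fin d) (𝕜 := ℝ) A)
      = Matrix.toEuclideanCLM (n := Fin d) (𝕜 := ℝ) A := by
    rw [← map_star, Matrix.star_eq_conjTranspose, hA.eq]
  rw [act, ← h, ContinuousLinearMap.star_eq_adjoint, ContinuousLinearMap.adjoint_inner_left]
  rfl

lemma exists_posDef_lower_bound {A : Matrix (Fin d) (Fin d) ℝ} (hA : A.PosDef) :
    ∃ c : ℝ, 0 < c ∧ ∀ x : Vec d, c * ‖x‖ ^ 2 ≤ inner ℝ x (act A x) := by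
  have hpos : ∀ x : Vec d, x ≠ 0 → 0 < (inner ℝ x (act A x) : ℝ) := by
    intro x hx
    have h := hA.dotProduct_mulVec_pos (x := x.ofLp) (by simpa using hx)
    rw [EuclideanSpace.inner_eq_star_dotProduct, dotProduct_comm]
    simpa [act] using h
  have hcont : Continuous fun x : Vec d => (inner ℝ x (act A x) : ℝ) :=
    continuous_id.inner (continuous_act A)
  -- The sphere is empty exactly when d = 0, where every vector is zero. Otherwise the constant is
  -- the minimum of the quadratic form on the compact sphere.
  rcases (Metric.sphere (0 : Vec d) 1).eq_empty_or_nonempty with he | hne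
  · refine ⟨1, one_pos, fun x => ?_⟩
    have hx : x = 0 := by
      by_contra hx
      have : ‖x‖⁻¹ • x ∈ Metric.sphere (0 : Vec d) 1 := by
        simp [norm_smul, inv_mul_cancel₀ (norm_ne_zero_iff.2 hx)]
      rw [he] at this
      exact this
    simp [hx]
  · obtain ⟨y, hy, hmin⟩ := (isCompact_sphere (0 : Vec d) 1).exists_isMinOn hne hcont.continuousOn
    have hy1 : ‖y‖ = 1 := by simpa using hy
    have hy0 : y ≠ 0 := by rintro rfl; simp at hy1
    refine ⟨_, hpos y hy0, fun x => ?_⟩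
    rcases eq_or_ne x 0 with rfl | hx
    · simp
    have hxn : ‖x‖ ≠ 0 := norm_ne_zero_iff.2 hx
    have hmem : ‖x‖⁻¹ • x ∈ Metric.sphere (0 : Vec d) 1 := by
      simp [norm_smul, inv_mul_cancel₀ hxn]
    have h := hmin hmem
    simp only [Set.mem_ofPred_eq, act_smul, real_inner_smul_left, real_inner_smul_right] at h
    calc _ ≤ ‖x‖⁻¹ * (‖x‖⁻¹ * inner ℝ x (act A x)) * ‖x‖ ^ 2 :=
          mul_le_mul_of_nonneg_right h (by positivity)
      _ = _ := by field_simp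

lemma opA_opMul (A : Matrix (Fin d) (Fin d) ℝ) (α : C(Horizon T, ℝ)) (x : HilbertProc 𝓕 P d) :
    opA hT A (opMul hT α x) = opMul hT α (opA hT A x) := by
  obtain ⟨X, hX⟩ := exists_process x
  exact ((hX.opMul α).opA A).eq_of_aeEq ((hX.opA A).opMul α)
    (ae_of_all _ fun p => act_smul _ _ _)

lemma opA_opA (A B : Matrix (Fin d) (Fin d) ℝ) (x : HilbertProc 𝓕 P d) :
    opA hT A (opA hT B x) = opA hT (A * B) x := by
  obtain ⟨X, hX⟩ := exists_process x
  exact ((hX.opA B).opA A).eq_of_aeEq (hX.opA (A * B)) (ae_of_all _ fun p => (act_mul _ _ _).symm)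

lemma opA_one (x : HilbertProc 𝓕 P d) : opA hT 1 x = x := by
  obtain ⟨X, hX⟩ := exists_process x
  exact (hX.opA 1).eq_of_aeEq hX (ae_of_all _ fun p => act_one _)

lemma cumul_act_ae [IsFiniteMeasure P] (A : Matrix (Fin d) (Fin d) ℝ) {X : VProc T Ω d}
    (hX : IsL2 P X) :
    ∀ᵐ ω ∂P, ∀ t, cumul (fun t ω => act A (X t ω)) t ω = act A (cumul X t ω) := by
  filter_upwards [ae_integrable_path hX.integrable] with ω h1 t
  exact (Matrix.toEuclideanCLM (n := Fin d) (𝕜 := ℝ) A).integral_comp_comm h1.integrableOn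

lemma inner_opA_left {A : Matrix (Fin d) (Fin d) ℝ} (hA : A.IsHermitian)
    (x y : HilbertProc 𝓕 P d) :
    (inner ℝ (opA hT A x) y : ℝ) = inner ℝ x (opA hT A y) := by
  obtain ⟨X, hX⟩ := exists_process x
  obtain ⟨Y, hY⟩ := exists_process y
  rw [(hX.opA A).inner_eq hY, hX.inner_eq (hY.opA A)]
  simp only [inner_act_left hA]

lemma inner_opMul_left (α : C(Horizon T, ℝ)) (x y : HilbertProc 𝓕 P d) :
    (inner ℝ (opMul hT α x) y : ℝ) = inner ℝ x (opMul hT α y) := by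
  obtain ⟨X, hX⟩ := exists_process x
  obtain ⟨Y, hY⟩ := exists_process y
  rw [(hX.opMul α).inner_eq hY, hX.inner_eq (hY.opMul α)]
  simp only [real_inner_smul_left, real_inner_smul_right]

lemma le_inner_opMul_opA {A : Matrix (Fin d) (Fin d) ℝ} {α : C(Horizon T, ℝ)} {c₁ c₂ : ℝ}
    (h₁ : 0 ≤ c₁) (h₂ : 0 ≤ c₂) (hα : ∀ t, c₁ ≤ α t)
    (hA : ∀ x : Vec d, c₂ * ‖x‖ ^ 2 ≤ inner ℝ x (act A x)) (x : HilbertProc 𝓕 P d) :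
    c₁ * c₂ * ‖x‖ ^ 2 ≤ (inner ℝ (opMul hT α x) (opA hT A x) : ℝ) := by
  obtain ⟨X, hX⟩ := exists_process x
  have h3 : IsL2 P X := hX.inH2.2
  have h4 : IsL2 P (fun t ω => α t • X t ω) := (hX.opMul (hT := hT) α).inH2.2
  have h5 : IsL2 P (fun t ω => act A (X t ω)) := (hX.opA (hT := hT) A).inH2.2
  have h6 : Integrable (fun p : Horizon T × Ω => c₁ * c₂ * ‖X p.1 p.2‖ ^ 2) (dtP T P) :=
    (MemLp.integrable_norm_pow h3 (by norm_num)).const_mul _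
  have h7 := IsL2.integrable_inner h4 h5
  have h8 : ∀ (t : Horizon T) (y : Vec d),
      c₁ * c₂ * ‖y‖ ^ 2 ≤ (inner ℝ (α t • y) (act A y) : ℝ) := fun t y => by
    rw [real_inner_smul_left, mul_assoc]
    exact mul_le_mul (hα t) (hA y) (by positivity) (h₁.trans (hα t))
  rw [(hX.opMul α).inner_eq (hX.opA A), hX.norm_sq_eq, ← integral_const_mul]
  exact integral_mono_ae h6 h7 (ae_of_all _ fun p => h8 p.1 (X p.1 p.2))

lemma ae_smul_cumul [IsFiniteMeasure P] {α α' : C(Horizon T, ℝ)} (hα : HasRate α α')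
    (hT : 0 < T) {X : VProc T Ω d} (hX : IsL2 P X) :
    ∀ᵐ ω ∂P, ∀ t, α t • cumul X t ω
      = cumul (fun t ω => α t • X t ω + α' t • cumul X t ω) t ω := by
  filter_upwards [ae_integrable_path hX.integrable] with ω h1 t
  exact hα.smul_primitive hT h1 t

lemma opMul_opC [IsFiniteMeasure P] {hnull : ContainsNull 𝓕 P} {α α' : C(Horizon T, ℝ)}
    (hα : HasRate α α') (x : HilbertProc 𝓕 P d) :
    opMul hT α (opC hT hnull x)
      = opC hT hnull (opMul hT α x + opMul hT α' (opC hT hnull x)) := by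
  obtain ⟨X, hX⟩ := exists_process x
  exact (hX.opC.opMul α).eq_of_aeEq (((hX.opMul α).add (hX.opC.opMul α')).opC)
    (AEEqProc.of_forall (ae_smul_cumul hα hT hX.inH2.2))

/-- Argued path by path: a primitive that vanishes a.e. is identically zero by continuity, and then
so is its derivative a.e. -/
lemma opC_injective [IsFiniteMeasure P] {hnull : ContainsNull 𝓕 P} {x : HilbertProc 𝓕 P d}
    (h : opC hT hnull x = 0) : x = 0 := by
  obtain ⟨X, hX⟩ := exists_process x
  have h1 : HasClass (cumul X) (0 : HilbertProc 𝓕 P d) := h ▸ hX.opC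
  have h2 := (h1.aeEq HasClass.zero).ae_ae
  rw [← norm_eq_zero, ← sq_eq_zero_iff, hX.norm_sq_eq, dtP, integral_prod_symm]
  · refine integral_eq_zero_of_ae ?_
    filter_upwards [h2, ae_integrable_path (IsL2.integrable hX.inH2.2)] with ω h2 h3
    have h4 := ae_eq_zero_of_primitive_ae_eq_zero hT h3 h2
    refine integral_eq_zero_of_ae ?_
    filter_upwards [h4] with t ht
    have ht' : X t ω = 0 := ht
    simp [ht']
  · exact hX.inH2.2.integrable_norm_pow (by norm_num)

/-- Equivalently, the range of C is dense. Among all measurable processes the adjoint of C sends x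
to I - Cx, with I the integral of x over the whole horizon; I is not adapted, so this is not an
element of the space. Two test directions suffice instead. Testing with x gives E‖I‖² = 2⟨x, Cx⟩ =
0, so I = 0; testing with Cx then gives ‖Cx‖² = 0, and C is injective. -/
lemma opC_adjoint_injective [IsFiniteMeasure P] {hnull : ContainsNull 𝓕 P}
    {x : HilbertProc 𝓕 P d} (h : ∀ v, (inner ℝ (opC hT hnull v) x : ℝ) = 0) : x = 0 := by
  obtain ⟨X, hX⟩ := exists_process x
  have hL2 : IsL2 P X := hX.inH2.2
  have hCL2 : IsL2 P (cumul X) := (hX.opC (hT := hT) (hnull := hnull)).inH2.2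
  set I : Ω → Vec d := fun ω => ∫ t, X t ω ∂(timeMeasure T) with hI
  have hIm : AEStronglyMeasurable I P := AEStronglyMeasurable.integral_prod_right' (μ := P)
    (ν := timeMeasure T) (f := fun q : Ω × Horizon T => X q.2 q.1) (by
      have h0 : AEStronglyMeasurable (fun p : Horizon T × Ω => X p.1 p.2)
        ((timeMeasure T).prod P) := hL2.1
      exact h0.prod_swap)
  have hIL2 : IsL2 P (fun _ ω => I ω : VProc T Ω d) := by
    refine (hL2.of_norm_le (Y := fun _ ω => I ω) ?_ ?_).1
    · exact hIm.comp_snd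
    · exact ae_of_all _ fun ω _ => norm_integral_le_integral_norm _
  have hII : ∀ {V : VProc T Ω d}, IsL2 P V → IsL2 P (cumul V) →
      ∫ p, (inner ℝ (cumul V p.1 p.2) (X p.1 p.2) : ℝ) ∂(dtP T P)
        = (∫ p, (inner ℝ (V p.1 p.2) (I p.2) : ℝ) ∂(dtP T P))
          - ∫ p, (inner ℝ (V p.1 p.2) (cumul X p.1 p.2) : ℝ) ∂(dtP T P) := by
    intro V hV hCV
    rw [integral_inner_cumul hV hL2 hCV, ← integral_sub (hV.integrable_inner hIL2)
      (hV.integrable_inner hCL2)]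
    have h1 : Integrable (fun p : Horizon T × Ω => (inner ℝ (V p.1 p.2) (I p.2) : ℝ)
        - inner ℝ (V p.1 p.2) (cumul X p.1 p.2)) ((timeMeasure T).prod P) :=
      (hV.integrable_inner hIL2).sub (hV.integrable_inner hCL2)
    rw [dtP, integral_prod_symm _ h1]
    simp only [inner_sub_right, hI]
  have e1 : ∫ p, (inner ℝ (cumul X p.1 p.2) (X p.1 p.2) : ℝ) ∂(dtP T P) = 0 := by
    rw [← (hX.opC (hT := hT) (hnull := hnull)).inner_eq hX]; exact h x
  have e2 : ∫ p, (inner ℝ (X p.1 p.2) (cumul X p.1 p.2) : ℝ) ∂(dtP T P) = 0 := by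
    refine Eq.trans ?_ e1
    exact integral_congr_ae (ae_of_all _ fun p => real_inner_comm _ _)
  have e3 : ∫ p, (inner ℝ (X p.1 p.2) (I p.2) : ℝ) ∂(dtP T P) = ∫ ω, ‖I ω‖ ^ 2 ∂P := by
    have h1 : Integrable (fun p : Horizon T × Ω => (inner ℝ (X p.1 p.2) (I p.2) : ℝ))
      ((timeMeasure T).prod P) := hL2.integrable_inner hIL2
    rw [dtP, integral_prod_symm _ h1]
    refine integral_congr_ae ?_
    filter_upwards [ae_integrable_path hL2.integrable] with ω h2
    rw [← real_inner_self_eq_norm_sq]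
    refine Eq.trans ?_ (integral_inner h2 (I ω))
    exact integral_congr_ae (ae_of_all _ fun p => real_inner_comm _ _)
  have e4 : ∫ ω, ‖I ω‖ ^ 2 ∂P = 0 := by
    have := hII hL2 hCL2
    linarith
  have hI0 : I =ᵐ[P] 0 := by
    have h1 : Integrable (fun ω => ‖I ω‖ ^ 2) P := by
      refine (hL2.integrable_integral_sq.const_mul ((timeMeasure T).real Set.univ)).mono'
        (hIm.norm.pow 2) ?_
      filter_upwards [hL2.ae_path] with ω h2
      rw [Real.norm_of_nonneg (by positivity)]
      exact (pow_le_pow_left₀ (norm_nonneg _) (norm_integral_le_integral_norm _) 2).trans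
        (sq_integral_norm_le h2)
    have h2 := (integral_eq_zero_iff_of_nonneg (fun ω => by positivity) h1).1 e4
    filter_upwards [h2] with ω hω
    simpa using hω
  have e5 : ‖opC hT hnull x‖ ^ 2 = 0 := by
    have hCC := (hX.opC (hT := hT) (hnull := hnull)).opC (hT := hT) (hnull := hnull)
    have h1 := hII hCL2 hCC.inH2.2
    rw [← hCC.inner_eq hX, h (opC hT hnull x)] at h1
    have h2 : ∫ p, (inner ℝ (cumul X p.1 p.2) (I p.2) : ℝ) ∂(dtP T P) = 0 := by
      refine integral_eq_zero_of_ae ?_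
      have h3 : ∀ᵐ p : Horizon T × Ω ∂(dtP T P), I p.2 = 0 :=
        Measure.quasiMeasurePreserving_snd.ae hI0
      filter_upwards [h3] with p hp
      simp [hp]
    rw [h2, zero_sub, zero_eq_neg] at h1
    rw [hX.opC.norm_sq_eq]
    simpa only [real_inner_self_eq_norm_sq] using h1
  exact opC_injective (norm_eq_zero.1 (sq_eq_zero_iff.1 e5))

end Operators

/-! ### Bounded processes and the class `𝒜` -/

section ClassA

variable {T : ℝ} {Ω : Type*} {d : ℕ} [mΩ : MeasurableSpace Ω]
  {𝓕 : Filtration (Horizon T) mΩ} {P : Measure Ω}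

lemma InHInf.inH2 (hT : 0 < T) [IsFiniteMeasure P] {X : VProc T Ω d} (h : InHInf 𝓕 P X) :
    InH2 𝓕 P X := by
  obtain ⟨h1, C, hC⟩ := h
  exact ⟨h1, MemLp.of_bound (h1.mono (optionalSigma_le hT 𝓕)) C hC⟩

lemma InHInf.congr {X Y : VProc T Ω d} (h : InHInf 𝓕 P X) (hXY : AEEqProc P X Y) :
    InHInf 𝓕 P Y := by
  obtain ⟨h1, C, hC⟩ := h
  refine ⟨h1.congr hXY, C, ?_⟩
  filter_upwards [hC, hXY] with p h1 h2
  rwa [← h2]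

lemma InHInf.add {X Y : VProc T Ω d} (hX : InHInf 𝓕 P X) (hY : InHInf 𝓕 P Y) :
    InHInf 𝓕 P fun t ω => X t ω + Y t ω := by
  obtain ⟨h1, C, hC⟩ := hX
  obtain ⟨h2, D, hD⟩ := hY
  refine ⟨AEStronglyMeasurable.add h1 h2, C + D, ?_⟩
  filter_upwards [hC, hD] with p h1 h2
  exact (norm_add_le _ _).trans (add_le_add h1 h2)

lemma InHInf.act (A : Matrix (Fin d) (Fin d) ℝ) {X : VProc T Ω d} (hX : InHInf 𝓕 P X) :
    InHInf 𝓕 P fun t ω => act A (X t ω) := by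
  obtain ⟨h1, C, hC⟩ := hX
  refine ⟨(continuous_act A).comp_aestronglyMeasurable h1,
    ‖Matrix.toEuclideanCLM (n := Fin d) (𝕜 := ℝ) A‖ * C, ?_⟩
  filter_upwards [hC] with p h1
  exact (norm_act_le A _).trans (mul_le_mul_of_nonneg_left h1 (norm_nonneg _))

lemma InHInf.mul (α : C(Horizon T, ℝ)) {X : VProc T Ω d} (hX : InHInf 𝓕 P X) :
    InHInf 𝓕 P fun t ω => α t • X t ω := by
  obtain ⟨h1, C, hC⟩ := hX
  refine ⟨AEStronglyMeasurable.fun_smul (measurable_time_optional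
        α.continuous).stronglyMeasurable.aestronglyMeasurable h1, ‖α‖ * C, ?_⟩
  filter_upwards [hC] with p h1
  rw [norm_smul]
  exact mul_le_mul (α.norm_coe_le_norm p.1) h1 (norm_nonneg _) (norm_nonneg _)

lemma InHInf.smul (c : ℝ) {X : VProc T Ω d} (hX : InHInf 𝓕 P X) :
    InHInf 𝓕 P fun t ω => c • X t ω :=
  hX.mul (ContinuousMap.const _ c)

lemma InHInf.sub {X Y : VProc T Ω d} (hX : InHInf 𝓕 P X) (hY : InHInf 𝓕 P Y) :
    InHInf 𝓕 P fun t ω => X t ω - Y t ω := by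
  simpa [sub_eq_add_neg] using hX.add (hY.smul (-1))

lemma InHInf.zero : InHInf 𝓕 P (fun _ _ => 0 : VProc T Ω d) :=
  ⟨aestronglyMeasurable_const, 0, ae_of_all _ fun _ => by simp⟩

lemma InHInf.exists_cumul_bound (hT : 0 < T) [IsFiniteMeasure P] {X : VProc T Ω d}
    (hX : InHInf 𝓕 P X) : ∃ K : ℝ, ∀ᵐ ω ∂P, ∀ t, ‖_root_.cumul X t ω‖ ≤ K := by
  have hL2 : IsL2 P X := (hX.inH2 hT).2
  obtain ⟨h1, C, hC⟩ := hX
  refine ⟨C * (timeMeasure T).real Set.univ, ?_⟩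
  have h2 : ∀ᵐ ω ∂P, ∀ᵐ t ∂(timeMeasure T), ‖X t ω‖ ≤ C := by
    have h' : ∀ᵐ p ∂(timeMeasure T).prod P, ‖X p.1 p.2‖ ≤ C := hC
    rw [← Measure.prod_swap] at h'
    exact Measure.ae_ae_of_ae_prod (ae_of_ae_map measurable_swap.aemeasurable h')
  filter_upwards [h2, cumul_norm_le_ae hL2, ae_integrable_path hL2.integrable]
    with ω h2 h3 h4 t
  refine (h3 t).trans ((integral_mono_ae h4.norm (integrable_const C) h2).trans_eq ?_)
  rw [integral_const, smul_eq_mul, mul_comm]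

lemma InHInf.of_forall_bound {X : VProc T Ω d} (hX : IsOptional 𝓕 P X) {K : ℝ}
    (h : ∀ᵐ ω ∂P, ∀ t, ‖X t ω‖ ≤ K) : InHInf 𝓕 P X := by
  refine ⟨hX, K, ?_⟩
  have h4 : ∀ᵐ p : Horizon T × Ω ∂(dtP T P), ∀ t, ‖X t p.2‖ ≤ K :=
    Measure.quasiMeasurePreserving_snd.ae h
  filter_upwards [h4] with p hp using hp p.1

lemma InHInf.cumul (hT : 0 < T) [IsFiniteMeasure P] (hnull : ContainsNull 𝓕 P)
    {X : VProc T Ω d} (hX : InHInf 𝓕 P X) : InHInf 𝓕 P (cumul X) := by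
  obtain ⟨K, hK⟩ := hX.exists_cumul_bound hT
  exact InHInf.of_forall_bound (hX.1.cumul hT hnull (IsL2.integrable (hX.inH2 hT).2)) hK

/-- `X` belongs to `𝒜` and has drift `a`. -/
def HasDrift (𝓕 : Filtration (Horizon T) mΩ) (P : Measure Ω) (X a : VProc T Ω d) : Prop :=
  ∃ M, IsClassA 𝓕 P X a M

lemma IsClassA.act [IsFiniteMeasure P] (hT : 0 < T) (A : Matrix (Fin d) (Fin d) ℝ)
    {X a M : VProc T Ω d} (h : IsClassA 𝓕 P X a M) :
    IsClassA 𝓕 P (fun t ω => act A (X t ω)) (fun t ω => _root_.act A (a t ω))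
      (fun t ω => _root_.act A (M t ω)) where
  mem := h.mem.act A
  continuous_paths := by
    filter_upwards [h.continuous_paths] with ω hω using (continuous_act A).comp hω
  drift_mem := h.drift_mem.act A
  mart_mem := h.mart_mem.act A
  mart := by
    refine ⟨fun t => (continuous_act A).comp_stronglyMeasurable (h.mart.1 t), fun s t hst => ?_⟩
    have h1 := (Matrix.toEuclideanCLM (n := Fin d) (𝕜 := ℝ) A).comp_condExp_comm
      (h.mart.integrable t) (m := 𝓕 s)
    filter_upwards [h1, h.mart.2 s t hst] with ω h1 h2
    rw [← h2]
    exact h1.symm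
  decomposition := by
    filter_upwards [h.decomposition,
      ae_integrable_path (IsL2.integrable (h.drift_mem.inH2 hT).2)] with ω h1 h2 s t hst
    have h3 : ∫ τ in Set.Ioc s t, _root_.act A (a τ ω) ∂(timeMeasure T)
        = _root_.act A (∫ τ in Set.Ioc s t, a τ ω ∂(timeMeasure T)) :=
      (Matrix.toEuclideanCLM (n := Fin d) (𝕜 := ℝ) A).integral_comp_comm h2.integrableOn
    rw [h3, ← act_sub, h1 s t hst, act_add, act_sub]
  terminal := by
    filter_upwards [h.terminal] with ω h1 t ht
    rw [h1 t ht]; simp [_root_.act]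

lemma IsClassA.add [IsFiniteMeasure P] (hT : 0 < T) {X a M Y b N : VProc T Ω d}
    (h : IsClassA 𝓕 P X a M) (h' : IsClassA 𝓕 P Y b N) :
    IsClassA 𝓕 P (fun t ω => X t ω + Y t ω) (fun t ω => a t ω + b t ω)
      (fun t ω => M t ω + N t ω) where
  mem := h.mem.add h'.mem
  continuous_paths := by
    filter_upwards [h.continuous_paths, h'.continuous_paths] with ω h1 h2 using h1.add h2
  drift_mem := h.drift_mem.add h'.drift_mem
  mart_mem := h.mart_mem.add h'.mart_mem
  mart := h.mart.add h'.mart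
  decomposition := by
    filter_upwards [h.decomposition, h'.decomposition,
      ae_integrable_path (IsL2.integrable (h.drift_mem.inH2 hT).2),
      ae_integrable_path (IsL2.integrable (h'.drift_mem.inH2 hT).2)] with ω h1 h2 h3 h4 s t hst
    rw [integral_add h3.integrableOn h4.integrableOn, add_sub_add_comm, h1 s t hst, h2 s t hst]
    abel
  terminal := by
    filter_upwards [h.terminal, h'.terminal] with ω h1 h2 t ht
    rw [h1 t ht, h2 t ht, add_zero]

lemma HasDrift.act [IsFiniteMeasure P] (hT : 0 < T) (A : Matrix (Fin d) (Fin d) ℝ)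
    {X a : VProc T Ω d} (h : HasDrift 𝓕 P X a) :
    HasDrift 𝓕 P (fun t ω => act A (X t ω)) (fun t ω => _root_.act A (a t ω)) := by
  obtain ⟨M, hM⟩ := h
  exact ⟨_, hM.act hT A⟩

lemma HasDrift.add [IsFiniteMeasure P] (hT : 0 < T) {X a Y b : VProc T Ω d}
    (h : HasDrift 𝓕 P X a) (h' : HasDrift 𝓕 P Y b) :
    HasDrift 𝓕 P (fun t ω => X t ω + Y t ω) (fun t ω => a t ω + b t ω) := by
  obtain ⟨M, hM⟩ := h
  obtain ⟨N, hN⟩ := h'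
  exact ⟨_, hM.add hT hN⟩

lemma HasDrift.smul [IsFiniteMeasure P] (hT : 0 < T) (c : ℝ)
    {X a : VProc T Ω d} (h : HasDrift 𝓕 P X a) :
    HasDrift 𝓕 P (fun t ω => c • X t ω) (fun t ω => c • a t ω) := by
  have h1 : ∀ x : Vec d, _root_.act (c • 1) x = c • x := fun x => by simp [_root_.act]
  simpa only [h1] using h.act hT (c • 1)

lemma HasDrift.zero : HasDrift 𝓕 P (fun _ _ => 0 : VProc T Ω d) (fun _ _ => 0) :=
  ⟨fun _ _ => 0, InHInf.zero, ae_of_all _ fun _ => continuous_const, InHInf.zero, InHInf.zero,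
    martingale_zero _ _ _, ae_of_all _ fun _ _ _ _ => by simp, ae_of_all _ fun _ _ _ => rfl⟩

lemma HasDrift.sum [IsFiniteMeasure P] (hT : 0 < T) {ι : Type*} (s : Finset ι)
    {X a : ι → VProc T Ω d} (h : ∀ i ∈ s, HasDrift 𝓕 P (X i) (a i)) :
    HasDrift 𝓕 P (fun t ω => ∑ i ∈ s, X i t ω) (fun t ω => ∑ i ∈ s, a i t ω) := by
  classical
  induction s using Finset.induction_on with
  | empty => simpa using HasDrift.zero
  | insert i s hi ih =>
    simp only [Finset.sum_insert hi]
    exact (h i (Finset.mem_insert_self i s)).add hT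
      (ih fun j hj => h j (Finset.mem_insert_of_mem hj))

lemma HasDrift.mem {X a : VProc T Ω d} (h : HasDrift 𝓕 P X a) : InHInf 𝓕 P X :=
  h.choose_spec.mem

lemma HasDrift.drift_mem {X a : VProc T Ω d} (h : HasDrift 𝓕 P X a) : InHInf 𝓕 P a :=
  h.choose_spec.drift_mem

/-- Absolutely continuous bounded elements of `𝒜`. -/
lemma hasDrift_mul_cumul [IsFiniteMeasure P] (hT : 0 < T) (hnull : ContainsNull 𝓕 P)
    {α α' : C(Horizon T, ℝ)} (hα : HasRate α α') (hα0 : α (lastTime hT) = 0)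
    {g : VProc T Ω d} (hg : InHInf 𝓕 P g) :
    HasDrift 𝓕 P (fun t ω => α t • cumul g t ω)
      (fun t ω => α t • g t ω + α' t • cumul g t ω) := by
  have hCg : InHInf 𝓕 P (cumul g) := hg.cumul hT hnull
  have hL2 : IsL2 P g := (hg.inH2 hT).2
  refine ⟨fun _ _ => 0, hCg.mul α, ?_, (hg.mul α).add (hCg.mul α'), InHInf.zero,
    martingale_zero _ _ _, ?_, ?_⟩
  · filter_upwards [ae_integrable_path hL2.integrable] with ω h1
    exact α.continuous.smul (continuous_primitive h1)
  · filter_upwards [ae_integrable_path hL2.integrable,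
      ae_integrable_path (X := fun t ω => α t • g t ω + α' t • cumul g t ω) (IsL2.integrable
        (X := fun t ω => α t • g t ω + α' t • cumul g t ω)
        (((hg.mul α).add (hCg.mul α')).inH2 hT).2),
      ae_smul_cumul hα hT hL2] with ω h1 h2 h3 s t hst
    rw [h3 t, h3 s, sub_self, add_zero]
    exact primitive_sub_primitive h2 hst
  · refine ae_of_all _ fun ω t ht => ?_
    have : t = lastTime hT := Subtype.ext ht
    rw [this, hα0, zero_smul]

/-- The known factor comes out of the conditional expectation. Used with g a future increment of a
martingale. -/
lemma integral_inner_eq_zero_of_condExp [IsFiniteMeasure P] {m : MeasurableSpace Ω} (hm : m ≤ mΩ)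
    {f g : Ω → Vec d} (hf : StronglyMeasurable[m] f)
    (hfg : Integrable (fun ω => (inner ℝ (f ω) (g ω) : ℝ)) P) (hg : Integrable g P)
    (h0 : P[g | m] =ᵐ[P] 0) : ∫ ω, (inner ℝ (f ω) (g ω) : ℝ) ∂P = 0 := by
  have h1 := condExp_bilin_of_stronglyMeasurable_left (innerSL ℝ (E := Vec d)) hf hfg hg
  rw [← integral_condExp hm]
  refine integral_eq_zero_of_ae ?_
  filter_upwards [h1, h0] with ω h1 h2
  refine h1.trans ?_
  rw [h2]
  exact inner_zero_right (𝕜 := ℝ) (f ω)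

/-- Integration by parts: an element of `𝒜` is minus the adjoint primitive of its drift. -/
lemma HasDrift.inner_eq [IsFiniteMeasure P] (hT : 0 < T) {hnull : ContainsNull 𝓕 P}
    {X a : VProc T Ω d} (h : HasDrift 𝓕 P X a) {x α : HilbertProc 𝓕 P d}
    (hX : HasClass X x) (ha : HasClass a α) (v : HilbertProc 𝓕 P d) :
    (inner ℝ v x : ℝ) = - inner ℝ (opC hT hnull v) α := by
  obtain ⟨M, hM⟩ := h
  obtain ⟨V, hV⟩ := exists_process v
  have hVL2 : IsL2 P V := hV.inH2.2
  have hXL2 : IsL2 P X := hX.inH2.2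
  have haL2 : IsL2 P a := ha.inH2.2
  have hCVL2 : IsL2 P (cumul V) := (hV.opC (hT := hT) (hnull := hnull)).inH2.2
  have hCaL2 : IsL2 P (cumul a) := (ha.opC (hT := hT) (hnull := hnull)).inH2.2
  set I : Ω → Vec d := fun ω => ∫ t, a t ω ∂(timeMeasure T) with hI
  have hIm : AEStronglyMeasurable I P := AEStronglyMeasurable.integral_prod_right' (μ := P)
    (ν := timeMeasure T) (f := fun q : Ω × Horizon T => a q.2 q.1) (by
      have h0 : AEStronglyMeasurable (fun p : Horizon T × Ω => a p.1 p.2)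
        ((timeMeasure T).prod P) := haL2.1
      exact h0.prod_swap)
  have hIL2 : IsL2 P (fun _ ω => I ω : VProc T Ω d) := by
    refine (haL2.of_norm_le (Y := fun _ ω => I ω) ?_ ?_).1
    · exact hIm.comp_snd
    · exact ae_of_all _ fun ω _ => norm_integral_le_integral_norm _
  -- R(t) is X(t) plus the drift integrated from t to T. As X(T) = 0, this is minus the martingale
  -- increment from t to T, hence orthogonal to what is known at t.
  let R : VProc T Ω d := fun t ω => X t ω + (I ω - cumul a t ω)
  have hR : IsL2 P R := MemLp.add hXL2 (MemLp.sub hIL2 hCaL2)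
  have hRM : ∀ᵐ ω ∂P, ∀ t, R t ω = - (M (lastTime hT) ω - M t ω) := by
    filter_upwards [hM.decomposition, hM.terminal, ae_integrable_path haL2.integrable]
      with ω h1 h2 h3 t
    have h4 := h1 t (lastTime hT) (le_lastTime hT t)
    rw [h2 _ rfl, ← primitive_sub_primitive h3 (le_lastTime hT t), primitive_lastTime] at h4
    have h5 : primitive (fun s => a s ω) t = cumul a t ω := rfl
    rw [h5, zero_sub] at h4
    show X t ω + (I ω - cumul a t ω) = _
    rw [neg_eq_iff_eq_neg.1 h4]
    abel
  -- A strictly optional version is needed, because its section at every t is measurable for `𝓕 t`.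
  obtain ⟨V', hV'm, hVV'⟩ := hV.inH2.1
  have hVR : Integrable (fun p : Horizon T × Ω => (inner ℝ (V p.1 p.2) (R p.1 p.2) : ℝ))
    (dtP T P) := hVL2.integrable_inner hR
  have hV'R : Integrable (fun p : Horizon T × Ω => (inner ℝ (V' p) (R p.1 p.2) : ℝ))
      ((timeMeasure T).prod P) := hVR.congr (by
    filter_upwards [hVV'] with p hp
    simp only [hp])
  have key : ∫ p, (inner ℝ (V p.1 p.2) (R p.1 p.2) : ℝ) ∂(dtP T P) = 0 := by
    have e1 : ∫ p, (inner ℝ (V p.1 p.2) (R p.1 p.2) : ℝ) ∂(dtP T P)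
        = ∫ p, (inner ℝ (V' p) (R p.1 p.2) : ℝ) ∂((timeMeasure T).prod P) := by
      refine integral_congr_ae ?_
      filter_upwards [hVV'] with p hp
      simp only [hp]
    rw [e1, integral_prod _ hV'R]
    refine integral_eq_zero_of_ae ?_
    filter_upwards [hV'R.prod_right_ae] with t ht
    have hRt : R t =ᵐ[P] fun ω => - (M (lastTime hT) ω - M t ω) := hRM.mono fun ω h => h t
    have hint : Integrable (fun ω => - (M (lastTime hT) ω - M t ω)) P :=
      ((hM.mart.integrable _).sub (hM.mart.integrable t)).neg
    refine integral_inner_eq_zero_of_condExp (𝓕.le t)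
      (hV'm.comp_measurable (measurable_section_optionalSigma t)) ht (hint.congr hRt.symm) ?_
    have h1 : P[fun ω => M (lastTime hT) ω - M t ω | 𝓕 t] =ᵐ[P] 0 := by
      refine (condExp_sub (hM.mart.integrable _) (hM.mart.integrable t) _).trans ?_
      filter_upwards [hM.mart.2 t _ (le_lastTime hT t), hM.mart.2 t t le_rfl] with ω h1 h2
      rw [Pi.sub_apply, h1, h2, sub_self]; rfl
    refine (condExp_congr_ae hRt).trans ((condExp_neg _ _).trans ?_)
    filter_upwards [h1] with ω h1
    rw [Pi.neg_apply, h1]; simp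
  have e2 := integral_inner_cumul hVL2 haL2 hCVL2
  rw [hV.inner_eq hX, (hV.opC).inner_eq ha, e2]
  have e3 : Integrable (fun p : Horizon T × Ω => (inner ℝ (V p.1 p.2) (I p.2 - cumul a p.1 p.2) : ℝ))
    ((timeMeasure T).prod P) :=
    IsL2.integrable_inner (Y := fun t ω => I ω - cumul a t ω) hVL2 (MemLp.sub hIL2 hCaL2)
  have e4 : ∫ p, (inner ℝ (V p.1 p.2) (R p.1 p.2) : ℝ) ∂(dtP T P)
      = ∫ p, (inner ℝ (V p.1 p.2) (X p.1 p.2) : ℝ) ∂(dtP T P)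
        + ∫ p, (inner ℝ (V p.1 p.2) (I p.2 - cumul a p.1 p.2) : ℝ) ∂((timeMeasure T).prod P) := by
    have e5 := integral_add (hVL2.integrable_inner hXL2) e3
    refine Eq.trans ?_ e5
    exact integral_congr_ae (ae_of_all _ fun p => inner_add_right _ _ _)
  rw [integral_prod_symm _ e3, key] at e4
  linarith

end ClassA

/-! ### Continuous versions of martingales -/

section ContinuousVersion

variable {T : ℝ} {Ω : Type*} [mΩ : MeasurableSpace Ω]
  {𝓕 : Filtration (Horizon T) mΩ} {P : Measure Ω}

/-- Doob's maximal inequality for martingales with continuous paths. -/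
lemma mul_measure_exists_lt_le (hT : 0 < T) [IsFiniteMeasure P] {N : Horizon T → Ω → ℝ}
    (hN : Martingale N 𝓕 P) (hc : ∀ᵐ ω ∂P, Continuous fun t => N t ω) (ε : NNReal) :
    ε * P {ω | ∃ t, (ε : ℝ) < |N t ω|} ≤ eLpNorm (N (lastTime hT)) 1 P := by
  obtain ⟨g, k, -, -, hlim, hmono, hbdd⟩ := exists_countable_approx_from_right hT
  choose K hK using hbdd
  have hS : Submartingale (fun t ω => |N t ω|) 𝓕 P := hN.submartingale.sup hN.neg.submartingale
  -- The event that the maximum over the n-th finite grid reaches ε, to which the discrete maximal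
  -- inequality applies.
  let A : ℕ → Set Ω := fun n => {ω | (ε : ℝ) ≤ (Finset.range (K n + 1)).sup'
    Finset.nonempty_range_add_one fun j => |N (g n j) ω|}
  have hA : ∀ n, ε * P (A n) ≤ eLpNorm (N (lastTime hT)) 1 P := by
    intro n
    let 𝒢 : Filtration ℕ mΩ :=
      { seq := fun j => 𝓕 (g n j)
        mono' := fun i j hij => 𝓕.mono (hmono n hij)
        le' := fun j => 𝓕.le _ }
    have hsub : Submartingale (fun j ω => |N (g n j) ω|) 𝒢 P :=
      ⟨fun j => hS.1 (g n j), fun i j hij => hS.2.1 _ _ (hmono n hij), fun j => hS.2.2 (g n j)⟩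
    refine (maximal_ineq hsub (fun j ω => abs_nonneg _) (K n)).trans ?_
    have h1 : ∫ ω in A n, |N (g n (K n)) ω| ∂P ≤ ∫ ω, |N (lastTime hT) ω| ∂P := by
      refine (setIntegral_le_integral (hS.2.2 _) (ae_of_all _ fun ω => abs_nonneg _)).trans ?_
      have := hS.setIntegral_le (le_lastTime hT (g n (K n))) MeasurableSet.univ
      simpa only [setIntegral_univ] using this
    refine (ENNReal.ofReal_le_ofReal h1).trans ?_
    rw [eLpNorm_one_eq_lintegral_enorm,
      ← ofReal_integral_norm_eq_lintegral_enorm (hN.integrable _)]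
    rfl
  -- A strict exceedance at t persists, by continuity, at the grid points rounding t up for all
  -- large n. The event thus lies in the lower limit of the `A n`, whose measure is an increasing
  -- limit.
  have hsub : ∀ᵐ ω ∂P, (∃ t, (ε : ℝ) < |N t ω|) → ω ∈ ⋃ m, ⋂ n ≥ m, A n := by
    filter_upwards [hc] with ω hω ⟨t, ht⟩
    have h1 : Tendsto (fun n => |N (g n (k n t)) ω|) atTop (𝓝 |N t ω|) :=
      (hω.abs.tendsto t).comp (hlim t)
    obtain ⟨m, hm⟩ := eventually_atTop.1 (h1.eventually (lt_mem_nhds ht))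
    refine Set.mem_iUnion.2 ⟨m, Set.mem_iInter₂.2 fun n hn => (hm n hn).le.trans ?_⟩
    exact Finset.le_sup' (fun j => |N (g n j) ω|)
      (Finset.mem_range.2 (Nat.lt_succ_of_le (hK n t)))
  have hmonoB : Monotone fun m => ⋂ n ≥ m, A n := fun i j hij =>
    Set.biInter_mono (fun n hn => le_trans hij hn) fun n _ => le_rfl
  calc ε * P {ω | ∃ t, (ε : ℝ) < |N t ω|} ≤ ε * P (⋃ m, ⋂ n ≥ m, A n) :=
        mul_le_mul_right (measure_mono_ae hsub) _
    _ = ⨆ m, ε * P (⋂ n ≥ m, A n) := by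
        rw [hmonoB.measure_iUnion, ENNReal.mul_iSup]
    _ ≤ _ := iSup_le fun m => (mul_le_mul_right (measure_mono
        (Set.iInter₂_subset m le_rfl)) _).trans (hA m)

/-- The martingale `E[Y | 𝓕 t]` has a version with almost surely continuous paths. -/
def HasContVersion {E : Type*} [NormedAddCommGroup E] [NormedSpace ℝ E] [CompleteSpace E]
    (𝓕 : Filtration (Horizon T) mΩ) (P : Measure Ω) (Y : Ω → E) : Prop :=
  ∃ m : Horizon T → Ω → E, (∀ᵐ ω ∂P, Continuous fun t => m t ω) ∧
    (∀ t, StronglyMeasurable[𝓕 t] (m t)) ∧ ∀ t, m t =ᵐ[P] P[Y | 𝓕 t]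

variable {E : Type*} [NormedAddCommGroup E] [NormedSpace ℝ E] [CompleteSpace E]

lemma HasContVersion.congr {Y Z : Ω → E} (h : HasContVersion 𝓕 P Y) (hYZ : Y =ᵐ[P] Z) :
    HasContVersion 𝓕 P Z := by
  obtain ⟨m, h1, h2, h3⟩ := h
  exact ⟨m, h1, h2, fun t => (h3 t).trans (condExp_congr_ae hYZ)⟩

lemma HasContVersion.add {Y Z : Ω → E} (hY : HasContVersion 𝓕 P Y) (hZ : HasContVersion 𝓕 P Z)
    (hYi : Integrable Y P) (hZi : Integrable Z P) :
    HasContVersion 𝓕 P fun ω => Y ω + Z ω := by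
  obtain ⟨m, h1, h2, h3⟩ := hY
  obtain ⟨n, k1, k2, k3⟩ := hZ
  refine ⟨fun t ω => m t ω + n t ω, ?_, fun t => (h2 t).add (k2 t), fun t => ?_⟩
  · filter_upwards [h1, k1] with ω h k using h.add k
  · refine EventuallyEq.trans ?_ (condExp_add hYi hZi _).symm
    filter_upwards [h3 t, k3 t] with ω h k
    rw [h, k]; rfl

lemma HasContVersion.clm {F : Type*} [NormedAddCommGroup F] [NormedSpace ℝ F] [CompleteSpace F]
    (L : E →L[ℝ] F) {Y : Ω → E} (hY : HasContVersion 𝓕 P Y) (hYi : Integrable Y P) :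
    HasContVersion 𝓕 P fun ω => L (Y ω) := by
  obtain ⟨m, h1, h2, h3⟩ := hY
  refine ⟨fun t ω => L (m t ω), ?_, fun t => L.continuous.comp_stronglyMeasurable (h2 t),
    fun t => ?_⟩
  · filter_upwards [h1] with ω h using L.continuous.comp h
  · refine EventuallyEq.trans ?_ (L.comp_condExp_comm hYi)
    filter_upwards [h3 t] with ω h
    rw [h]; rfl

/-- By the tower property the whole martingale vanishes. This covers the part of a random variable
that is invisible to the filtration. -/
lemma HasContVersion.of_condExp_eq_zero [IsFiniteMeasure P] (hT : 0 < T) {Y : Ω → E}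
    (h : P[Y | 𝓕 (lastTime hT)] =ᵐ[P] 0) : HasContVersion 𝓕 P Y := by
  refine ⟨fun _ _ => 0, ae_of_all _ fun _ => continuous_const,
    fun _ => stronglyMeasurable_const, fun t => ?_⟩
  have h1 := condExp_condExp_of_le (f := Y) (μ := P) (𝓕.mono (le_lastTime hT t)) (𝓕.le _)
  refine EventuallyEq.trans ?_ h1
  refine EventuallyEq.trans ?_ (condExp_congr_ae h).symm
  rw [condExp_zero]; rfl

/-- Closure under convergence in mean. -/
lemma HasContVersion.of_tendsto (hT : 0 < T) [IsFiniteMeasure P] {Y : ℕ → Ω → ℝ} {Z : Ω → ℝ}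
    (hY : ∀ n, HasContVersion 𝓕 P (Y n)) (hYi : ∀ n, Integrable (Y n) P) (hZi : Integrable Z P)
    (hlim : Tendsto (fun n => eLpNorm (Y n - Z) 1 P) atTop (𝓝 0)) :
    HasContVersion 𝓕 P Z := by
  -- With mean errors at most 4⁻ⁿ, Doob's inequality at level 2⁻ⁿ bounds the exceedance
  -- probabilities by 2·2⁻ⁿ, which is summable for Borel–Cantelli.
  obtain ⟨φ, -, hφ⟩ : ∃ φ : ℕ → ℕ, StrictMono φ ∧
      ∀ n, eLpNorm (Y (φ n) - Z) 1 P ≤ (4⁻¹ : ℝ≥0∞) ^ n := by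
    refine extraction_forall_of_eventually'
      (P := fun n k => eLpNorm (Y k - Z) 1 P ≤ (4⁻¹ : ℝ≥0∞) ^ n) (fun n => ?_)
    have : (0 : ℝ≥0∞) < 4⁻¹ ^ n := ENNReal.pow_pos (by simp) n
    exact ((hlim.eventually (gt_mem_nhds this)).exists_forall_of_atTop).imp
      fun N hN k hk => (hN k hk).le
  choose m hmc hma hme using hY
  let N : ℕ → Horizon T → Ω → ℝ := fun n t ω => m (φ (n + 1)) t ω - m (φ n) t ω
  have hNe : ∀ n t, N n t =ᵐ[P] P[Y (φ (n + 1)) - Y (φ n) | 𝓕 t] := by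
    intro n t
    refine EventuallyEq.trans ?_ (condExp_sub (hYi _) (hYi _) _).symm
    filter_upwards [hme (φ (n + 1)) t, hme (φ n) t] with ω h1 h2
    simp only [N, h1, h2]; rfl
  have hNmart : ∀ n, Martingale (N n) 𝓕 P := fun n =>
    (martingale_condExp (Y (φ (n + 1)) - Y (φ n)) 𝓕 P).congr
      (fun t => (hma _ t).sub (hma _ t)) fun t => (hNe n t).symm
  have hNc : ∀ n, ∀ᵐ ω ∂P, Continuous fun t => N n t ω := fun n => by
    filter_upwards [hmc (φ (n + 1)), hmc (φ n)] with ω h1 h2 using h1.sub h2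
  have hNn : ∀ n, eLpNorm (N n (lastTime hT)) 1 P ≤ 2 * (4⁻¹ : ℝ≥0∞) ^ n := by
    intro n
    rw [eLpNorm_congr_ae (hNe n _)]
    refine (eLpNorm_condExp_le_eLpNorm _ le_rfl).trans ?_
    have h1 : Y (φ (n + 1)) - Y (φ n) = (Y (φ (n + 1)) - Z) - (Y (φ n) - Z) := by abel
    rw [h1]
    refine (eLpNorm_sub_le ((hYi _).1.sub hZi.1) ((hYi _).1.sub hZi.1) le_rfl).trans ?_
    rw [two_mul]
    refine add_le_add ((hφ _).trans ?_) (hφ n)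
    rw [pow_succ]
    exact mul_le_of_le_one_right' (by simp)
  have hBC : ∀ᵐ ω ∂P, ∀ᶠ n in atTop, ∀ t, |N n t ω| ≤ (2⁻¹ : ℝ) ^ n := by
    have hsum : ∑' n, P {ω | ∃ t, (((2⁻¹ : NNReal) ^ n : NNReal) : ℝ) < |N n t ω|} ≠ ∞ := by
      have hle : ∀ n, P {ω | ∃ t, (((2⁻¹ : NNReal) ^ n : NNReal) : ℝ) < |N n t ω|}
          ≤ 2 * (2⁻¹ : ℝ≥0∞) ^ n := by
        intro n
        have h1 := (mul_measure_exists_lt_le hT (hNmart n) (hNc n) (2⁻¹ ^ n)).trans (hNn n)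
        have h2 : (4⁻¹ : ℝ≥0∞) ^ n = 2⁻¹ ^ n * 2⁻¹ ^ n := by
          rw [← mul_pow, ← ENNReal.mul_inv (by simp) (by simp)]
          norm_num
        have h3 : (((2⁻¹ : NNReal) ^ n : NNReal) : ℝ≥0∞) = (2⁻¹ : ℝ≥0∞) ^ n := by
          rw [ENNReal.coe_pow, ENNReal.coe_inv (by norm_num)]; simp
        rw [h2, h3, mul_left_comm] at h1
        exact (ENNReal.mul_le_mul_iff_right (ENNReal.pow_pos (by simp) n).ne'
          (ENNReal.pow_ne_top (by simp))).1 h1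
      refine ne_top_of_le_ne_top ?_ (ENNReal.tsum_le_tsum hle)
      rw [ENNReal.tsum_mul_left, ENNReal.tsum_geometric, ENNReal.one_sub_inv_two, inv_inv]
      exact ENNReal.mul_ne_top (by simp) (by simp)
    filter_upwards [ae_eventually_notMem hsum] with ω hω
    filter_upwards [hω] with n hn t
    simpa using not_lt.1 fun h => hn ⟨t, h⟩
  -- Almost every sequence of paths is Cauchy in the uniform norm, with geometric increments from
  -- some index on.
  have hconv : ∀ᵐ ω ∂P, ∃ f : C(Horizon T, ℝ), ∀ t,
      Tendsto (fun n => m (φ n) t ω) atTop (𝓝 (f t)) := by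
    filter_upwards [hBC, ae_all_iff.2 fun n => hmc (φ n)] with ω h1 h2
    obtain ⟨n₀, hn₀⟩ := eventually_atTop.1 h1
    let F : ℕ → C(Horizon T, ℝ) := fun n => ⟨fun t => m (φ (n + n₀)) t ω, h2 (n + n₀)⟩
    have hF : CauchySeq F := by
      refine cauchySeq_of_le_geometric (2⁻¹ : ℝ) 1 (by norm_num) fun n => ?_
      rw [one_mul, ContinuousMap.dist_le (by positivity)]
      intro t
      rw [dist_comm, Real.dist_eq]
      have h3 := hn₀ (n + n₀) (Nat.le_add_left _ _) t
      have h4 : n + 1 + n₀ = n + n₀ + 1 := by ring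
      simp only [F, ContinuousMap.coe_mk, h4]
      refine h3.trans ?_
      exact pow_le_pow_of_le_one (by norm_num) (by norm_num) (Nat.le_add_right _ _)
    obtain ⟨f, hf⟩ := cauchySeq_tendsto_of_complete hF
    refine ⟨f, fun t => ?_⟩
    have h5 : Tendsto (fun n => F n t) atTop (𝓝 (f t)) :=
      ((ContinuousEvalConst.continuous_eval_const t).tendsto f).comp hf
    exact (tendsto_add_atTop_iff_nat (f := fun n => m (φ n) t ω) n₀).1 h5
  refine ⟨fun t ω => limUnder atTop fun n => m (φ n) t ω, ?_, fun t => ?_, fun t => ?_⟩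
  · filter_upwards [hconv] with ω ⟨f, hf⟩
    have : (fun t => limUnder atTop fun n => m (φ n) t ω) = f := by
      funext t; exact (hf t).limUnder_eq
    rw [this]; exact f.continuous
  -- Where the sequence diverges `limUnder` takes a default value; measurability for `𝓕 t` holds
  -- nevertheless.
  · exact @StronglyMeasurable.limUnder _ _ _ (𝓕 t) _ _ _ _ _ _ _ fun n => hma (φ n) t
  · have h1 : TendstoInMeasure P (fun n => m (φ n) t) atTop
        (fun ω => limUnder atTop fun n => m (φ n) t ω) := by
      refine tendstoInMeasure_of_tendsto_ae
        (fun n => ((hma (φ n) t).mono (𝓕.le t)).aestronglyMeasurable) ?_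
      filter_upwards [hconv] with ω ⟨f, hf⟩
      rw [(hf t).limUnder_eq]; exact hf t
    -- Conditional expectation contracts the mean norm, so the same sequence also tends to the
    -- conditional expectation of Z; limits in measure are unique.
    have h2 : TendstoInMeasure P (fun n => m (φ n) t) atTop (P[Z | 𝓕 t]) := by
      refine tendstoInMeasure_of_tendsto_eLpNorm (p := 1) one_ne_zero
        (fun n => ((hma (φ n) t).mono (𝓕.le t)).aestronglyMeasurable)
        integrable_condExp.1 ?_
      have h3 : ∀ n, eLpNorm (m (φ n) t - P[Z | 𝓕 t]) 1 P ≤ (4⁻¹ : ℝ≥0∞) ^ n := by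
        intro n
        have h4 : m (φ n) t - P[Z | 𝓕 t] =ᵐ[P] P[Y (φ n) - Z | 𝓕 t] := by
          refine EventuallyEq.trans ?_ (condExp_sub (hYi _) hZi _).symm
          exact (hme (φ n) t).sub EventuallyEq.rfl
        rw [eLpNorm_congr_ae h4]
        exact (eLpNorm_condExp_le_eLpNorm _ le_rfl).trans (hφ n)
      refine tendsto_of_tendsto_of_tendsto_of_le_of_le tendsto_const_nhds ?_
        (fun _ => zero_le) h3
      exact ENNReal.tendsto_pow_atTop_nhds_zero_of_lt_one (by
        rw [ENNReal.inv_lt_one]; norm_num)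
    exact tendstoInMeasure_ae_unique h1 h2

end ContinuousVersion

/-! ### The Brownian filtration has continuous martingales -/

section Brownian

variable {T : ℝ} {Ω : Type*} {d : ℕ} [mΩ : MeasurableSpace Ω] {P : Measure Ω}
  {W : VProc T Ω d}

lemma measurable_augFiltration (hW : ∀ t, Measurable (W t)) {s t : Horizon T} (hst : s ≤ t) :
    Measurable[augFiltration P W hW t] (W s) := by
  rw [measurable_iff_comap_le]
  refine le_trans ?_ le_sup_left
  exact le_iSup (fun u : Set.Iic t => MeasurableSpace.comap (W u) inferInstance) ⟨s, hst⟩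

/-- The events a.s. equal to an event of the raw filtration form a σ-algebra, and it contains all
null events. Independence of increments thereby passes to the augmented filtration. -/
lemma exists_ae_eq_of_measurableSet_augFiltration (hW : ∀ t, Measurable (W t)) {t : Horizon T}
    {A : Set Ω} (hA : MeasurableSet[augFiltration P W hW t] A) :
    ∃ A', MeasurableSet[⨆ u : Set.Iic t, MeasurableSpace.comap (W u) inferInstance] A' ∧
      A =ᵐ[P] A' := by
  have h : (augFiltration P W hW t : MeasurableSpace Ω) ≤ eventuallyMeasurableSpace
      (⨆ u : Set.Iic t, MeasurableSpace.comap (W u) inferInstance) (ae P) := by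
    refine sup_le le_eventuallyMeasurableSpace (MeasurableSpace.generateFrom_le fun B hB => ?_)
    exact ⟨∅, MeasurableSpace.measurableSet_empty _, ae_eq_empty.2 hB.2⟩
  obtain ⟨A', h1, h2⟩ := h A hA
  exact ⟨A', h1, h2⟩

lemma IsStdBrownian.indep_augFiltration (hW : IsStdBrownian P W) {s t : Horizon T} (hst : s ≤ t) :
    Indep (MeasurableSpace.comap (fun ω => W t ω - W s ω) inferInstance)
      (augFiltration P W hW.measurable s) P := by
  rw [Indep_iff]
  intro A B hA hB
  obtain ⟨B', hB', hBB'⟩ := exists_ae_eq_of_measurableSet_augFiltration hW.measurable hB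
  rw [measure_congr (EventuallyEq.rfl.inter hBB'), measure_congr hBB']
  exact (Indep_iff _ _ _).1 (hW.indep_past s t hst) A B' hA hB'

/-- The increment character `exp (i ⟨W t - W s, c⟩)`. -/
def incrChar (W : VProc T Ω d) (s t : Horizon T) (c : Vec d) (ω : Ω) : ℂ :=
  Complex.exp ((inner ℝ (W t ω - W s ω) c : ℝ) * Complex.I)

lemma norm_incrChar {Ω : Type*} {W : VProc T Ω d} (s t : Horizon T) (c : Vec d) (ω : Ω) : ‖incrChar W s t c ω‖ = 1 :=
  Complex.norm_exp_ofReal_mul_I _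

lemma incrChar_mul {Ω : Type*} {W : VProc T Ω d} (s t u : Horizon T) (c : Vec d) (ω : Ω) :
    incrChar W s t c ω * incrChar W t u c ω = incrChar W s u c ω := by
  rw [incrChar, incrChar, incrChar, ← Complex.exp_add, ← add_mul, ← Complex.ofReal_add,
    ← inner_add_left]
  congr 5
  abel

lemma incrChar_self {Ω : Type*} {W : VProc T Ω d} (s : Horizon T) (c : Vec d) (ω : Ω) : incrChar W s s c ω = 1 := by
  simp [incrChar]

lemma continuous_charMap (c : Vec d) :
    Continuous fun x : Vec d => Complex.exp ((inner ℝ x c : ℝ) * Complex.I) := by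
  fun_prop

lemma stronglyMeasurable_incrChar (hW : ∀ t, Measurable (W t)) {s t u : Horizon T} (hs : s ≤ u)
    (ht : t ≤ u) (c : Vec d) : StronglyMeasurable[augFiltration P W hW u] (incrChar W s t c) :=
  ((continuous_charMap c).measurable.comp
    ((measurable_augFiltration hW ht).sub (measurable_augFiltration hW hs))).stronglyMeasurable

lemma IsStdBrownian.integral_incrChar (hW : IsStdBrownian P W) {s t : Horizon T} (hst : s ≤ t)
    (c : Vec d) :
    ∫ ω, incrChar W s t c ω ∂P
      = Complex.exp ((-(((t : ℝ) - s) * ‖c‖ ^ 2 / 2) : ℝ)) := by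
  have h1 := hW.increment_law s t hst
  have h2 : ∫ ω, incrChar W s t c ω ∂P
      = ∫ x, Complex.exp ((inner ℝ x c : ℝ) * Complex.I) ∂(P.map fun ω => W t ω - W s ω) :=
    (integral_map h1.aemeasurable (continuous_charMap c).aestronglyMeasurable).symm
  rw [h2, h1.map_eq, ← charFun_apply, charFun_map_smul, charFun_stdGaussian, norm_smul,
    Real.norm_of_nonneg (Real.sqrt_nonneg _)]
  congr 1
  have h3 : Real.sqrt ((t : ℝ) - s) ^ 2 = (t : ℝ) - s := Real.sq_sqrt (sub_nonneg.2 hst)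
  rw [← Complex.ofReal_pow, mul_pow, h3]
  push_cast
  ring

lemma IsStdBrownian.condExp_mul_incrChar [IsProbabilityMeasure P] (hW : IsStdBrownian P W)
    {s t : Horizon T} (hst : s ≤ t) (c : Vec d) {Z : Ω → ℂ}
    (hZ : StronglyMeasurable[augFiltration P W hW.measurable s] Z) (hZi : Integrable Z P) :
    P[fun ω => Z ω * incrChar W s t c ω | augFiltration P W hW.measurable s]
      =ᵐ[P] fun ω => Z ω * Complex.exp ((-(((t : ℝ) - s) * ‖c‖ ^ 2 / 2) : ℝ)) := by
  have hm : StronglyMeasurable (incrChar W s t c) :=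
    (stronglyMeasurable_incrChar hW.measurable hst le_rfl c (P := P)).mono (Filtration.le _ _)
  have hi : Integrable (incrChar W s t c) P :=
    Integrable.of_bound hm.aestronglyMeasurable 1 (ae_of_all _ fun ω => (norm_incrChar _ _ _ _).le)
  have hZX : Integrable (fun ω => Z ω * incrChar W s t c ω) P :=
    hZi.mul_bdd (c := 1) hm.aestronglyMeasurable (ae_of_all _ fun ω => (norm_incrChar _ _ _ _).le)
  have h1 := condExp_bilin_of_stronglyMeasurable_left (ContinuousLinearMap.mul ℝ ℂ) hZ hZX hi
  have hXm : StronglyMeasurable[MeasurableSpace.comap (fun ω => W t ω - W s ω) inferInstance]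
      (incrChar W s t c) :=
    ((continuous_charMap c).measurable.comp (comap_measurable _)).stronglyMeasurable
  have h2 := condExp_indep_eq
    (((hW.measurable t).sub (hW.measurable s)).comap_le) (Filtration.le _ _) hXm
    (hW.indep_augFiltration hst)
  refine h1.trans ?_
  filter_upwards [h2] with ω h2
  rw [ContinuousLinearMap.mul_apply', h2, hW.integral_incrChar hst c]

/-- Multiplication by the character of a later increment. -/
lemma IsStdBrownian.hasContVersion_mul_incrChar [IsProbabilityMeasure P] (hW : IsStdBrownian P W)
    {s t : Horizon T} (hst : s ≤ t) (c : Vec d) {Z : Ω → ℂ}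
    (hZ : StronglyMeasurable[augFiltration P W hW.measurable s] Z) (hZi : Integrable Z P)
    (h : HasContVersion (augFiltration P W hW.measurable) P Z) :
    HasContVersion (augFiltration P W hW.measurable) P fun ω => Z ω * incrChar W s t c ω := by
  obtain ⟨m, hmc, hma, hme⟩ := h
  set 𝓕 := augFiltration P W hW.measurable with h𝓕
  -- The mean of the character of that part of the increment over [s, t] which is still in the
  -- future at time τ.
  let κ : Horizon T → ℂ := fun τ =>
    Complex.exp ((-(((t : ℝ) - (max s (min τ t) : Horizon T)) * ‖c‖ ^ 2 / 2) : ℝ))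
  have hκ : Continuous κ := by
    have h1 : Continuous fun τ : Horizon T => ((max s (min τ t) : Horizon T) : ℝ) :=
      continuous_subtype_val.comp (continuous_const.max (continuous_id.min continuous_const))
    have h2 : Continuous fun τ : Horizon T =>
        -(((t : ℝ) - (max s (min τ t) : Horizon T)) * ‖c‖ ^ 2 / 2) := by fun_prop
    exact Complex.continuous_exp.comp (Complex.continuous_ofReal.comp h2)
  have hsm : ∀ {a b u : Horizon T}, a ≤ u → b ≤ u → StronglyMeasurable[𝓕 u] (incrChar W a b c) :=
    fun ha hb => stronglyMeasurable_incrChar hW.measurable ha hb c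
  have hbi : ∀ {a b : Horizon T} {Y : Ω → ℂ}, Integrable Y P →
      Integrable (fun ω => Y ω * incrChar W a b c ω) P := fun {a b Y} hY =>
    hY.mul_bdd (c := 1) ((hsm (le_max_left a b) (le_max_right a b)).mono (𝓕.le _)).aestronglyMeasurable
      (ae_of_all _ fun ω => (norm_incrChar _ _ _ _).le)
  refine ⟨fun τ ω => m τ ω * incrChar W (min τ s) (min τ t) c ω * κ τ, ?_, fun τ => ?_,
    fun τ => ?_⟩
  · filter_upwards [hmc, hW.continuous_paths] with ω h1 h2
    refine (h1.mul ?_).mul hκ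
    exact (continuous_charMap c).comp ((h2.comp (continuous_id.min continuous_const)).sub
      (h2.comp (continuous_id.min continuous_const)))
  · exact ((hma τ).mul (hsm (min_le_left _ _) (min_le_left _ _))).mul stronglyMeasurable_const
  -- Before s no part of the increment is known and its revealed character is 1; between s and t it
  -- splits at τ; after t it is entirely known.
  · rcases le_total τ s with hτs | hsτ
    · have h1 : P[fun ω => Z ω * incrChar W s t c ω | 𝓕 τ]
          =ᵐ[P] P[fun ω => κ s * Z ω | 𝓕 τ] := by
        refine (condExp_condExp_of_le (𝓕.mono hτs) (𝓕.le s)).symm.trans ?_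
        refine condExp_congr_ae ((hW.condExp_mul_incrChar hst c hZ hZi).trans ?_)
        refine ae_of_all _ fun ω => ?_
        simp only [κ, min_eq_left hst, max_self]
        ring
      have h2 : P[fun ω => κ s * Z ω | 𝓕 τ] =ᵐ[P] fun ω => κ s * P[Z | 𝓕 τ] ω :=
        condExp_bilin_of_stronglyMeasurable_left (ContinuousLinearMap.mul ℝ ℂ)
          stronglyMeasurable_const (hZi.const_mul _) hZi
      refine EventuallyEq.trans ?_ (h1.trans h2).symm
      filter_upwards [hme τ] with ω h3
      have h4 : κ τ = κ s := by
        simp only [κ, min_eq_left (hτs.trans hst), max_eq_left hτs, min_eq_left hst, max_self]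
      rw [min_eq_left hτs, min_eq_left (hτs.trans hst), incrChar_self, h3, h4]
      ring
    · have hmZ : m τ =ᵐ[P] Z := by
        refine (hme τ).trans ?_
        rw [condExp_of_stronglyMeasurable (𝓕.le τ) (hZ.mono (𝓕.mono hsτ)) hZi]
      have hZs : StronglyMeasurable[𝓕 τ] Z := hZ.mono (𝓕.mono hsτ)
      rcases le_total τ t with hτt | htτ
      · have h1 : (fun ω => Z ω * incrChar W s t c ω)
            = fun ω => (Z ω * incrChar W s τ c ω) * incrChar W τ t c ω := by
          funext ω; rw [mul_assoc, incrChar_mul]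
        have h2 := hW.condExp_mul_incrChar hτt c
          ((hZ.mono (𝓕.mono hsτ)).mul (hsm hsτ le_rfl)) (hbi hZi)
        rw [h1]
        refine EventuallyEq.trans ?_ h2.symm
        filter_upwards [hmZ] with ω h3
        simp only [κ, min_eq_left hτt, max_eq_right hsτ, min_eq_right hsτ, h3, Pi.mul_apply]
      · have hZX : StronglyMeasurable[𝓕 τ] fun ω => Z ω * incrChar W s t c ω :=
          hZs.mul (hsm hsτ htτ)
        rw [condExp_of_stronglyMeasurable (𝓕.le τ) hZX (hbi hZi)]
        have h4 : κ τ = 1 := by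
          simp only [κ, min_eq_right htτ, max_eq_right hst]; simp
        filter_upwards [hmZ] with ω h3
        rw [min_eq_right htτ, min_eq_right hsτ, h3, h4, mul_one]

/-- Characters of finitely many values of the Brownian motion. -/
def cylinderChar (W : VProc T Ω d) (J : Finset (Horizon T)) (c : Horizon T → Vec d) (ω : Ω) : ℂ :=
  Complex.exp ((∑ t ∈ J, inner ℝ (W t ω) (c t) : ℝ) * Complex.I)

lemma norm_cylinderChar {Ω : Type*} {W : VProc T Ω d} (J : Finset (Horizon T)) (c : Horizon T → Vec d) (ω : Ω) :
    ‖cylinderChar W J c ω‖ = 1 :=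
  Complex.norm_exp_ofReal_mul_I _

lemma stronglyMeasurable_cylinderChar (hW : ∀ t, Measurable (W t)) {J : Finset (Horizon T)}
    {u : Horizon T} (hJ : ∀ t ∈ J, t ≤ u) (c : Horizon T → Vec d) :
    StronglyMeasurable[augFiltration P W hW u] (cylinderChar W J c) := by
  refine Measurable.stronglyMeasurable ?_
  have h1 : Measurable[augFiltration P W hW u]
      fun ω => (∑ t ∈ J, inner ℝ (W t ω) (c t) : ℝ) :=
    Finset.measurable_fun_sum J fun t ht =>
      (measurable_augFiltration hW (hJ t ht)).inner measurable_const
  exact Complex.measurable_exp.comp ((Complex.measurable_ofReal.comp h1).mul measurable_const)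

lemma integrable_cylinderChar [IsFiniteMeasure P] (hT : 0 < T) (hW : ∀ t, Measurable (W t))
    (J : Finset (Horizon T)) (c : Horizon T → Vec d) : Integrable (cylinderChar W J c) P :=
  Integrable.of_bound ((stronglyMeasurable_cylinderChar hW (P := P)
    (fun t _ => le_lastTime hT t) c).mono (Filtration.le _ _)).aestronglyMeasurable 1
    (ae_of_all _ fun _ => (norm_cylinderChar _ _ _).le)

/-- Induction on the largest time t. Writing W(t) as W(s) plus an increment, with s the preceding
time, reduces the character to one with fewer times multiplied by the character of a later
increment. For a single time the role of s is played by 0, where W vanishes a.s. -/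
lemma IsStdBrownian.hasContVersion_cylinderChar [IsProbabilityMeasure P] (hT : 0 < T)
    (hW : IsStdBrownian P W) (J : Finset (Horizon T)) (c : Horizon T → Vec d) :
    HasContVersion (augFiltration P W hW.measurable) P (cylinderChar W J c) := by
  classical
  induction J using Finset.induction_on_max generalizing c with
  | empty =>
    have h1 : cylinderChar W ∅ c = fun _ => (1 : ℂ) := by
      funext ω; simp [cylinderChar]
    rw [h1]
    refine ⟨fun _ _ => 1, ae_of_all _ fun _ => continuous_const,
      fun _ => stronglyMeasurable_const, fun t => ?_⟩
    rw [condExp_const (Filtration.le _ _)]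
  | insert t J hJ ih =>
    have htJ : t ∉ J := fun h => lt_irrefl t (hJ t h)
    rcases J.eq_empty_or_nonempty with rfl | hne
    · have h0 : (⟨0, le_rfl, hT.le⟩ : Horizon T) ≤ t := t.2.1
      have h1 := hW.hasContVersion_mul_incrChar h0 (c t)
        (stronglyMeasurable_cylinderChar hW.measurable (P := P) (J := ∅) (by simp) c)
        (integrable_cylinderChar hT hW.measurable ∅ c) (ih c)
      refine h1.congr ?_
      filter_upwards [hW.start_zero ⟨0, le_rfl, hT.le⟩ rfl] with _ hω
      simp [cylinderChar, incrChar, hω]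
    · set s := J.max' hne with hs
      have hsJ : s ∈ J := J.max'_mem hne
      have hst : s ≤ t := (hJ s hsJ).le
      -- The coefficient of the removed time t is transferred to s.
      let c' : Horizon T → Vec d := fun u => c u + if u = s then c t else 0
      have h1 := hW.hasContVersion_mul_incrChar hst (c t)
        (stronglyMeasurable_cylinderChar hW.measurable (P := P) (J := J)
          (fun u hu => J.le_max' u hu) c')
        (integrable_cylinderChar hT hW.measurable J c') (ih c')
      refine h1.congr (ae_of_all _ fun ω => ?_)
      simp only [cylinderChar, incrChar, c', Finset.sum_insert htJ]
      rw [← Complex.exp_add, ← add_mul, ← Complex.ofReal_add]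
      congr 3
      simp only [inner_add_right, Finset.sum_add_distrib, inner_sub_left]
      rw [Finset.sum_eq_single s (f := fun u => inner ℝ (W u ω) (if u = s then c t else 0))]
      · simp only [if_true]; ring
      · intro u _ hu; simp [hu]
      · intro h; exact absurd hsJ h

/-- The finite measures with densities Z⁺ and Z⁻ give the path of W the same finite-dimensional
characteristic functions, hence the same law. So Z integrates to 0 over every event generated by W,
and null events do not matter. -/
lemma condExp_eq_zero_of_integral_mul_cylinderChar [IsProbabilityMeasure P] (hT : 0 < T)
    (hW : ∀ t, Measurable (W t)) {Z : Ω → ℝ} (hZ : Integrable Z P)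
    (h : ∀ (J : Finset (Horizon T)) (c : Horizon T → Vec d),
      ∫ ω, (Z ω : ℂ) * cylinderChar W J c ω ∂P = 0) :
    P[Z | augFiltration P W hW (lastTime hT)] =ᵐ[P] 0 := by
  have hdens : ∀ {Y : Ω → ℝ}, Integrable Y P →
      IsFiniteMeasure (P.withDensity fun ω => ((Y ω).toNNReal : ℝ≥0∞)) := fun {Y} hY =>
    isFiniteMeasure_withDensity hY.lintegral_lt_top.ne
  have h1 := hdens hZ
  have h2 := hdens hZ.neg
  set μ₁ := P.withDensity fun ω => ((Z ω).toNNReal : ℝ≥0∞) with hμ₁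
  set μ₂ := P.withDensity fun ω => (((-Z) ω).toNNReal : ℝ≥0∞) with hμ₂
  let X : Ω → Horizon T → Vec d := fun ω t => W t ω
  have hX : Measurable X := measurable_pi_lambda _ hW
  have hint : ∀ {Y : Ω → ℝ} (f : Ω → ℂ), Integrable Y P →
      ∫ ω, f ω ∂(P.withDensity fun ω => ((Y ω).toNNReal : ℝ≥0∞))
        = ∫ ω, (((Y ω).toNNReal : ℝ) : ℂ) * f ω ∂P := fun {Y} f hY => by
    rw [integral_withDensity_eq_integral_smul₀ hY.1.aemeasurable.real_toNNReal]
    exact integral_congr_ae (ae_of_all _ fun ω => by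
      simp [NNReal.smul_def])
  have hmeas : ∀ J : Finset (Horizon T), μ₁.map (fun ω => J.restrict (X ω))
      = μ₂.map (fun ω => J.restrict (X ω)) := by
    intro J
    classical
    have hJX : Measurable fun ω => J.restrict (X ω) := (Finset.measurable_restrict J).comp hX
    refine Measure.ext_of_charFunDual ?_
    ext L
    -- The Riesz vectors of the coordinates of `L`, which make the character of `L` a cylinder
    -- character.
    let c : Horizon T → Vec d := fun t => if ht : t ∈ J then
      (InnerProductSpace.toDual ℝ (Vec d)).symm
        (L.comp (ContinuousLinearMap.single ℝ (fun _ : J => Vec d) ⟨t, ht⟩)) else 0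
    have hL : ∀ ω, Complex.exp (L (J.restrict (X ω)) * Complex.I) = cylinderChar W J c ω := by
      intro ω
      rw [cylinderChar]
      congr 3
      have h3 : J.restrict (X ω)
          = ∑ t : J, ContinuousLinearMap.single ℝ (fun _ : J => Vec d) t (W t ω) := by
        exact (Finset.univ_sum_single (J.restrict (X ω))).symm
      rw [h3, map_sum, ← Finset.sum_coe_sort J]
      refine Finset.sum_congr rfl fun t _ => ?_
      rw [real_inner_comm]
      simp [c]
    have hcm : ∀ μ : Measure Ω, charFunDual (μ.map fun ω => J.restrict (X ω)) L
        = ∫ ω, cylinderChar W J c ω ∂μ := by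
      intro μ
      rw [charFunDual_apply, integral_map hJX.aemeasurable
        (by fun_prop : Continuous fun v => Complex.exp (L v * Complex.I)).aestronglyMeasurable]
      exact integral_congr_ae (ae_of_all _ hL)
    rw [hcm, hcm, hint _ hZ, hint _ hZ.neg, ← sub_eq_zero, ← integral_sub]
    · refine Eq.trans (integral_congr_ae (ae_of_all _ fun ω => ?_)) (h J c)
      have h4 : (Z ω).toNNReal - ((-Z ω).toNNReal : ℝ) = Z ω := by
        rw [Real.coe_toNNReal', Real.coe_toNNReal', max_comm, max_comm (-Z ω)]
        rcases le_total 0 (Z ω) with h | h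
        · rw [max_eq_right h, max_eq_left (neg_nonpos.2 h), sub_zero]
        · rw [max_eq_left h, max_eq_right (neg_nonneg.2 h)]; ring
      simp only [Pi.neg_apply]
      rw [← sub_mul, ← Complex.ofReal_sub, h4]
    · exact (hZ.real_toNNReal.ofReal (𝕜 := ℂ)).mul_bdd (c := 1)
        (integrable_cylinderChar hT hW J c).1
        (ae_of_all _ fun ω => (norm_cylinderChar _ _ _).le)
    · exact (hZ.neg.real_toNNReal.ofReal (𝕜 := ℂ)).mul_bdd (c := 1)
        (integrable_cylinderChar hT hW J c).1
        (ae_of_all _ fun ω => (norm_cylinderChar _ _ _).le)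
  -- A finite measure on path space is determined by its finite-dimensional marginals.
  have hlaw : μ₁.map X = μ₂.map X := by
    have h3 := isProjectiveLimit_map (P := μ₁) (X := W) hX.aemeasurable
    have h4 := isProjectiveLimit_map (P := μ₂) (X := W) hX.aemeasurable
    have h5 : (fun I : Finset (Horizon T) => μ₁.map fun ω => I.restrict (W · ω))
        = fun I : Finset (Horizon T) => μ₂.map fun ω => I.restrict (W · ω) := funext hmeas
    rw [h5] at h3
    exact h3.unique h4
  have hset : ∀ {Y : Ω → ℝ} {A : Set Ω}, Integrable Y P → MeasurableSet A →
      ((P.withDensity fun ω => ((Y ω).toNNReal : ℝ≥0∞)) A).toReal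
        = ∫ ω in A, ((Y ω).toNNReal : ℝ) ∂P := by
    intro Y A hY hA
    rw [withDensity_apply _ hA, integral_eq_lintegral_of_nonneg_ae
      (ae_of_all _ fun ω => NNReal.coe_nonneg _) hY.real_toNNReal.1.restrict]
    simp only [ENNReal.ofReal_coe_nnreal]
  symm
  refine ae_eq_condExp_of_forall_setIntegral_eq (Filtration.le _ _) hZ
    (fun _ _ _ => integrableOn_zero) (fun A hA _ => ?_) stronglyMeasurable_zero.aestronglyMeasurable
  obtain ⟨A', hA', hAA'⟩ := exists_ae_eq_of_measurableSet_augFiltration hW hA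
  have hle : (⨆ u : Set.Iic (lastTime hT), MeasurableSpace.comap (W u) inferInstance)
      ≤ MeasurableSpace.comap X inferInstance := by
    refine iSup_le fun u => ?_
    rw [← measurable_iff_comap_le]
    exact (measurable_pi_apply (u : Horizon T)).comp (comap_measurable X)
  obtain ⟨B, hB, hBA⟩ := hle A' hA'
  have hA'm : MeasurableSet A' := hX.comap_le _ (hle A' hA')
  have h5 : μ₁ A' = μ₂ A' := by
    rw [← hBA, ← Measure.map_apply hX hB, ← Measure.map_apply hX hB, hlaw]
  have h6 := congrArg ENNReal.toReal h5
  rw [hset hZ hA'm, hset hZ.neg hA'm, ← sub_eq_zero,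
    ← integral_sub hZ.real_toNNReal.integrableOn hZ.neg.real_toNNReal.integrableOn] at h6
  rw [setIntegral_congr_set hAA', ← setIntegral_congr_set (s := A) hAA']
  simp only [Pi.zero_apply, integral_zero]
  rw [setIntegral_congr_set hAA', ← h6]
  refine integral_congr_ae (ae_of_all _ fun ω => ?_)
  simp only [Pi.neg_apply, Real.coe_toNNReal']
  rcases le_total 0 (Z ω) with h | h
  · rw [max_eq_left h, max_eq_right (neg_nonpos.2 h), sub_zero]
  · rw [max_eq_right h, max_eq_left (neg_nonneg.2 h)]; ring

/-- In a Brownian filtration, every square integrable random variable generates a continuous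
martingale. -/
lemma IsStdBrownian.hasContVersion_of_memLp [IsProbabilityMeasure P] (hT : 0 < T)
    (hW : IsStdBrownian P W) {Y : Ω → ℝ} (hY : MemLp Y 2 P) :
    HasContVersion (augFiltration P W hW.measurable) P Y := by
  set 𝓕 := augFiltration P W hW.measurable with h𝓕
  have hi : ∀ f : Lp ℝ 2 P, Integrable f P := fun f => (Lp.memLp f).integrable one_le_two
  let V : Submodule ℝ (Lp ℝ 2 P) :=
    { carrier := {f | HasContVersion 𝓕 P f}
      add_mem' := fun {f g} hf hg => by
        refine (HasContVersion.add hf hg (hi f) (hi g)).congr ?_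
        filter_upwards [Lp.coeFn_add f g] with ω h
        rw [h]; rfl
      zero_mem' := by
        refine HasContVersion.of_condExp_eq_zero hT ?_
        refine (condExp_congr_ae (Lp.coeFn_zero ℝ 2 P)).trans ?_
        rw [condExp_zero]
      smul_mem' := fun c f hf => by
        refine (HasContVersion.clm (c • ContinuousLinearMap.id ℝ ℝ) hf (hi f)).congr ?_
        filter_upwards [Lp.coeFn_smul c f] with ω h
        rw [h]; rfl }
  have hV : IsClosed (V : Set (Lp ℝ 2 P)) := by
    refine IsSeqClosed.isClosed fun f g hf hg => ?_
    refine HasContVersion.of_tendsto hT hf (fun n => hi (f n)) (hi g) ?_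
    have h1 := (Lp.tendsto_Lp_iff_tendsto_eLpNorm' f g).1 hg
    exact tendsto_of_tendsto_of_tendsto_of_le_of_le tendsto_const_nhds h1 (fun _ => zero_le)
      fun n => eLpNorm_le_eLpNorm_of_exponent_le one_le_two
        ((Lp.aestronglyMeasurable _).sub (Lp.aestronglyMeasurable _))
  have : CompleteSpace V := hV.completeSpace_coe
  -- An f orthogonal to V is orthogonal to the real and imaginary parts of all cylinder characters,
  -- so its conditional expectation at T is 0. Then f itself belongs to V, being orthogonal to V it
  -- is 0.
  have hort : Vᗮ = ⊥ := by
    rw [Submodule.eq_bot_iff]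
    intro f hf
    have hre : ∀ (L : ℂ →L[ℝ] ℝ) (J : Finset (Horizon T)) (c : Horizon T → Vec d),
        ∫ ω, L ((f ω : ℂ) * cylinderChar W J c ω) ∂P = 0 := by
      intro L J c
      have h1 := (hW.hasContVersion_cylinderChar hT J c).clm L
        (integrable_cylinderChar hT hW.measurable J c)
      have h2 : MemLp (fun ω => L (cylinderChar W J c ω)) 2 P :=
        MemLp.of_bound (L.continuous.comp_aestronglyMeasurable
          (integrable_cylinderChar hT hW.measurable J c).1) (‖L‖ * 1)
          (ae_of_all _ fun ω => (L.le_opNorm _).trans (by rw [norm_cylinderChar]))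
      have h3 : h2.toLp ∈ V := HasContVersion.congr h1 h2.coeFn_toLp.symm
      have h4 := (Submodule.mem_orthogonal V f).1 hf _ h3
      rw [L2.inner_def] at h4
      rw [← h4]
      refine integral_congr_ae ?_
      filter_upwards [h2.coeFn_toLp] with ω h5
      rw [h5, ← Complex.real_smul, map_smul]
      rfl
    have hz := condExp_eq_zero_of_integral_mul_cylinderChar hT hW.measurable (hi f) fun J c => by
      have h5 : Integrable (fun ω => (f ω : ℂ) * cylinderChar W J c ω) P :=
        ((hi f).ofReal (𝕜 := ℂ)).mul_bdd (c := 1)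
          (integrable_cylinderChar hT hW.measurable J c).1
          (ae_of_all _ fun ω => (norm_cylinderChar _ _ _).le)
      have h6 := hre Complex.reCLM J c
      have h7 := hre Complex.imCLM J c
      rw [ContinuousLinearMap.integral_comp_comm _ h5] at h6 h7
      exact Complex.ext h6 h7
    have hmem : f ∈ V := HasContVersion.of_condExp_eq_zero hT hz
    exact inner_self_eq_zero.1 ((Submodule.mem_orthogonal V f).1 hf f hmem)
  have htop : V = ⊤ := (Submodule.orthogonal_eq_bot_iff (K := V)).1 hort
  have h : hY.toLp ∈ V := by rw [htop]; trivial
  exact HasContVersion.congr h hY.coeFn_toLp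

/-- In a Brownian filtration, every square integrable random vector generates a continuous
martingale. -/
lemma IsStdBrownian.exists_contAdapted_condExp [IsProbabilityMeasure P] (hT : 0 < T)
    (hW : IsStdBrownian P W) {n : ℕ} {Y : Ω → Vec n} (hY : MemLp Y 2 P) :
    ∃ m : VProc T Ω n, IsContAdapted (augFiltration P W hW.measurable) m ∧
      ∀ t, m t =ᵐ[P] P[Y | augFiltration P W hW.measurable t] := by
  set 𝓕 := augFiltration P W hW.measurable with h𝓕
  have hYi : Integrable Y P := hY.integrable one_le_two
  have hc : ∀ i, HasContVersion 𝓕 P fun ω => Y ω i • EuclideanSpace.single i (1 : ℝ) := by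
    intro i
    have h1 : MemLp (fun ω => Y ω i) 2 P :=
      hY.of_le_mul (c := 1) ((EuclideanSpace.proj (𝕜 := ℝ) i).continuous.comp_aestronglyMeasurable
        hY.1) (ae_of_all _ fun ω => by rw [one_mul]; exact PiLp.norm_apply_le _ _)
    exact (hW.hasContVersion_of_memLp hT h1).clm
      (ContinuousLinearMap.toSpanSingleton ℝ (EuclideanSpace.single i (1 : ℝ)))
      (h1.integrable one_le_two)
  have hci : ∀ i, Integrable (fun ω => Y ω i • EuclideanSpace.single i (1 : ℝ)) P := fun i =>
    ((EuclideanSpace.proj (𝕜 := ℝ) i).integrable_comp hYi).smul_const _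
  have hs : ∀ s : Finset (Fin n), HasContVersion 𝓕 P
      fun ω => ∑ i ∈ s, Y ω i • EuclideanSpace.single i (1 : ℝ) := by
    intro s
    classical
    induction s using Finset.induction_on with
    | empty =>
      refine HasContVersion.of_condExp_eq_zero hT ?_
      simp only [Finset.sum_empty]
      exact Eventually.of_forall fun ω => by rw [condExp_const (𝓕.le _)]; rfl
    | insert i s hi ih =>
      refine ((hc i).add ih (hci i) (integrable_finsetSum s fun j _ => hci j)).congr
        (ae_of_all _ fun ω => ?_)
      exact (Finset.sum_insert (f := fun j => Y ω j • EuclideanSpace.single j (1 : ℝ)) hi).symm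
  have hsum : ∀ ω, ∑ i, Y ω i • EuclideanSpace.single i (1 : ℝ) = Y ω := by
    intro ω
    ext j
    simp [Finset.sum_apply, Pi.single_apply]
  obtain ⟨m, hmc, hma, hme⟩ := (hs Finset.univ).congr (ae_of_all _ hsum)
  -- The discontinuous paths are covered by a measurable null event; it belongs to every `𝓕 t`, so
  -- setting the process to 0 there keeps it adapted.
  obtain ⟨B, hBsub, hBm, hB0⟩ := exists_measurable_superset_of_null hmc
  have hBF : ∀ t, MeasurableSet[𝓕 t] B := fun t =>
    containsNull_augFiltration P W hW.measurable t B hBm hB0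
  classical
  refine ⟨fun t ω => if ω ∈ B then 0 else m t ω, ⟨fun ω => ?_, fun t => ?_⟩, fun t => ?_⟩
  · by_cases h : ω ∈ B
    · simpa only [h, if_true] using continuous_const
    · simp only [h, if_false]
      by_contra h'
      exact h (hBsub h')
  · exact StronglyMeasurable.ite (hBF t) stronglyMeasurable_const (hma t)
  · refine EventuallyEq.trans ?_ (hme t)
    filter_upwards [measure_eq_zero_iff_ae_notMem.1 hB0] with ω h
    rw [if_neg h]

end Brownian

/-! ### Linear forward-backward equations -/

section ForwardBackward

/-- The solution of `θ'' = r θ' + s θ` with terminal values `θ(T) = 1`, `θ'(T) = 0` is positive. -/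
lemma exists_pos_riccati_solution (r T : ℝ) {s : ℝ} (hs : 0 < s) :
    ∃ θ θ' : ℝ → ℝ, (∀ t, HasDerivAt θ (θ' t) t) ∧
      (∀ t, HasDerivAt θ' (r * θ' t + s * θ t) t) ∧ θ T = 1 ∧ θ' T = 0 ∧ ∀ t, 0 < θ t := by
  set q := Real.sqrt (r ^ 2 + 4 * s) with hq
  have hq2 : q ^ 2 = r ^ 2 + 4 * s := Real.sq_sqrt (by positivity)
  have hq0 : 0 < q := Real.sqrt_pos.2 (by positivity)
  have hrq : |r| < q := abs_lt_of_sq_lt_sq (by nlinarith) hq0.le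
  obtain ⟨h1, h2⟩ := abs_lt.1 hrq
  -- The roots a > 0 > b of λ² = rλ + s. The signs make both terms of a·exp(b(t-T)) - b·exp(a(t-T))
  -- positive.
  set a := (r + q) / 2 with ha
  set b := (r - q) / 2 with hb
  have ha0 : 0 < a := by linarith
  have hb0 : b < 0 := by linarith
  have ha2 : a ^ 2 = r * a + s := by rw [ha]; nlinarith
  have hb2 : b ^ 2 = r * b + s := by rw [hb]; nlinarith
  have hab : 0 < a - b := by linarith
  have hexp : ∀ c t : ℝ, HasDerivAt (fun t => Real.exp (c * (t - T)))
      (c * Real.exp (c * (t - T))) t := by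
    intro c t
    have h3 : HasDerivAt (fun t : ℝ => c * (t - T)) (c * 1) t :=
      ((hasDerivAt_id t).sub_const T).const_mul c
    have h4 := h3.exp
    rwa [mul_one, mul_comm] at h4
  refine ⟨fun t => (a * Real.exp (b * (t - T)) - b * Real.exp (a * (t - T))) / (a - b),
    fun t => (a * (b * Real.exp (b * (t - T))) - b * (a * Real.exp (a * (t - T)))) / (a - b),
    fun t => ?_, fun t => ?_, ?_, ?_, fun t => ?_⟩
  · exact (((hexp b t).const_mul a).sub ((hexp a t).const_mul b)).div_const _
  · have h5 := ((((hexp b t).const_mul b).const_mul a).sub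
      (((hexp a t).const_mul a).const_mul b)).div_const (a - b)
    refine h5.congr_deriv ?_
    field_simp
    linear_combination (a * Real.exp (b * (t - T))) * hb2 - (b * Real.exp (a * (t - T))) * ha2
  · simp [hab.ne']
  · simp [mul_comm]
  · have h6 := Real.exp_pos (b * (t - T))
    have h7 := Real.exp_pos (a * (t - T))
    refine div_pos ?_ hab
    nlinarith [mul_pos ha0 h6, mul_pos (neg_pos.2 hb0) h7]

variable {T : ℝ} {Ω : Type*} {d : ℕ} [mΩ : MeasurableSpace Ω]
  {𝓕 : Filtration (Horizon T) mΩ} {P : Measure Ω}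

lemma InHInf.integrable [IsFiniteMeasure P] (hT : 0 < T) {X : VProc T Ω d}
    (h : InHInf 𝓕 P X) : Integrable (fun p : Horizon T × Ω => X p.1 p.2) (dtP T P) :=
  IsL2.integrable (h.inH2 hT).2

/-- The stochastic integral of a function of time with respect to a continuous martingale,
defined by integration by parts. -/
lemma exists_martingale_integral_time [IsFiniteMeasure P] (hT : 0 < T) (hnull : ContainsNull 𝓕 P)
    {β β' : C(Horizon T, ℝ)} (hβ : HasRate β β') {m : VProc T Ω d} (hm : IsContAdapted 𝓕 m)
    (hmart : Martingale m 𝓕 P) {K : ℝ} (hK : ∀ᵐ ω ∂P, ∀ t, ‖m t ω‖ ≤ K) :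
    ∃ M : VProc T Ω d, Martingale M 𝓕 P ∧ InHInf 𝓕 P M ∧
      ∀ᵐ ω ∂P, ∀ t, M t ω = β t • m t ω - cumul (fun τ ω => β' τ • m τ ω) t ω := by
  have hmInf : InHInf 𝓕 P m := InHInf.of_forall_bound hm.isOptional hK
  have hBm : InHInf 𝓕 P fun τ ω => β' τ • m τ ω := hmInf.mul β'
  obtain ⟨Y, hY, hYe⟩ := exists_contAdapted_cumul hT hnull hBm.1 (hBm.integrable hT)
  obtain ⟨K', hK'⟩ := hBm.exists_cumul_bound hT
  have hYK : ∀ᵐ ω ∂P, ∀ t, ‖Y t ω‖ ≤ K' := by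
    filter_upwards [hYe, hK'] with ω h1 h2 t
    rw [← h1 t]; exact h2 t
  have hmi : ∀ t, Integrable (m t) P := hmart.integrable
  have hYi : ∀ t, Integrable (Y t) P := fun t =>
    Integrable.of_bound ((hY.adapted t).mono (𝓕.le t)).aestronglyMeasurable K'
      (hYK.mono fun ω h => h t)
  have hMa : ∀ t, StronglyMeasurable[𝓕 t] fun ω => β t • m t ω - Y t ω := fun t =>
    ((hm.adapted t).const_smul (β t)).sub (hY.adapted t)
  have hMi : ∀ t, Integrable (fun ω => β t • m t ω - Y t ω) P := fun t =>
    ((hmi t).smul (β t)).sub (hYi t)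
  refine ⟨fun t ω => β t • m t ω - Y t ω, ⟨hMa, fun s t hst => ?_⟩,
    (hmInf.mul β).sub (InHInf.of_forall_bound hY.isOptional hYK), ?_⟩
  · symm
    refine ae_eq_condExp_of_forall_setIntegral_eq (𝓕.le s) (hMi t)
      (fun _ _ _ => (hMi s).integrableOn) (fun B hB _ => ?_) (hMa s).aestronglyMeasurable
    have hBm' : MeasurableSet B := 𝓕.le s B hB
    have hI : ∀ τ, s ≤ τ → ∫ ω in B, m τ ω ∂P = ∫ ω in B, m s ω ∂P := fun τ hτ =>
      (hmart.setIntegral_eq hτ hB).symm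
    have hjm : StronglyMeasurable fun p : Ω × Horizon T => β' p.2 • m p.2 p.1 := by
      have h1 : StronglyMeasurable fun p : Horizon T × Ω => m p.1 p.2 :=
        hm.stronglyMeasurable.mono (optionalSigma_le hT 𝓕)
      exact ((β'.continuous.measurable.comp measurable_snd).stronglyMeasurable).smul
        (h1.comp_measurable measurable_swap)
    -- By Fubini, as the integral of m(τ) over B does not depend on τ ≥ s. It offsets exactly the
    -- change of β(t)·m(t) on B.
    have hfub : ∫ ω in B, (Y t ω - Y s ω) ∂P = (β t - β s) • ∫ ω in B, m s ω ∂P := by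
      have h1 : ∫ ω in B, (Y t ω - Y s ω) ∂P
          = ∫ ω in B, (∫ τ in Set.Ioc s t, β' τ • m τ ω ∂(timeMeasure T)) ∂P := by
        refine integral_congr_ae (ae_restrict_of_ae ?_)
        filter_upwards [hYe, ae_integrable_path (X := fun τ ω => β' τ • m τ ω)
          (hBm.integrable hT)] with ω h2 h3
        rw [← h2 t, ← h2 s]
        exact primitive_sub_primitive h3 hst
      rw [h1, integral_integral_swap]
      · have h4 : ∀ τ ∈ Set.Ioc s t, ∫ ω in B, β' τ • m τ ω ∂P
            = β' τ • ∫ ω in B, m s ω ∂P := fun τ hτ => by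
          rw [integral_smul, hI τ hτ.1.le]
        rw [setIntegral_congr_fun measurableSet_Ioc h4, integral_smul_const, ← hβ.sub_eq s t hst]
      · refine Integrable.of_bound hjm.aestronglyMeasurable (‖β'‖ * K) ?_
        have h5 : ∀ᵐ p : Ω × Horizon T ∂(P.restrict B).prod
            ((timeMeasure T).restrict (Set.Ioc s t)), ∀ τ, ‖m τ p.1‖ ≤ K :=
          Measure.quasiMeasurePreserving_fst.ae (ae_restrict_of_ae hK)
        filter_upwards [h5] with p hp
        simp only [Function.uncurry, norm_smul]
        exact mul_le_mul (β'.norm_coe_le_norm p.2) (hp p.2) (norm_nonneg _) (norm_nonneg _)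
    have h6 : ∀ τ, ∫ ω in B, (β τ • m τ ω - Y τ ω) ∂P
        = β τ • ∫ ω in B, m τ ω ∂P - ∫ ω in B, Y τ ω ∂P := fun τ => by
      rw [← integral_smul]
      exact integral_sub ((hmi τ).smul (β τ)).integrableOn (hYi τ).integrableOn
    rw [integral_sub (hYi t).integrableOn (hYi s).integrableOn] at hfub
    rw [h6, h6, hI t hst, ← sub_eq_zero]
    rw [sub_eq_iff_eq_add] at hfub
    rw [hfub, sub_smul]
    abel
  · filter_upwards [hYe] with ω h t
    rw [h t]

/-- The linear forward-backward equation with a scalar coefficient. -/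
lemma IsStdBrownian.exists_hasDrift_scalar [IsProbabilityMeasure P] (hT : 0 < T) {n : ℕ}
    {W : VProc T Ω n} (hW : IsStdBrownian P W) (r : ℝ) {s : ℝ} (hs : 0 < s) {g : VProc T Ω d}
    (hg : InHInf (augFiltration P W hW.measurable) P g) :
    ∃ u a : VProc T Ω d, HasDrift (augFiltration P W hW.measurable) P u a ∧
      AEEqProc P a fun t ω => r • u t ω + s • cumul u t ω - g t ω := by
  set 𝓕 := augFiltration P W hW.measurable with h𝓕
  have hnull : ContainsNull 𝓕 P := containsNull_augFiltration P W hW.measurable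
  -- Reduction of order: seek the demand as θD. With β = exp(rt)/θ, γ = 1/β, N(t) the conditional
  -- expectation at t of the integral of γg over [t, T], and D the primitive of (β/θ)N, the rate is
  -- u = θ'D + βN. The terms in θ'N cancel in its drift, leaving ru + sθD - g. Since θ'(T) = 0 and
  -- N(T) = 0, also u(T) = 0.
  obtain ⟨θ₀, θ₁, hθ, hθ', hθT, hθ'T, hpos⟩ := exists_pos_riccati_solution r T hs
  have hθc : Continuous θ₀ := continuous_iff_continuousAt.2 fun t => (hθ t).continuousAt
  have hθ₁c : Continuous θ₁ := continuous_iff_continuousAt.2 fun t => (hθ' t).continuousAt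
  have hβd : ∀ t, HasDerivAt (fun t => Real.exp (r * t) / θ₀ t)
      (r * (Real.exp (r * t) / θ₀ t) - θ₁ t * (Real.exp (r * t) / θ₀ t ^ 2)) t := by
    intro t
    have h1 : HasDerivAt (fun t : ℝ => Real.exp (r * t)) (Real.exp (r * t) * (r * 1)) t :=
      ((hasDerivAt_id t).const_mul r).exp
    refine (h1.div (hθ t) (hpos t).ne').congr_deriv ?_
    have := (hpos t).ne'
    field_simp
  have hβ₁c : Continuous fun t => r * (Real.exp (r * t) / θ₀ t)
      - θ₁ t * (Real.exp (r * t) / θ₀ t ^ 2) := by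
    have h1 : ∀ t, θ₀ t ≠ 0 := fun t => (hpos t).ne'
    have h2 : ∀ t, θ₀ t ^ 2 ≠ 0 := fun t => pow_ne_zero 2 (h1 t)
    have h3 : Continuous fun t : ℝ => Real.exp (r * t) := by fun_prop
    exact (continuous_const.mul (h3.div hθc h1)).sub (hθ₁c.mul (h3.div (hθc.pow 2) h2))
  have hθ₂c : Continuous fun t => r * θ₁ t + s * θ₀ t := by fun_prop
  let toC : ∀ f : ℝ → ℝ, Continuous f → C(Horizon T, ℝ) := fun f hf =>
    ⟨fun t => f t, hf.comp continuous_subtype_val⟩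
  have hβc : Continuous fun t => Real.exp (r * t) / θ₀ t :=
    continuous_iff_continuousAt.2 fun t => (hβd t).continuousAt
  have hβ2c : Continuous fun t => Real.exp (r * t) / θ₀ t ^ 2 :=
    (by fun_prop : Continuous fun t : ℝ => Real.exp (r * t)).div (hθc.pow 2)
      fun t => pow_ne_zero 2 (hpos t).ne'
  have hγc : Continuous fun t => θ₀ t / Real.exp (r * t) :=
    hθc.div (by fun_prop) fun t => (Real.exp_pos _).ne'
  set θ := toC _ hθc with hθdef
  set θ' := toC _ hθ₁c with hθ'def
  set θ'' := toC _ hθ₂c with hθ''def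
  set β := toC _ hβc with hβdef
  set β' := toC _ hβ₁c with hβ'def
  set βt := toC _ hβ2c with hβtdef
  set γ := toC _ hγc with hγdef
  have hRθ : HasRate θ θ' := HasRate.of_hasDerivAt hθ hθ₁c
  have hRθ' : HasRate θ' θ'' := HasRate.of_hasDerivAt hθ' hθ₂c
  have hRβ : HasRate β β' := HasRate.of_hasDerivAt hβd hβ₁c
  have hβγ : ∀ t, β t * γ t = 1 := fun t => by
    have h1 := (hpos t).ne'
    have h2 := (Real.exp_pos (r * t)).ne'
    simp only [hβdef, hγdef, toC, ContinuousMap.coe_mk]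
    field_simp
  have hθβ : ∀ t, θ t * βt t = β t := fun t => by
    have h1 := (hpos t).ne'
    simp only [hβdef, hβtdef, hθdef, toC, ContinuousMap.coe_mk]
    field_simp
  have hβ'e : ∀ t, β' t = r * β t - θ' t * βt t := fun t => rfl
  have hθ''e : ∀ t, θ'' t = r * θ' t + s * θ t := fun t => rfl
  have hG : InHInf 𝓕 P fun t ω => γ t • g t ω := hg.mul γ
  obtain ⟨A, hA, hAe⟩ := exists_contAdapted_cumul hT hnull hG.1 (hG.integrable hT)
  obtain ⟨K, hK⟩ := hG.exists_cumul_bound hT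
  have hAK : ∀ᵐ ω ∂P, ∀ t, ‖A t ω‖ ≤ K := by
    filter_upwards [hAe, hK] with ω h1 h2 t
    rw [← h1 t]; exact h2 t
  set L := lastTime hT with hL
  have hAT : MemLp (A L) 2 P :=
    MemLp.of_bound ((hA.adapted L).mono (𝓕.le L)).aestronglyMeasurable K (hAK.mono fun ω h => h L)
  obtain ⟨m, hm, hme⟩ := hW.exists_contAdapted_condExp hT hAT
  have hmart : Martingale m 𝓕 P :=
    (martingale_condExp (A L) 𝓕 P).congr hm.adapted fun t => (hme t).symm
  -- The bound holds a.s. at each time, hence simultaneously on a countable dense set, and extends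
  -- by continuity of the paths.
  have hmK : ∀ᵐ ω ∂P, ∀ t, ‖m t ω‖ ≤ K := by
    obtain ⟨S, hSc, hSd⟩ := TopologicalSpace.exists_countable_dense (Horizon T)
    have h1 : ∀ᵐ ω ∂P, ∀ t ∈ S, ‖m t ω‖ ≤ K := by
      refine (ae_ball_iff hSc).2 fun t _ => ?_
      filter_upwards [hme t, ae_bdd_norm_condExp_of_ae_bdd_norm (m := 𝓕 t)
        (hAK.mono fun ω h => h L)] with ω h1 h2
      rw [h1]; exact h2
    filter_upwards [h1] with ω h2 t
    exact (isClosed_le (hm.continuous ω).norm continuous_const).closure_subset_iff.2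
      (fun τ hτ => h2 τ hτ) (hSd t)
  have hmT : m L =ᵐ[P] A L := by
    refine (hme L).trans ?_
    rw [condExp_of_stronglyMeasurable (𝓕.le L) (hA.adapted L) (hAT.integrable one_le_two)]
  have hmInf : InHInf 𝓕 P m := InHInf.of_forall_bound hm.isOptional hmK
  have hAInf : InHInf 𝓕 P A := InHInf.of_forall_bound hA.isOptional hAK
  have hN : InHInf 𝓕 P fun t ω => m t ω - A t ω := hmInf.sub hAInf
  set N : VProc T Ω d := fun t ω => m t ω - A t ω with hNdef
  have hE : InHInf 𝓕 P fun t ω => βt t • N t ω := hN.mul βt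
  set D : VProc T Ω d := cumul fun t ω => βt t • N t ω with hDdef
  have hD : InHInf 𝓕 P D := hE.cumul hT hnull
  obtain ⟨M, hM, hMInf, hMe⟩ := exists_martingale_integral_time hT hnull hRβ hm hmart hmK
  have hu : InHInf 𝓕 P fun t ω => θ' t • D t ω + β t • N t ω := (hD.mul θ').add (hN.mul β)
  set u : VProc T Ω d := fun t ω => θ' t • D t ω + β t • N t ω with hudef
  have ha : InHInf 𝓕 P fun t ω => r • u t ω + s • (θ t • D t ω) - g t ω :=
    ((hu.smul r).add ((hD.mul θ).smul s)).sub hg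
  have hint : ∀ {X : VProc T Ω d}, InHInf 𝓕 P X →
      ∀ᵐ ω ∂P, Integrable (fun t => X t ω) (timeMeasure T) := fun {X} hX =>
    ae_integrable_path (hX.integrable hT)
  have hcu : ∀ᵐ ω ∂P, ∀ t, cumul u t ω = θ t • D t ω := by
    filter_upwards [hint hE] with ω h1 t
    refine Eq.trans ?_ (hRθ.smul_primitive hT h1 t).symm
    simp only [cumul, primitive, hudef, smul_smul, hθβ]
    refine integral_congr_ae (ae_of_all _ fun τ => add_comm _ _)
  refine ⟨u, _, ⟨M, hu, ?_, ha, hMInf, hM, ?_, ?_⟩, ?_⟩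
  · filter_upwards [hint hE] with ω h1
    exact (θ'.continuous.smul (continuous_primitive h1)).add
      (β.continuous.smul ((hm.continuous ω).sub (hA.continuous ω)))
  · filter_upwards [hint hE, hint hG, hint (hmInf.mul β'), hint ha, hAe, hMe]
      with ω h1 h2 h3 h4 h5 h6
    -- M is the integral of β against m. The product rule applied to θ'D and to β times the
    -- primitive of γg shows that u - M is absolutely continuous with the required drift.
    have h7 : ∀ t, u t ω - M t ω
        = primitive (fun τ => r • u τ ω + s • (θ τ • D τ ω) - g τ ω) t := by
      intro t
      have h8 := hRθ'.smul_primitive hT h1 t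
      have h9 := hRβ.smul_primitive hT h2 t
      have h10 : u t ω - M t ω = θ' t • primitive (fun τ => βt τ • N τ ω) t
          - β t • primitive (fun τ => γ τ • g τ ω) t
          + primitive (fun τ => β' τ • m τ ω) t := by
        have h13 : primitive (fun τ => γ τ • g τ ω) t = A t ω := h5 t
        rw [h6 t, h13]
        change θ' t • D t ω + β t • (m t ω - A t ω)
            - (β t • m t ω - primitive (fun τ => β' τ • m τ ω) t)
          = θ' t • D t ω - β t • A t ω + primitive (fun τ => β' τ • m τ ω) t
        rw [smul_sub]
        abel
      rw [h10, h8, h9, primitive, primitive, primitive, primitive, ← integral_sub, ← integral_add]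
      · refine integral_congr_ae (ae_of_all _ fun τ => ?_)
        have h11 : primitive (fun τ => γ τ • g τ ω) τ = A τ ω := h5 τ
        have h12 : primitive (fun τ => βt τ • N τ ω) τ = D τ ω := rfl
        have h13 : u τ ω = θ' τ • D τ ω + β τ • N τ ω := rfl
        have h14 : N τ ω = m τ ω - A τ ω := rfl
        simp only [h11, h12, h13, hβ'e, hθ''e, smul_smul, hβγ]
        rw [h14]
        module
      · exact (((hRθ'.integrable_smul hT h1).add (hRθ'.integrable_deriv_smul_primitive h1)).sub
          ((hRβ.integrable_smul hT h2).add (hRβ.integrable_deriv_smul_primitive h2))).integrableOn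
      · exact h3.integrableOn
      · exact ((hRθ'.integrable_smul hT h1).add
          (hRθ'.integrable_deriv_smul_primitive h1)).integrableOn
      · exact ((hRβ.integrable_smul hT h2).add
          (hRβ.integrable_deriv_smul_primitive h2)).integrableOn
    intro τ t hτt
    rw [← primitive_sub_primitive h4 hτt, ← h7 t, ← h7 τ]
    abel
  · filter_upwards [hmT] with ω h1 t ht
    have h2 : t = L := Subtype.ext ht
    have h3 : θ' L = 0 := hθ'T
    simp only [hudef, hNdef, h2, h3, h1, zero_smul, sub_self, smul_zero, add_zero]
  · refine AEEqProc.of_forall ?_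
    filter_upwards [hcu] with ω h t
    rw [h t]

open Matrix in
/-- Simultaneous diagonalisation: `Λ⁻¹ S` has positive eigenvalues and a resolution of the
identity into matrices of eigenvectors. -/
lemma exists_spectral_resolution {S Λ : Matrix (Fin d) (Fin d) ℝ} (hS : S.PosDef) (hΛ : Λ.PosDef)
    (hdiag : Λ.IsDiag) : ∃ (s : Fin d → ℝ) (Q : Fin d → Matrix (Fin d) (Fin d) ℝ),
      (∀ k, 0 < s k) ∧ ∑ k, Q k = 1 ∧ ∀ k, Λ⁻¹ * S * Q k = s k • Q k := by
  have hpos : ∀ i, 0 < Λ i i := fun i => hΛ.diag_pos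
  have hsqrt : ∀ i, 0 < Real.sqrt (Λ i i) := fun i => Real.sqrt_pos.2 (hpos i)
  -- D and E are the square root of Λ and its inverse: Λ⁻¹S = E(ESE)D is similar to the symmetric
  -- positive definite matrix ESE, which U diagonalises.
  set D : Matrix (Fin d) (Fin d) ℝ := diagonal fun i => Real.sqrt (Λ i i) with hD
  set E : Matrix (Fin d) (Fin d) ℝ := diagonal fun i => (Real.sqrt (Λ i i))⁻¹ with hE
  have hED : E * D = 1 := by
    rw [hE, hD, diagonal_mul_diagonal, ← diagonal_one]
    exact congrArg diagonal (funext fun i => inv_mul_cancel₀ (hsqrt i).ne')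
  have hDE : D * E = 1 := mul_eq_one_comm.1 hED
  have hDD : D * D = Λ := by
    rw [hD, diagonal_mul_diagonal]
    ext i j
    by_cases h : i = j
    · subst h; rw [diagonal_apply_eq, Real.mul_self_sqrt (hpos i).le]
    · rw [diagonal_apply_ne _ h, hdiag h]
  have hΛE : Λ⁻¹ = E * E := inv_eq_left_inv (by
    rw [← hDD, mul_assoc, ← mul_assoc E D D, hED, one_mul, hED])
  have hB : (E * S * E).PosDef := by
    have h1 : Eᴴ = E := by rw [hE, diagonal_conjTranspose]; congr 1
    have h2 := hS.conjTranspose_mul_mul_same (B := E) fun x y hxy => by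
      have h3 := congrArg (D *ᵥ ·) hxy
      simpa only [mulVec_mulVec, hDE, one_mulVec] using h3
    rwa [h1] at h2
  set U : Matrix (Fin d) (Fin d) ℝ :=
    (hB.1.eigenvectorUnitary : unitaryGroup (Fin d) ℝ).1 with hU
  have hUU : U * star U = 1 := Unitary.coe_mul_star_self _
  have hUU' : star U * U = 1 := Unitary.coe_star_mul_self _
  have hspec : E * S * E = U * diagonal hB.1.eigenvalues * star U := by
    have h4 := hB.1.spectral_theorem
    rw [Unitary.conjStarAlgAut_apply] at h4
    exact h4
  have hpos' := hB.eigenvalues_pos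
  clear_value U
  generalize hB.1.eigenvalues = e at hspec hpos'
  refine ⟨e, fun k => E * U * single k k 1 * star U * D, hpos', ?_, fun k => ?_⟩
  · have h5 : ∑ k : Fin d, single k k (1 : ℝ) = 1 := by
      ext i j
      simp only [Matrix.sum_apply, single_apply, one_apply]
      by_cases h : i = j
      · subst h; simp
      · rw [if_neg h]
        exact Finset.sum_eq_zero fun k _ => if_neg fun hk : k = i ∧ k = j =>
          h (hk.1.symm.trans hk.2)
    rw [← Finset.sum_mul, ← Finset.sum_mul, ← Finset.mul_sum, h5, mul_one, mul_assoc E, hUU,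
      mul_one, hED]
  · have h6 : diagonal e * single k k (1 : ℝ) = e k • single k k (1 : ℝ) := by
      ext i j
      rw [diagonal_mul, Matrix.smul_apply, single_apply]
      by_cases h : k = i ∧ k = j
      · rw [if_pos h, h.1]; rfl
      · rw [if_neg h]; simp
    calc Λ⁻¹ * S * (E * U * single k k 1 * star U * D)
        = E * (E * S * E) * U * single k k 1 * star U * D := by
          rw [hΛE]; simp only [mul_assoc]
      _ = E * U * (diagonal e * ((star U * U) * single k k 1)) * star U * D := by
          rw [hspec]; simp only [mul_assoc]
      _ = _ := by
          rw [hUU', one_mul, h6]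
          simp only [Matrix.mul_smul, Matrix.smul_mul]

/-- The linear forward-backward equation. -/
lemma IsStdBrownian.exists_hasDrift [IsProbabilityMeasure P] (hT : 0 < T) {n : ℕ}
    {W : VProc T Ω n} (hW : IsStdBrownian P W) (r : ℝ) {κ : ℝ} (hκ : 0 < κ)
    {S Λ : Matrix (Fin d) (Fin d) ℝ} (hS : S.PosDef) (hΛ : Λ.PosDef)
    (hdiag : Λ.IsDiag) {g : VProc T Ω d} (hg : InHInf (augFiltration P W hW.measurable) P g) :
    ∃ u a : VProc T Ω d, HasDrift (augFiltration P W hW.measurable) P u a ∧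
      AEEqProc P a fun t ω => r • u t ω + κ • act (Λ⁻¹ * S) (cumul u t ω) - g t ω := by
  obtain ⟨s, Q, hs, hQ, hQs⟩ := exists_spectral_resolution hS hΛ hdiag
  -- Each eigenvalue has its scalar equation with the full inhomogeneity g. Applying `Q k` and
  -- adding gives the solution, since Λ⁻¹S multiplies the range of `Q k` by `s k` and the `Q k` sum
  -- to the identity.
  choose v b hv hb using fun k => hW.exists_hasDrift_scalar hT r (mul_pos hκ (hs k)) hg
  refine ⟨fun t ω => ∑ k, act (Q k) (v k t ω), fun t ω => ∑ k, act (Q k) (b k t ω),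
    HasDrift.sum hT _ fun k _ => (hv k).act hT (Q k), ?_⟩
  have hcum : ∀ᵐ ω ∂P, ∀ t, cumul (fun t ω => ∑ k, act (Q k) (v k t ω)) t ω
      = ∑ k, act (Q k) (cumul (v k) t ω) := by
    have h1 : ∀ k, ∀ᵐ ω ∂P, (∀ t, cumul (fun t ω => act (Q k) (v k t ω)) t ω
        = act (Q k) (cumul (v k) t ω)) ∧
        Integrable (fun t => act (Q k) (v k t ω)) (timeMeasure T) := fun k => by
      filter_upwards [cumul_act_ae (Q k) ((hv k).mem.inH2 hT).2,
        ae_integrable_path (X := fun t ω => act (Q k) (v k t ω))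
          (((hv k).mem.act (Q k)).integrable hT)] with ω h2 h3 using ⟨h2, h3⟩
    filter_upwards [ae_all_iff.2 h1] with ω h2 t
    rw [← Finset.sum_congr rfl fun k _ => (h2 k).1 t]
    exact integral_finsetSum _ fun k _ => (h2 k).2.integrableOn
  have hact : ∀ x : Vec d, ∑ k, act (Q k) x = x := fun x => by
    have h3 : act (∑ k, Q k) x = ∑ k, act (Q k) x := by
      simp [act]
    rw [← h3, hQ, act_one]
  unfold AEEqProc at hb ⊢
  have hcum' : ∀ᵐ p : Horizon T × Ω ∂(dtP T P), ∀ t, cumul (fun t ω => ∑ k, act (Q k) (v k t ω))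
      t p.2 = ∑ k, act (Q k) (cumul (v k) t p.2) := Measure.quasiMeasurePreserving_snd.ae hcum
  filter_upwards [ae_all_iff.2 hb, hcum'] with p h4 h5
  have h6 : ∀ k, act (Q k) (b k p.1 p.2) = r • act (Q k) (v k p.1 p.2)
      + κ • act (Λ⁻¹ * S) (act (Q k) (cumul (v k) p.1 p.2)) - act (Q k) (g p.1 p.2) := by
    intro k
    rw [h4 k, act_sub, act_add, act_smul, act_smul, ← act_mul (Λ⁻¹ * S), hQs]
    congr 2
    rw [mul_smul]
    congr 1
    simp [act]
  rw [Finset.sum_congr rfl fun k _ => h6 k, h5, Finset.sum_sub_distrib, Finset.sum_add_distrib,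
    hact, ← Finset.smul_sum, ← Finset.smul_sum]
  congr 3
  simp [act]

end ForwardBackward

/-! ### The discounted pairing -/

section Pairing

/-- Maximality of a point, for a function with a quadratic expansion around it. -/
lemma forall_le_iff_of_expansion {H : Type*} [AddCommGroup H] [Module ℝ H] (V : Submodule ℝ H)
    {J D q : H → ℝ} {x : H} (hx : x ∈ V) (hJ : ∀ w ∈ V, J (x + w) = J x + D w - q w)
    (hD : ∀ (t : ℝ) w, D (t • w) = t * D w) (hq : ∀ (t : ℝ) w, q (t • w) = t ^ 2 * q w)
    (hq0 : ∀ w, 0 ≤ q w) : (∀ v ∈ V, J v ≤ J x) ↔ ∀ w ∈ V, D w = 0 := by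
  constructor
  · intro h w hw
    have h1 : ∀ t : ℝ, t * D w ≤ t ^ 2 * q w := fun t => by
      have h2 := h (x + t • w) (V.add_mem hx (V.smul_mem t hw))
      rw [hJ _ (V.smul_mem t hw), hD, hq] at h2
      linarith
    by_contra hne
    -- A step short enough for the linear gain to exceed the quadratic loss; the added 1 allows q w
    -- = 0.
    have h3 := h1 (D w / (q w + 1))
    have hpos : 0 < q w + 1 := by linarith [hq0 w]
    have h4 : D w / (q w + 1) * D w = D w ^ 2 * (q w + 1) / (q w + 1) ^ 2 := by
      field_simp
    have h5 : (D w / (q w + 1)) ^ 2 * q w = D w ^ 2 * q w / (q w + 1) ^ 2 := by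
      field_simp
    rw [h4, h5, div_le_div_iff_of_pos_right (by positivity)] at h3
    have h6 : 0 < D w ^ 2 := by positivity
    linarith
  · intro h v hv
    have h1 := hJ (v - x) (V.sub_mem hv hx)
    rw [add_sub_cancel, h _ (V.sub_mem hv hx)] at h1
    linarith [hq0 (v - x)]

variable {T : ℝ} {Ω : Type*} {d : ℕ} [mΩ : MeasurableSpace Ω]
  {𝓕 : Filtration (Horizon T) mΩ} {P : Measure Ω}

/-- The discount factor `e^{-rt}`. -/
def discount (T r : ℝ) : C(Horizon T, ℝ) :=
  ⟨fun t => Real.exp (-r * (t : ℝ)), by fun_prop⟩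

lemma hasRate_discount (r : ℝ) : HasRate (discount T r) (-r • discount T r : C(Horizon T, ℝ)) := by
  refine HasRate.of_hasDerivAt (α := fun t => Real.exp (-r * t))
    (α' := fun t => -r * Real.exp (-r * t)) (fun t => ?_) (by fun_prop)
  have h1 : HasDerivAt (fun t : ℝ => Real.exp (-r * t)) (Real.exp (-r * t) * (-r * 1)) t :=
    ((hasDerivAt_id t).const_mul (-r)).exp
  exact h1.congr_deriv (by ring)

lemma exists_discount_lower_bound (T r : ℝ) : ∃ c : ℝ, 0 < c ∧ ∀ t, c ≤ discount T r t := by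
  refine ⟨Real.exp (-|r| * |T|), Real.exp_pos _, fun t => Real.exp_le_exp.2 ?_⟩
  have h1 : r * t ≤ |r| * |T| := by
    refine (le_abs_self _).trans ?_
    rw [abs_mul]
    refine mul_le_mul_of_nonneg_left ?_ (abs_nonneg _)
    rw [abs_of_nonneg t.2.1]
    exact t.2.2.trans (le_abs_self T)
  simp only [neg_mul]
  exact neg_le_neg h1

/-- The discounted pairing `E ∫ e^{-rt} ⟨x, y⟩ dt`. -/
def discForm (hT : 0 < T) (r : ℝ) :
    HilbertProc 𝓕 P d →L[ℝ] HilbertProc 𝓕 P d →L[ℝ] ℝ :=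
  (innerSL ℝ).comp (opMul hT (discount T r))

variable {hT : 0 < T} {r : ℝ}

lemma discForm_apply (x y : HilbertProc 𝓕 P d) :
    discForm hT r x y = inner ℝ (opMul hT (discount T r) x) y := rfl

lemma discForm_comm (x y : HilbertProc 𝓕 P d) : discForm hT r x y = discForm hT r y x := by
  rw [discForm_apply, discForm_apply, inner_opMul_left, real_inner_comm]

lemma discForm_opA_comm {A : Matrix (Fin d) (Fin d) ℝ} (hA : A.IsHermitian)
    (x y : HilbertProc 𝓕 P d) :
    discForm hT r x (opA hT A y) = discForm hT r y (opA hT A x) := by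
  rw [discForm_comm x, discForm_apply, discForm_apply, ← inner_opA_left hA, opA_opMul]

lemma exists_discForm_lower_bound (hT : 0 < T) (r : ℝ) {A : Matrix (Fin d) (Fin d) ℝ}
    (hA : A.PosDef) :
    ∃ c : ℝ, 0 < c ∧ ∀ x : HilbertProc 𝓕 P d, c * ‖x‖ ^ 2 ≤ discForm hT r x (opA hT A x) := by
  obtain ⟨c₁, h1, h2⟩ := exists_discount_lower_bound T r
  obtain ⟨c₂, h3, h4⟩ := exists_posDef_lower_bound hA
  exact ⟨c₁ * c₂, mul_pos h1 h3, fun x => le_inner_opMul_opA h1.le h3.le h2 h4 x⟩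

lemma discForm_opA_nonneg {A : Matrix (Fin d) (Fin d) ℝ} (hA : A.PosDef)
    (x : HilbertProc 𝓕 P d) : 0 ≤ discForm hT r x (opA hT A x) := by
  obtain ⟨c, h1, h2⟩ := exists_discForm_lower_bound (𝓕 := 𝓕) (P := P) hT r hA
  exact le_trans (by positivity) (h2 x)

lemma eq_zero_of_discForm_opA_le {A : Matrix (Fin d) (Fin d) ℝ} (hA : A.PosDef)
    {x : HilbertProc 𝓕 P d} (h : discForm hT r x (opA hT A x) ≤ 0) : x = 0 := by
  obtain ⟨c, h1, h2⟩ := exists_discForm_lower_bound (𝓕 := 𝓕) (P := P) hT r hA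
  have h3 : ‖x‖ ^ 2 ≤ 0 := by
    by_contra h4
    nlinarith [h2 x, mul_pos h1 (not_le.1 h4)]
  exact norm_eq_zero.1 (pow_eq_zero_iff two_ne_zero |>.1 (le_antisymm h3 (sq_nonneg _)))

lemma opMul_discount_injective {x : HilbertProc 𝓕 P d} (h : opMul hT (discount T r) x = 0) :
    x = 0 := by
  refine eq_zero_of_discForm_opA_le (hT := hT) (r := r) Matrix.PosDef.one ?_
  rw [discForm_apply, h, inner_zero_left]

lemma eq_zero_of_forall_discForm {y : HilbertProc 𝓕 P d} (h : ∀ w, discForm hT r w y = 0) :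
    y = 0 := by
  refine eq_zero_of_discForm_opA_le (hT := hT) (r := r) Matrix.PosDef.one ?_
  rw [opA_one, h]

/-- Moving the discount to y leaves a vector orthogonal to the dense range of C. This turns weak
first-order conditions into equations between processes. -/
lemma eq_zero_of_forall_discForm_opC [IsFiniteMeasure P] {hnull : ContainsNull 𝓕 P}
    {y : HilbertProc 𝓕 P d} (h : ∀ w, discForm hT r (opC hT hnull w) y = 0) : y = 0 := by
  refine opMul_discount_injective (hT := hT) (r := r) (opC_adjoint_injective (hT := hT)
    (hnull := hnull) fun v => ?_)
  rw [← inner_opMul_left]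
  exact h v

lemma opMul_neg_smul (c : ℝ) (α : C(Horizon T, ℝ)) (x : HilbertProc 𝓕 P d) :
    opMul hT (c • α) x = c • opMul hT α x := by
  obtain ⟨X, hX⟩ := exists_process x
  exact (hX.opMul _).eq_of_aeEq ((hX.opMul α).smul c) (ae_of_all _ fun p => mul_smul _ _ _)

/-- Discounted integration by parts against an element of `𝒜`. -/
lemma HasDrift.discForm_eq [IsFiniteMeasure P] {hnull : ContainsNull 𝓕 P}
    {X a : VProc T Ω d} (h : HasDrift 𝓕 P X a) {x α : HilbertProc 𝓕 P d}
    (hX : HasClass X x) (ha : HasClass a α) (A : Matrix (Fin d) (Fin d) ℝ)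
    (w : HilbertProc 𝓕 P d) :
    discForm hT r (opC hT hnull w) (opA hT A (α - r • x)) = - discForm hT r w (opA hT A x) := by
  -- The test process e^{-rt}(w - rCw) is chosen because, by the product rule, its primitive is
  -- e^{-rt}Cw.
  have h1 := (h.act hT A).inner_eq hT (hnull := hnull) (hX.opA (hT := hT) A)
    (ha.opA (hT := hT) A)
    (opMul hT (discount T r) w - r • opMul hT (discount T r) (opC hT hnull w))
  have h2 := opMul_opC (hT := hT) (hnull := hnull) (hasRate_discount r) w
  rw [opMul_neg_smul, neg_smul, ← sub_eq_add_neg] at h2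
  have h3 : ∀ u v : HilbertProc 𝓕 P d, (inner ℝ (r • u) v : ℝ) = r * inner ℝ u v :=
    fun u v => real_inner_smul_left u v r
  have h4 : ∀ u v : HilbertProc 𝓕 P d, (inner ℝ u (r • v) : ℝ) = r * inner ℝ u v :=
    fun u v => real_inner_smul_right u v r
  rw [← h2, inner_sub_left, h3] at h1
  rw [discForm_apply, discForm_apply, map_sub, map_smul, inner_sub_right, h4]
  linarith

/-- Elements of `𝒜`, as classes. -/
def classA (hT : 0 < T) [IsFiniteMeasure P] (𝓕 : Filtration (Horizon T) mΩ) (d : ℕ) :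
    Submodule ℝ (HilbertProc 𝓕 P d) where
  carrier := {x | ∃ X a, HasDrift 𝓕 P X a ∧ HasClass X x}
  add_mem' := by
    rintro x y ⟨X, a, h1, h2⟩ ⟨Y, b, h3, h4⟩
    exact ⟨_, _, h1.add hT h3, h2.add h4⟩
  zero_mem' := ⟨_, _, HasDrift.zero, HasClass.zero⟩
  smul_mem' := by
    rintro c x ⟨X, a, h1, h2⟩
    exact ⟨_, _, h1.smul hT c, h2.smul c⟩

/-- Essentially bounded classes. -/
def classInf (𝓕 : Filtration (Horizon T) mΩ) (P : Measure Ω) (d : ℕ) :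
    Submodule ℝ (HilbertProc 𝓕 P d) where
  carrier := {x | ∃ X, InHInf 𝓕 P X ∧ HasClass X x}
  add_mem' := by
    rintro x y ⟨X, h1, h2⟩ ⟨Y, h3, h4⟩
    exact ⟨_, h1.add h3, h2.add h4⟩
  zero_mem' := ⟨_, InHInf.zero, HasClass.zero⟩
  smul_mem' := by
    rintro c x ⟨X, h1, h2⟩
    exact ⟨_, h1.smul c, h2.smul c⟩

lemma HasClass.mem_classInf [IsFiniteMeasure P] {X : VProc T Ω d} {x : HilbertProc 𝓕 P d}
    (h : HasClass X x) (hX : InHInf 𝓕 P X) : x ∈ classInf 𝓕 P d :=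
  ⟨X, hX, h⟩

lemma HasClass.inHInf [IsFiniteMeasure P] {X : VProc T Ω d} {x : HilbertProc 𝓕 P d}
    (h : HasClass X x) (hx : x ∈ classInf 𝓕 P d) : InHInf 𝓕 P X := by
  obtain ⟨Y, h1, h2⟩ := hx
  exact h1.congr (h2.aeEq h)

lemma opA_mem_classInf [IsFiniteMeasure P] (A : Matrix (Fin d) (Fin d) ℝ)
    {x : HilbertProc 𝓕 P d} (hx : x ∈ classInf 𝓕 P d) :
    opA hT A x ∈ classInf 𝓕 P d := by
  obtain ⟨X, h1, h2⟩ := hx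
  exact ⟨_, h1.act A, h2.opA A⟩

lemma opC_mem_classInf [IsFiniteMeasure P] {hnull : ContainsNull 𝓕 P}
    {x : HilbertProc 𝓕 P d} (hx : x ∈ classInf 𝓕 P d) :
    opC hT hnull x ∈ classInf 𝓕 P d := by
  obtain ⟨X, h1, h2⟩ := hx
  exact ⟨_, h1.cumul hT hnull, h2.opC⟩

/-- Bounded processes are dense: testing against x/(1 + ‖x‖), whose norm is at most 1, already
forces x = 0. -/
lemma eq_zero_of_forall_inner_classInf [IsFiniteMeasure P] (hT : 0 < T)
    {x : HilbertProc 𝓕 P d}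
    (h : ∀ g ∈ classInf 𝓕 P d, (inner ℝ g x : ℝ) = 0) : x = 0 := by
  obtain ⟨X, hX⟩ := exists_process x
  let φ : Vec d → Vec d := fun v => (1 + ‖v‖)⁻¹ • v
  have hφ : Continuous φ :=
    ((continuous_const.add continuous_norm).inv₀ fun v =>
      (by positivity : (0 : ℝ) < 1 + ‖v‖).ne').smul continuous_id
  have hG : InHInf 𝓕 P fun t ω => φ (X t ω) := by
    refine ⟨hφ.comp_aestronglyMeasurable hX.inH2.1, 1, ae_of_all _ fun p => ?_⟩
    simp only [φ]
    rw [norm_smul, norm_inv, Real.norm_of_nonneg (by positivity), inv_mul_le_one₀ (by positivity)]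
    linarith
  obtain ⟨g, hg⟩ := (hG.inH2 hT).exists_rep
  have h1 := h g ⟨_, hG, hg⟩
  rw [hg.inner_eq hX] at h1
  have h2 : ∀ v : Vec d, (inner ℝ (φ v) v : ℝ) = (1 + ‖v‖)⁻¹ * ‖v‖ ^ 2 := fun v => by
    simp only [φ]
    rw [real_inner_smul_left, real_inner_self_eq_norm_sq]
  simp only [h2] at h1
  have h3 := (integral_eq_zero_iff_of_nonneg_ae (ae_of_all _ fun p => by positivity) (by
    have h4 := IsL2.integrable_inner (X := fun t ω => φ (X t ω)) (hG.inH2 hT).2 hX.inH2.2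
    simpa only [h2] using h4)).1 h1
  refine hX.eq_of_aeEq HasClass.zero ?_
  filter_upwards [h3] with p h5
  simp only [Pi.zero_apply, mul_eq_zero, inv_eq_zero] at h5
  rcases h5 with h5 | h5
  · have : 0 < 1 + ‖X p.1 p.2‖ := by positivity
    exact absurd h5 this.ne'
  · exact norm_eq_zero.1 (pow_eq_zero_iff two_ne_zero |>.1 h5)

lemma completeSpace_hilbertProc (hT : 0 < T) : CompleteSpace (HilbertProc 𝓕 P d) := by
  have : Fact (optionalSigma 𝓕 ≤ (inferInstance : MeasurableSpace (Horizon T × Ω))) :=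
    ⟨optionalSigma_le hT 𝓕⟩
  infer_instance

/-- The primitives of elements of `𝒜` are dense. -/
lemma eq_zero_of_forall_discForm_opC_classA [IsFiniteMeasure P] {hnull : ContainsNull 𝓕 P}
    {y : HilbertProc 𝓕 P d}
    (h : ∀ w ∈ classA (P := P) hT 𝓕 d, discForm hT r (opC hT hnull w) y = 0) : y = 0 := by
  have := completeSpace_hilbertProc (𝓕 := 𝓕) (P := P) (d := d) hT
  -- For bounded g the process (T - t)Cg lies in 𝒜, the factor providing the terminal zero. Testing
  -- with it shows that C*τC* kills the discounted y; C* is injective, and τ vanishes only at the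
  -- null instant T.
  let τ : C(Horizon T, ℝ) := ⟨fun t => T - t, by fun_prop⟩
  have hτ : HasRate τ (ContinuousMap.const (Horizon T) (-1 : ℝ)) := by
    refine HasRate.of_hasDerivAt (α := fun t => T - t) (α' := fun _ => -1) (fun t => ?_)
      continuous_const
    simpa using (hasDerivAt_id t).const_sub T
  have hτ0 : τ (lastTime hT) = 0 := sub_self T
  set C := opC (d := d) hT hnull with hC
  set z := opMul hT (discount T r) y with hz
  have h1 : ∀ g ∈ classInf 𝓕 P d,
      (inner ℝ g (ContinuousLinearMap.adjoint C (opMul hT τ (ContinuousLinearMap.adjoint C z)))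
        : ℝ) = 0 := by
    rintro g ⟨G, hG, hGg⟩
    have h2 := h (opMul hT τ (C g)) ⟨_, _, hasDrift_mul_cumul hT hnull hτ hτ0 hG,
      hGg.opC.opMul τ⟩
    rw [ContinuousLinearMap.adjoint_inner_right, ← inner_opMul_left,
      ContinuousLinearMap.adjoint_inner_right, hz, ← inner_opMul_left]
    exact h2
  have h3 := eq_zero_of_forall_inner_classInf hT h1
  have h4 : opMul hT τ (ContinuousLinearMap.adjoint C z) = 0 := by
    refine opC_adjoint_injective (hT := hT) (hnull := hnull) fun v => ?_
    rw [← ContinuousLinearMap.adjoint_inner_right, h3, inner_zero_right]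
  have h5 : ContinuousLinearMap.adjoint C z = 0 := by
    obtain ⟨X, hX⟩ := exists_process (ContinuousLinearMap.adjoint C z)
    have h6 := HasClass.aeEq (hX.opMul (hT := hT) τ) (h4 ▸ HasClass.zero)
    refine hX.eq_of_aeEq HasClass.zero ?_
    have h7 : ∀ᵐ t ∂(timeMeasure T), t ≠ lastTime hT := by
      rw [ae_iff]
      simp
    have h8 : ∀ᵐ p : Horizon T × Ω ∂(dtP T P), p.1 ≠ lastTime hT :=
      Measure.quasiMeasurePreserving_fst.ae h7
    filter_upwards [h6, h8] with p h9 h10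
    refine (smul_eq_zero.1 h9).resolve_left fun h11 => h10 (Subtype.ext ?_)
    exact (sub_eq_zero.1 h11).symm
  refine opMul_discount_injective (hT := hT) (r := r)
    (opC_adjoint_injective (hT := hT) (hnull := hnull) fun v => ?_)
  rw [← ContinuousLinearMap.adjoint_inner_right, ← hz, h5, inner_zero_right]

/-- The drift of an element of `𝒜` is determined by its class. -/
lemma HasDrift.class_eq_zero [IsFiniteMeasure P] {hnull : ContainsNull 𝓕 P}
    {X a : VProc T Ω d} (h : HasDrift 𝓕 P X a) {α : HilbertProc 𝓕 P d}
    (hX : HasClass X (0 : HilbertProc 𝓕 P d)) (ha : HasClass a α) (hT : 0 < T) : α = 0 := by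
  refine opC_adjoint_injective (hT := hT) (hnull := hnull) fun v => ?_
  have h1 := h.inner_eq hT (hnull := hnull) hX ha v
  rw [inner_zero_right] at h1
  linarith

end Pairing

/-! ### Quadratic optimisation -/

section Quadratic

variable {H : Type*} [NormedAddCommGroup H] [InnerProductSpace ℝ H] (B : H →L[ℝ] H →L[ℝ] ℝ)
  (C S L : H →L[ℝ] H)

/-- First order condition for a concave quadratic functional. -/
lemma quadratic_max_iff (hS : ∀ x y, B x (S y) = B y (S x)) (hL : ∀ x y, B x (L y) = B y (L x))
    (hS0 : ∀ x, 0 ≤ B x (S x)) (hL0 : ∀ x, 0 ≤ B x (L x)) {c e f : ℝ} (hc : 0 ≤ c) (he : 0 ≤ e)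
    (hf : 0 ≤ f) (n k y : H) (V : Submodule ℝ H) {J : H → ℝ}
    (hJ : ∀ x ∈ V, J x = B (C x) n - e * B (C x) (S (C x)) - f * B x (L x) + B x k
      - c * B (C x + y) (S (C x + y))) {x : H} (hx : x ∈ V) :
    (∀ v ∈ V, J v ≤ J x) ↔ ∀ w ∈ V, B (C w) (n - (2 * e) • S (C x) - (2 * c) • S (C x + y))
      + B w (k - (2 * f) • L x) = 0 := by
  -- In the applications `c` is the weight of the risk penalty, `e` that of the investor's own price
  -- impact, and `f` that of trading costs. Symmetry of S and L doubles the cross terms.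
  refine forall_le_iff_of_expansion V hx
    (q := fun w => (e + c) * B (C w) (S (C w)) + f * B w (L w)) (fun w hw => ?_)
    (fun t w => ?_) (fun t w => ?_) (fun w => ?_)
  · rw [hJ _ (V.add_mem hx hw), hJ x hx]
    have h1 := hS (C x) (C w)
    have h2 := hL x w
    have h3 := hS y (C w)
    simp only [map_add, map_sub, map_smul, _root_.add_apply, smul_eq_mul]
    rw [h1, h2, h3]
    ring
  · simp only [map_smul, _root_.smul_apply, smul_eq_mul]
    ring
  · simp only [map_smul, _root_.smul_apply, smul_eq_mul]
    ring
  · have := hS0 (C w)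
    have := hL0 w
    positivity

/-- Solvability of the first order condition. -/
lemma exists_quadratic_critical [CompleteSpace H] (hS0 : ∀ x, 0 ≤ B x (S x)) {l : ℝ}
    (hl : 0 < l) (hL0 : ∀ x, l * ‖x‖ ^ 2 ≤ B x (L x)) {c f : ℝ} (hc : 0 ≤ c) (hf : 0 < f)
    (n y : H) :
    ∃ x, ∀ w, B (C w) (n - c • S (C x + y)) - f * B w (L x) = 0 := by
  -- Lax–Milgram. The trading cost alone makes this form coercive; the risk term contributes a
  -- nonnegative amount.
  let A : H →L[ℝ] H →L[ℝ] ℝ :=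
    (c • B.bilinearComp C (S.comp C) + f • B.bilinearComp (ContinuousLinearMap.id ℝ H) L).flip
  have hA : ∀ x w, A x w = c * B (C w) (S (C x)) + f * B w (L x) := fun x w => rfl
  have hcoer : IsCoercive A := by
    refine ⟨f * l, mul_pos hf hl, fun u => ?_⟩
    rw [hA]
    have h1 := mul_nonneg hc (hS0 (C u))
    have h2 := mul_le_mul_of_nonneg_left (hL0 u) hf.le
    nlinarith
  let b : H →L[ℝ] ℝ := (B.flip (n - c • S y)).comp C
  refine ⟨hcoer.continuousLinearEquivOfBilin.symm ((InnerProductSpace.toDual ℝ H).symm b),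
    fun w => ?_⟩
  set x := hcoer.continuousLinearEquivOfBilin.symm ((InnerProductSpace.toDual ℝ H).symm b)
    with hx
  have h1 := hcoer.continuousLinearEquivOfBilin_apply x w
  rw [hx, ContinuousLinearEquiv.apply_symm_apply, InnerProductSpace.toDual_symm_apply, ← hx,
    hA] at h1
  have h2 : b w = B (C w) (n - c • S y) := rfl
  rw [h2] at h1
  simp only [map_add, map_sub, map_smul, smul_eq_mul] at h1 ⊢
  linarith

end Quadratic

/-! ### The market without transaction costs -/

section Frictionless

variable {T : ℝ} {Ω : Type*} {d N : ℕ} [mΩ : MeasurableSpace Ω]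
  {𝓕 : Filtration (Horizon T) mΩ} {P : Measure Ω} {K : Market T Ω d N} {hT : 0 < T}

lemma HasClass.integral_discount_inner {X Y : VProc T Ω d} {x y : HilbertProc 𝓕 P d}
    (hX : HasClass X x) (hY : HasClass Y y) (r : ℝ) :
    Integrable (fun p : Horizon T × Ω =>
        Real.exp (-r * (p.1 : ℝ)) * (inner ℝ (X p.1 p.2) (Y p.1 p.2) : ℝ)) (dtP T P) ∧
      ∫ p, Real.exp (-r * (p.1 : ℝ)) * (inner ℝ (X p.1 p.2) (Y p.1 p.2) : ℝ) ∂(dtP T P)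
        = discForm hT r x y := by
  have h1 := hX.opMul (hT := hT) (discount T r)
  have h2 := IsL2.integrable_inner (X := fun t ω => discount T r t • X t ω) h1.inH2.2 hY.inH2.2
  have h3 := h1.inner_eq hY
  simp only [real_inner_smul_left] at h2 h3
  exact ⟨h2, h3.symm⟩

lemma Market.objective_eq (m : Fin N) {z ν φ : VProc T Ω d} {y n x : HilbertProc 𝓕 P d}
    (hz : HasClass z y) (hν : HasClass ν n) (hφ : HasClass φ x) :
    K.objective P m z ν φ = discForm hT K.r x n
      - 1 / (2 * K.tol m) * discForm hT K.r (x + y) (opA hT K.cov (x + y)) := by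
  obtain ⟨h1, h2⟩ := hφ.integral_discount_inner (hT := hT) hν K.r
  obtain ⟨h3, h4⟩ := (hφ.add hz).integral_discount_inner (hT := hT)
    ((hφ.add hz).opA (hT := hT) K.cov) K.r
  rw [← h2, ← h4, ← integral_const_mul, ← integral_sub h1 (h3.const_mul _)]
  refine integral_congr_ae (ae_of_all _ fun p => ?_)
  simp only [Market.payoff]
  ring

lemma Market.costObjective_eq [IsFiniteMeasure P] {hnull : ContainsNull 𝓕 P} (m : Fin N)
    {z ν u : VProc T Ω d} {y n x : HilbertProc 𝓕 P d}
    (hz : HasClass z y) (hν : HasClass ν n) (hu : HasClass u x) :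
    K.costObjective P m z ν u = discForm hT K.r (opC hT hnull x) n
      - 1 / (2 * K.tol m) * discForm hT K.r (opC hT hnull x + y)
        (opA hT K.cov (opC hT hnull x + y))
      - discForm hT K.r x (opA hT K.cost x) := by
  have hφ := hu.opC (hT := hT) (hnull := hnull)
  obtain ⟨h1, h2⟩ := hφ.integral_discount_inner (hT := hT) hν K.r
  obtain ⟨h3, h4⟩ := (hφ.add hz).integral_discount_inner (hT := hT)
    ((hφ.add hz).opA (hT := hT) K.cov) K.r
  obtain ⟨h5, h6⟩ := hu.integral_discount_inner (hT := hT) (hu.opA (hT := hT) K.cost) K.r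
  have h7 : Integrable (fun p : Horizon T × Ω =>
      Real.exp (-K.r * (p.1 : ℝ)) * (inner ℝ (cumul u p.1 p.2) (ν p.1 p.2) : ℝ)
        - 1 / (2 * K.tol m) * (Real.exp (-K.r * (p.1 : ℝ)) * (inner ℝ (cumul u p.1 p.2
          + z p.1 p.2) (act K.cov (cumul u p.1 p.2 + z p.1 p.2)) : ℝ))) (dtP T P) :=
    h1.sub (h3.const_mul _)
  rw [← h2, ← h4, ← h6, ← integral_const_mul, ← integral_sub h1 (h3.const_mul _),
    ← integral_sub h7 h5]
  refine integral_congr_ae (ae_of_all _ fun p => ?_)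
  simp only [Market.payoff]
  ring

lemma opA_opA_inv {A : Matrix (Fin d) (Fin d) ℝ} (hA : A.PosDef) (x : HilbertProc 𝓕 P d) :
    opA hT A (opA hT A⁻¹ x) = x := by
  rw [opA_opA, Matrix.mul_nonsing_inv _ (A.isUnit_iff_isUnit_det.1 hA.isUnit), opA_one]

lemma opA_inv_opA {A : Matrix (Fin d) (Fin d) ℝ} (hA : A.PosDef) (x : HilbertProc 𝓕 P d) :
    opA hT A⁻¹ (opA hT A x) = x := by
  rw [opA_opA, Matrix.nonsing_inv_mul _ (A.isUnit_iff_isUnit_det.1 hA.isUnit), opA_one]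

/-- Without costs every direction in the space is an admissible test, so the first-order condition
is a pointwise equation. -/
lemma Market.priceTaking_iff (hcov : K.cov.PosDef) {m : Fin N} (hδ : 0 < K.tol m)
    {z ν φ : VProc T Ω d} {y n x : HilbertProc 𝓕 P d}
    (hz : HasClass z y) (hν : HasClass ν n) (hφ : HasClass φ x) :
    K.PriceTaking 𝓕 P m z ν φ ↔ n = (K.tol m)⁻¹ • opA hT K.cov (x + y) := by
  have h1 : K.PriceTaking 𝓕 P m z ν φ ↔ ∀ v ∈ (⊤ : Submodule ℝ (HilbertProc 𝓕 P d)),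
      discForm hT K.r v n - 1 / (2 * K.tol m) * discForm hT K.r (v + y) (opA hT K.cov (v + y))
        ≤ discForm hT K.r x n
          - 1 / (2 * K.tol m) * discForm hT K.r (x + y) (opA hT K.cov (x + y)) := by
    constructor
    · rintro ⟨-, h⟩ v -
      obtain ⟨θ, hθ⟩ := exists_process v
      have h2 := h θ hθ.inH2
      rwa [K.objective_eq (hT := hT) m hz hν hθ, K.objective_eq (hT := hT) m hz hν hφ] at h2
    · intro h
      refine ⟨hφ.inH2, fun θ hθ => ?_⟩
      obtain ⟨v, hv⟩ := hθ.exists_rep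
      rw [K.objective_eq (hT := hT) m hz hν hv, K.objective_eq (hT := hT) m hz hν hφ]
      exact h v trivial
  rw [h1, quadratic_max_iff (discForm hT K.r) (ContinuousLinearMap.id ℝ _) (opA hT K.cov) 0
    (discForm_opA_comm hcov.1) (by simp) (discForm_opA_nonneg hcov) (by simp)
    (c := 1 / (2 * K.tol m)) (e := 0) (f := 0) (by positivity) le_rfl le_rfl n 0 y ⊤
    (J := fun v => discForm hT K.r v n
      - 1 / (2 * K.tol m) * discForm hT K.r (v + y) (opA hT K.cov (v + y)))
    (fun v _ => by simp) (x := x) trivial]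
  have h3 : 2 * (1 / (2 * K.tol m)) = (K.tol m)⁻¹ := by field_simp
  simp only [h3, ContinuousLinearMap.id_apply, mul_zero, zero_smul, sub_zero, map_zero, add_zero]
  constructor
  · intro h
    exact sub_eq_zero.1 (eq_zero_of_forall_discForm (hT := hT) (r := K.r) fun w => h w trivial)
  · intro h w _
    rw [← h, sub_self, map_zero]

/-- The sum of the N - 1 conditions of the rivals, with their total demand replaced through
clearing. Conversely the returns determine each rival's demand as δΣ⁻¹k - y_i, and these clear. -/
lemma Market.priceImpact_iff (hN : 2 ≤ N) (hcov : K.cov.PosDef) {δ : ℝ} (hδ : 0 < δ)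
    (htol : ∀ m, K.tol m = δ) (n : Fin N) {z : Fin N → VProc T Ω d} {φ ν : VProc T Ω d}
    {y : Fin N → HilbertProc 𝓕 P d} {x k p : HilbertProc 𝓕 P d}
    (hz : ∀ i, HasClass (z i) (y i)) (hφ : HasClass φ x) (hν : HasClass ν k)
    (hψ : HasClass K.noise p) :
    K.PriceImpact 𝓕 P z n φ ν ↔
      ((N : ℝ) - 1) • k = δ⁻¹ • opA hT K.cov (∑ i ∈ Finset.univ.erase n, y i - x - p) := by
  have hpt : ∀ i {χ : VProc T Ω d} {c : HilbertProc 𝓕 P d}, HasClass χ c →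
      (K.PriceTaking 𝓕 P i (z i) ν χ ↔ k = δ⁻¹ • opA hT K.cov (c + y i)) := fun i χ c hχ => by
    rw [K.priceTaking_iff hcov (by rw [htol]; exact hδ) (hz i) hν hχ (hT := hT), htol]
  have hcard : ∑ _i ∈ Finset.univ.erase n, k = ((N : ℝ) - 1) • k := by
    rw [Finset.sum_const, Finset.card_erase_of_mem (Finset.mem_univ n), Finset.card_univ,
      Fintype.card_fin, ← Nat.cast_smul_eq_nsmul ℝ, Nat.cast_sub (by omega), Nat.cast_one]
  constructor
  · rintro ⟨-, χ, h1, h2⟩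
    choose! c hc using fun i (hi : i ≠ n) => (h1 i hi).1.exists_rep
    have hc' : ∀ i ∈ Finset.univ.erase n, HasClass (χ i) (c i) := fun i hi =>
      hc i (Finset.ne_of_mem_erase hi)
    have h3 : x + ∑ i ∈ Finset.univ.erase n, c i + p = 0 :=
      ((hφ.add (HasClass.sum _ hc')).add hψ).eq_of_aeEq HasClass.zero h2
    have h4 : ∑ i ∈ Finset.univ.erase n, y i - x - p
        = ∑ i ∈ Finset.univ.erase n, (c i + y i) := by
      rw [Finset.sum_add_distrib]
      linear_combination (norm := module) (-1 : ℝ) • h3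
    rw [h4, map_sum, Finset.smul_sum, ← hcard]
    exact Finset.sum_congr rfl fun i hi => (hpt i (hc' i hi)).1 (h1 i (Finset.ne_of_mem_erase hi))
  · intro h
    have hc : ∀ i, ∃ χ : VProc T Ω d, HasClass χ (δ • opA hT K.cov⁻¹ k - y i) := fun i =>
      exists_process _
    choose χ hχ using hc
    refine ⟨hν.inH2, χ, fun i _ => (hpt i (hχ i)).2 ?_, ?_⟩
    · rw [sub_add_cancel, map_smul, opA_opA_inv hcov, smul_smul, inv_mul_cancel₀ hδ.ne', one_smul]
    · have h7 := (hφ.add (HasClass.sum (Finset.univ.erase n) fun i _ => hχ i)).add hψ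
      have h5 := congrArg (fun v => δ • opA hT K.cov⁻¹ v) h
      simp only [map_smul, opA_inv_opA hcov, smul_smul, mul_inv_cancel₀ hδ.ne', one_smul] at h5
      have h6 : x + ∑ i ∈ Finset.univ.erase n, (δ • opA hT K.cov⁻¹ k - y i) + p = 0 := by
        rw [Finset.sum_sub_distrib, Finset.sum_const, Finset.card_erase_of_mem (Finset.mem_univ n),
          Finset.card_univ, Fintype.card_fin, ← Nat.cast_smul_eq_nsmul ℝ,
          Nat.cast_sub (by omega), Nat.cast_one]
        linear_combination (norm := module) (1 : ℝ) • h5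
      rw [h6] at h7
      exact h7.aeEq HasClass.zero

/-- Her demand moves the returns with slope -eΣ, where e = 1/((N-1)δ). Differentiating her quadratic
gain from trading doubles this, and risk adds 1/δ = (N-1)e; hence the coefficient N + 1. -/
lemma Market.bestResponse_iff (hN : 2 ≤ N) (hcov : K.cov.PosDef) {δ : ℝ} (hδ : 0 < δ)
    (htol : ∀ m, K.tol m = δ) (n : Fin N) {z : Fin N → VProc T Ω d} {φ : VProc T Ω d}
    {y : Fin N → HilbertProc 𝓕 P d} {x p : HilbertProc 𝓕 P d}
    (hz : ∀ i, HasClass (z i) (y i)) (hφ : HasClass φ x) (hψ : HasClass K.noise p) (hT : 0 < T) :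
    K.BestResponse 𝓕 P z n φ ↔
      ((N : ℝ) + 1) • x = ∑ i ∈ Finset.univ.erase n, y i - p - ((N : ℝ) - 1) • y n := by
  have hN1 : (0 : ℝ) < (N : ℝ) - 1 := by
    have : (2 : ℝ) ≤ N := by exact_mod_cast hN
    linarith
  set Y := ∑ i ∈ Finset.univ.erase n, y i with hY
  set e : ℝ := ((N : ℝ) - 1)⁻¹ * δ⁻¹ with he
  have he0 : 0 < e := by positivity
  have hpi : ∀ {θ κ : VProc T Ω d} {v k : HilbertProc 𝓕 P d}, HasClass θ v → HasClass κ k →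
      (K.PriceImpact 𝓕 P z n θ κ ↔ k = e • opA hT K.cov (Y - v - p)) := by
    intro θ κ v k hθ hκ
    rw [K.priceImpact_iff hN hcov hδ htol n hz hθ hκ hψ (hT := hT), he, mul_smul]
    exact (eq_inv_smul_iff₀ hN1.ne').symm
  have hobj : ∀ {θ κ : VProc T Ω d} {v k : HilbertProc 𝓕 P d}, HasClass θ v → HasClass κ k →
      K.objective P n (z n) κ θ = discForm hT K.r v k
        - 1 / (2 * δ) * discForm hT K.r (v + y n) (opA hT K.cov (v + y n)) := by
    intro θ κ v k hθ hκ
    rw [K.objective_eq (hT := hT) n (hz n) hκ hθ, htol]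
  let J : HilbertProc 𝓕 P d → ℝ := fun v => discForm hT K.r v (e • opA hT K.cov (Y - v - p))
    - 1 / (2 * δ) * discForm hT K.r (v + y n) (opA hT K.cov (v + y n))
  have h1 : K.BestResponse 𝓕 P z n φ ↔ ∀ v ∈ (⊤ : Submodule ℝ (HilbertProc 𝓕 P d)),
      J v ≤ J x := by
    constructor
    · rintro ⟨-, μ, h2, h3⟩ v -
      obtain ⟨m, hm⟩ := h2.1.exists_rep
      obtain ⟨θ, hθ⟩ := exists_process v
      obtain ⟨κ, hκ⟩ := exists_process (e • opA hT K.cov (Y - v - p))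
      have h4 := h3 θ κ hθ.inH2 ((hpi hθ hκ).2 rfl)
      rw [hobj hθ hκ, hobj hφ hm, (hpi hφ hm).1 h2] at h4
      exact h4
    · intro h
      obtain ⟨μ, hμ⟩ := exists_process (e • opA hT K.cov (Y - x - p))
      refine ⟨hφ.inH2, μ, (hpi hφ hμ).2 rfl, fun θ κ hθ hκ => ?_⟩
      obtain ⟨v, hv⟩ := hθ.exists_rep
      obtain ⟨k, hk⟩ := hκ.1.exists_rep
      rw [hobj hv hk, hobj hφ hμ, (hpi hv hk).1 hκ]
      exact h v trivial
  rw [h1, quadratic_max_iff (discForm hT K.r) (ContinuousLinearMap.id ℝ _) (opA hT K.cov) 0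
    (discForm_opA_comm hcov.1) (by simp) (discForm_opA_nonneg hcov) (by simp)
    (c := 1 / (2 * δ)) (e := e) (f := 0) (by positivity) he0.le le_rfl
    (e • opA hT K.cov (Y - p)) 0 (y n) ⊤ (J := J) (fun v _ => ?_) (x := x) trivial]
  · have h3 : 2 * (1 / (2 * δ)) = δ⁻¹ := by field_simp
    simp only [h3, ContinuousLinearMap.id_apply, mul_zero, zero_smul, sub_zero, map_zero, add_zero]
    have h5 : e • opA hT K.cov (Y - p) - (2 * e) • opA hT K.cov x - δ⁻¹ • opA hT K.cov (x + y n)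
        = opA hT K.cov (e • (Y - p - ((N : ℝ) - 1) • y n - ((N : ℝ) + 1) • x)) := by
      have h6 : δ⁻¹ = e * ((N : ℝ) - 1) := by rw [he]; field_simp
      rw [h6]
      simp only [map_add, map_sub, map_smul]
      module
    rw [h5]
    constructor
    · intro h
      have h7 := eq_zero_of_forall_discForm (hT := hT) (r := K.r) fun w => h w trivial
      have h8 := opA_inv_opA (hT := hT) hcov
        (e • (Y - p - ((N : ℝ) - 1) • y n - ((N : ℝ) + 1) • x))
      rw [h7, map_zero] at h8
      exact (sub_eq_zero.1 ((smul_eq_zero.1 h8.symm).resolve_left he0.ne')).symm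
    · intro h w _
      rw [h, sub_self, smul_zero, map_zero, map_zero]
  · simp only [J, ContinuousLinearMap.id_apply, map_sub, map_smul, smul_eq_mul,
      map_zero, zero_mul, add_zero, sub_zero]
    ring

lemma HasClass.revealed {ν φ : VProc T Ω d} {n x : HilbertProc 𝓕 P d} (hν : HasClass ν n)
    (hφ : HasClass φ x) (m : Fin N) (hT : 0 < T) :
    HasClass (K.revealed m ν φ) (K.tol m • _root_.opA hT K.cov⁻¹ n - x) :=
  ((hν.opA K.cov⁻¹).smul (K.tol m)).sub hφ

lemma HasClass.facedExpo {ν : VProc T Ω d} {φ : Fin N → VProc T Ω d} {n : HilbertProc 𝓕 P d}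
    {x ζ : Fin N → HilbertProc 𝓕 P d} (hν : HasClass ν n) (hφ : ∀ i, HasClass (φ i) (x i))
    (hζ : ∀ i, HasClass (K.expo i) (ζ i)) (m : Fin N) (hT : 0 < T) (i : Fin N) :
    HasClass (K.facedExpo ν φ m i)
      (if i = m then ζ m else K.tol i • _root_.opA hT K.cov⁻¹ n - x i) := by
  unfold Market.facedExpo
  split_ifs with h
  · exact hζ m
  · exact hν.revealed (hφ i) i hT

/-- The aggregate exposure that an investor faces at clearing demands. -/
lemma sum_revealed_eq {H : Type*} [AddCommGroup H] [Module ℝ H] (hN : 2 ≤ N) (x ζ : Fin N → H)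
    (v p : H) (hx : ∑ i, x i + p = 0) (m : Fin N) :
    ∑ i ∈ Finset.univ.erase m, (if i = m then ζ m else v - x i)
      = ((N : ℝ) - 1) • v + x m + p := by
  have h1 : ∑ i ∈ Finset.univ.erase m, (if i = m then ζ m else v - x i)
      = ∑ i ∈ Finset.univ.erase m, (v - x i) :=
    Finset.sum_congr rfl fun i hi => if_neg (Finset.ne_of_mem_erase hi)
  have h2 := Finset.add_sum_erase Finset.univ x (Finset.mem_univ m)
  rw [h1, Finset.sum_sub_distrib, Finset.sum_const, Finset.card_erase_of_mem (Finset.mem_univ m),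
    Finset.card_univ, Fintype.card_fin, ← Nat.cast_smul_eq_nsmul ℝ, Nat.cast_sub (by omega),
    Nat.cast_one]
  rw [← h2] at hx
  linear_combination (norm := module) (-1 : ℝ) • hx

/-- With all weights 1/N the denominator is (N-1)/N, and the same factor multiplies ζ in the
numerator, so it survives only in front of the noise. -/
lemma Market.hasClass_nashFormula (hN : 2 ≤ N) {δ : ℝ} (hδ : 0 < δ) (htol : ∀ m, K.tol m = δ)
    {ζ : Fin N → HilbertProc 𝓕 P d} {p : HilbertProc 𝓕 P d}
    (hζ : ∀ i, HasClass (K.expo i) (ζ i)) (hψ : HasClass K.noise p) (hT : 0 < T) :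
    HasClass K.nashFormula
      (((N : ℝ) * δ)⁻¹ • opA hT K.cov (∑ i, ζ i - ((N : ℝ) / ((N : ℝ) - 1)) • p)) := by
  have hN2 : (2 : ℝ) ≤ N := by exact_mod_cast hN
  have hN0 : (N : ℝ) ≠ 0 := by linarith
  have hN1 : (N : ℝ) - 1 ≠ 0 := by linarith
  have h1 := (((HasClass.sum Finset.univ fun i _ => hζ i).sub hψ).sub
    (HasClass.sum Finset.univ fun m _ => (hζ m).smul (K.tol m / ∑ i, K.tol i))).opA (hT := hT) K.cov
  have h2 := h1.smul ((∑ m, K.tol m)⁻¹ * (1 - ∑ m, (K.tol m / ∑ i, K.tol i) ^ 2)⁻¹)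
  have h3 : ∑ i, K.tol i = N * δ := by simp [htol]
  have h4 : ∀ m, K.tol m / ∑ i, K.tol i = (N : ℝ)⁻¹ := fun m => by
    rw [h3, htol]; field_simp
  have h5 : (1 - ∑ m, (K.tol m / ∑ i, K.tol i) ^ 2)⁻¹ = (N : ℝ) / ((N : ℝ) - 1) := by
    simp only [h4]
    rw [Finset.sum_const, Finset.card_univ, Fintype.card_fin, nsmul_eq_mul]
    have : 1 - (N : ℝ) * (N : ℝ)⁻¹ ^ 2 = ((N : ℝ) - 1) / N := by field_simp
    rw [this, inv_div]
  have h7 : HasClass K.nashFormula _ := h2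
  convert h7 using 1
  rw [h5]
  simp only [h4]
  rw [h3, ← Finset.smul_sum, mul_smul,
    ← map_smul (opA hT K.cov) ((N : ℝ) / ((N : ℝ) - 1))]
  congr 2
  match_scalars <;> field_simp

/-- The frictionless Nash equilibrium returns. -/
lemma Market.isNashReturns_iff (hN : 2 ≤ N) (hcov : K.cov.PosDef) {δ : ℝ} (hδ : 0 < δ)
    (htol : ∀ m, K.tol m = δ) {ζ : Fin N → HilbertProc 𝓕 P d} {p : HilbertProc 𝓕 P d}
    (hζ : ∀ i, HasClass (K.expo i) (ζ i)) (hψ : HasClass K.noise p) (hT : 0 < T)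
    (ν : VProc T Ω d) : K.IsNashReturns 𝓕 P ν ↔ AEEqProc P ν K.nashFormula := by
  have hN2 : (2 : ℝ) ≤ N := by exact_mod_cast hN
  have hN0 : (N : ℝ) ≠ 0 := by linarith
  have hN1 : (N : ℝ) - 1 ≠ 0 := by linarith
  have hform := K.hasClass_nashFormula hN hδ htol hζ hψ hT
  -- The revealed exposures of the rivals add up to (N-1)δΣ⁻¹n + x_m + p: the noise cancels and the
  -- coefficient of x_m drops from N + 1 to N.
  have hbr : ∀ {n : HilbertProc 𝓕 P d} {φ : Fin N → VProc T Ω d} {x : Fin N → HilbertProc 𝓕 P d},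
      HasClass ν n → (∀ i, HasClass (φ i) (x i)) → ∑ i, x i + p = 0 → ∀ m,
      (K.BestResponse 𝓕 P (K.facedExpo ν φ m) m (φ m) ↔
        (N : ℝ) • x m = ((N : ℝ) - 1) • (δ • opA hT K.cov⁻¹ n - ζ m)) := by
    intro n φ x hν hφ hx m
    rw [K.bestResponse_iff hN hcov hδ htol m (hν.facedExpo hφ hζ m hT) (hφ m) hψ hT]
    simp only [htol]
    rw [sum_revealed_eq hN x ζ _ p hx m]
    simp only [if_true]
    constructor
    · intro h
      linear_combination (norm := module) (1 : ℝ) • h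
    · intro h
      linear_combination (norm := module) (1 : ℝ) • h
  constructor
  · rintro ⟨hν, φ, h1, h2⟩
    obtain ⟨n, hn⟩ := hν.exists_rep
    choose x hx using fun m => (h1 m).1.exists_rep
    have h3 : ∑ i, x i + p = 0 :=
      ((HasClass.sum _ fun i _ => hx i).add hψ).eq_of_aeEq HasClass.zero h2
    refine HasClass.aeEq (x := n) hn ?_
    have h4 : ∑ m, (N : ℝ) • x m = ∑ m, ((N : ℝ) - 1) • (δ • opA hT K.cov⁻¹ n - ζ m) :=
      Finset.sum_congr rfl fun m _ => (hbr hn hx h3 m).1 (h1 m)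
    rw [← Finset.smul_sum, ← Finset.smul_sum, Finset.sum_sub_distrib, Finset.sum_const,
      Finset.card_univ, Fintype.card_fin, ← Nat.cast_smul_eq_nsmul ℝ] at h4
    have h5 : ∑ i, ζ i - ((N : ℝ) / ((N : ℝ) - 1)) • p = ((N : ℝ) * δ) • opA hT K.cov⁻¹ n := by
      linear_combination (norm := skip) (((N : ℝ) - 1)⁻¹) • h4 - ((N : ℝ) / ((N : ℝ) - 1)) • h3
      match_scalars <;> field_simp <;> ring
    rw [h5, map_smul, opA_opA_inv hcov, smul_smul, inv_mul_cancel₀ (by positivity), one_smul]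
      at hform
    exact hform
  · intro h
    have hn := hform.congr (h.mono fun _ h => h.symm)
    set n := ((N : ℝ) * δ)⁻¹ • opA hT K.cov (∑ i, ζ i - ((N : ℝ) / ((N : ℝ) - 1)) • p) with hndef
    -- The demands are dictated by `hbr`; that they clear is exactly the defining relation of n.
    choose φ hφ using fun m => exists_process
      (((N : ℝ)⁻¹ * ((N : ℝ) - 1)) • (δ • opA hT K.cov⁻¹ n - ζ m))
    have hx : ∑ m, ((N : ℝ)⁻¹ * ((N : ℝ) - 1)) • (δ • opA hT K.cov⁻¹ n - ζ m) + p = 0 := by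
      have h6 : δ • opA hT K.cov⁻¹ n = (N : ℝ)⁻¹ •
          (∑ i, ζ i - ((N : ℝ) / ((N : ℝ) - 1)) • p) := by
        rw [hndef, map_smul, opA_inv_opA hcov, smul_smul]
        congr 1
        field_simp
      rw [← Finset.smul_sum, Finset.sum_sub_distrib, Finset.sum_const, Finset.card_univ,
        Fintype.card_fin, ← Nat.cast_smul_eq_nsmul ℝ, h6]
      match_scalars <;> field_simp <;> ring
    refine ⟨hn.inH2, φ, fun m => (hbr hn hφ hx m).2 ?_, ?_⟩
    · rw [smul_smul, mul_inv_cancel_left₀ hN0]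
    · exact ((HasClass.sum _ fun i _ => hφ i).add hψ).aeEq (hx ▸ HasClass.zero)

end Frictionless

/-! ### Algebra of the strategic first-order condition under costs -/

section

variable {H : Type*} [NormedAddCommGroup H] [InnerProductSpace ℝ H]

/-- The two expressions for the derivative of the objective of a strategic investor. -/
lemma bilinear_gradient_eq {B : H →L[ℝ] H →L[ℝ] ℝ} {C S L : H →L[ℝ] H} {w g h x p : H}
    (hx : B (C w) (L g) = -B w (L x)) (hp : B (C w) (L h) = -B w (L p)) {c e : ℝ} (Y y : H) :
    B (C w) ((c * e) • S Y - (2 * (c * e)) • S (C x) - e • S (C x + y))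
        + B w (-(2 * c) • L p - (2 * (2 * c + 1)) • L x)
      = B (C w) ((c * e) • S (Y - (2 : ℝ) • C x) - e • S (C x + y)
          + (4 * c + 2) • L g + (2 * c) • L h) := by
  simp only [map_add, map_sub, map_smul, smul_eq_mul, hx, hp]
  ring

end

/-! ### The market with quadratic transaction costs -/

section Costs

variable {T : ℝ} {Ω : Type*} {d N : ℕ} [mΩ : MeasurableSpace Ω]
  {𝓕 : Filtration (Horizon T) mΩ} {P : Measure Ω} [IsProbabilityMeasure P]
  {K : Market T Ω d N} {hT : 0 < T} {hnull : ContainsNull 𝓕 P}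

/-- The condition stays in weak form: an optimal rate is only known to be in H², so no drift is
available for integrating by parts. -/
lemma Market.costPriceTaking_iff (hcov : K.cov.PosDef) (hcost : K.cost.PosDef) {m : Fin N}
    (hδ : 0 < K.tol m) {z ν u : VProc T Ω d} {y n x : HilbertProc 𝓕 P d}
    (hz : HasClass z y) (hν : HasClass ν n) (hu : HasClass u x) :
    K.CostPriceTaking 𝓕 P m z ν u ↔ ∀ w, discForm hT K.r (opC hT hnull w)
      (n - (K.tol m)⁻¹ • opA hT K.cov (opC hT hnull x + y))
        - 2 * discForm hT K.r w (opA hT K.cost x) = 0 := by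
  let J : HilbertProc 𝓕 P d → ℝ := fun v => discForm hT K.r (opC hT hnull v) n
      - 1 / (2 * K.tol m) * discForm hT K.r (opC hT hnull v + y)
        (opA hT K.cov (opC hT hnull v + y))
      - discForm hT K.r v (opA hT K.cost v)
  have h1 : K.CostPriceTaking 𝓕 P m z ν u ↔ ∀ v ∈ (⊤ : Submodule ℝ (HilbertProc 𝓕 P d)),
      J v ≤ J x := by
    constructor
    · rintro ⟨-, h⟩ v -
      obtain ⟨θ, hθ⟩ := exists_process v
      have h2 := h θ hθ.inH2
      rwa [K.costObjective_eq (hT := hT) (hnull := hnull) m hz hν hθ,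
        K.costObjective_eq (hT := hT) (hnull := hnull) m hz hν hu] at h2
    · intro h
      refine ⟨hu.inH2, fun θ hθ => ?_⟩
      obtain ⟨v, hv⟩ := hθ.exists_rep
      rw [K.costObjective_eq (hT := hT) (hnull := hnull) m hz hν hv,
        K.costObjective_eq (hT := hT) (hnull := hnull) m hz hν hu]
      exact h v trivial
  rw [h1, quadratic_max_iff (discForm hT K.r) (opC hT hnull) (opA hT K.cov) (opA hT K.cost)
    (discForm_opA_comm hcov.1) (discForm_opA_comm hcost.1) (discForm_opA_nonneg hcov)
    (discForm_opA_nonneg hcost) (c := 1 / (2 * K.tol m)) (e := 0) (f := 1) (by positivity) le_rfl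
    zero_le_one n 0 y ⊤ (J := J) (fun v _ => ?_) (x := x) trivial]
  · have h3 : 2 * (1 / (2 * K.tol m)) = (K.tol m)⁻¹ := by field_simp
    simp only [h3, mul_zero, zero_smul, sub_zero, zero_sub, mul_one, map_neg, map_smul,
      smul_eq_mul, Submodule.mem_top, true_implies, ← sub_eq_add_neg]
  · simp only [J, zero_mul, sub_zero, one_mul, map_zero, add_zero]
    ring

lemma Market.exists_costPriceTaking (hT : 0 < T) (hnull : ContainsNull 𝓕 P)
    (hcov : K.cov.PosDef) (hcost : K.cost.PosDef) {m : Fin N}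
    (hδ : 0 < K.tol m) {z ν : VProc T Ω d} {y n : HilbertProc 𝓕 P d}
    (hz : HasClass z y) (hν : HasClass ν n) :
    ∃ (u : VProc T Ω d) (x : HilbertProc 𝓕 P d), HasClass u x ∧
      K.CostPriceTaking 𝓕 P m z ν u := by
  have := completeSpace_hilbertProc (𝓕 := 𝓕) (P := P) (d := d) hT
  obtain ⟨l, hl, hl'⟩ := exists_discForm_lower_bound (𝓕 := 𝓕) (P := P) hT K.r hcost
  obtain ⟨x, hx⟩ := exists_quadratic_critical (discForm hT K.r) (opC hT hnull) (opA hT K.cov)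
    (opA hT K.cost) (discForm_opA_nonneg hcov) hl hl' (c := (K.tol m)⁻¹) (f := 2)
    (inv_nonneg.2 hδ.le) two_pos n y
  obtain ⟨u, hu⟩ := exists_process x
  exact ⟨u, x, hu, (K.costPriceTaking_iff (hT := hT) (hnull := hnull) hcov hcost hδ hz hν hu).2 hx⟩

/-- Demands clear if and only if their rates do, because the primitive is injective. -/
lemma cumul_clearing_iff {ι : Type*} (s : Finset ι) {u ψ η : VProc T Ω d} {v : ι → VProc T Ω d}
    {x p : HilbertProc 𝓕 P d} {c : ι → HilbertProc 𝓕 P d} (hu : HasClass u x)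
    (hv : ∀ i ∈ s, HasClass (v i) (c i)) (hψ : HasClass ψ p)
    (hη : ∀ᵐ ω ∂P, ∀ t, η t ω = cumul ψ t ω) (hT : 0 < T) (hnull : ContainsNull 𝓕 P) :
    (∀ᵐ ω ∂P, ∀ t, cumul u t ω + ∑ i ∈ s, cumul (v i) t ω + η t ω = 0)
      ↔ x + ∑ i ∈ s, c i + p = 0 := by
  have hZ := (hu.add (HasClass.sum s hv)).add hψ
  set Z : VProc T Ω d := fun t ω => (u t ω + ∑ i ∈ s, v i t ω) + ψ t ω with hZdef
  have hpath : ∀ {X : VProc T Ω d} {y : HilbertProc 𝓕 P d}, HasClass X y →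
      ∀ᵐ ω ∂P, Integrable (fun t => X t ω) (timeMeasure T) := fun hX =>
    ae_integrable_path (IsL2.integrable hX.inH2.2)
  have h1 : ∀ᵐ ω ∂P, ∀ t, cumul Z t ω
      = cumul u t ω + ∑ i ∈ s, cumul (v i) t ω + η t ω := by
    have h2 : ∀ᵐ ω ∂P, ∀ i ∈ s, Integrable (fun t => v i t ω) (timeMeasure T) :=
      (Filter.eventually_all_finset s).2 fun i hi => hpath (hv i hi)
    filter_upwards [hpath hu, h2, hpath hψ, hη] with ω h3 h4 h5 h6 t
    rw [h6 t]
    simp only [cumul, hZdef]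
    rw [integral_add _ h5.integrableOn, integral_add h3.integrableOn, integral_finsetSum]
    · exact fun i hi => (h4 i hi).integrableOn
    · exact integrable_finsetSum _ fun i hi => (h4 i hi).integrableOn
    · exact h3.integrableOn.add (integrable_finsetSum _ fun i hi => (h4 i hi).integrableOn)
  constructor
  · intro h
    refine opC_injective (hT := hT) (hnull := hnull) ?_
    refine hZ.opC.eq_of_aeEq HasClass.zero (AEEqProc.of_forall ?_)
    filter_upwards [h1, h] with ω h2 h3 t
    rw [h2 t, h3 t]
  · intro h
    rw [h] at hZ
    filter_upwards [h1, (hZ.aeEq HasClass.zero).cumul_eq] with ω h2 h3 t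
    rw [← h2 t, h3 t]
    simp [cumul]

set_option maxHeartbeats 1000000 in
/-- The price impact with transaction costs. -/
lemma Market.costPriceImpact_iff (hN : 2 ≤ N) (hcov : K.cov.PosDef) (hcost : K.cost.PosDef)
    {δ : ℝ} (hδ : 0 < δ) (htol : ∀ m, K.tol m = δ) (n : Fin N) {z : Fin N → VProc T Ω d}
    {u a ψ b κ : VProc T Ω d} {y : Fin N → HilbertProc 𝓕 P d}
    {x α p β k : HilbertProc 𝓕 P d} (hz : ∀ i, HasClass (z i) (y i))
    (hua : HasDrift 𝓕 P u a) (hu : HasClass u x) (ha : HasClass a α)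
    (hψb : HasDrift 𝓕 P ψ b) (hψ : HasClass ψ p) (hb : HasClass b β)
    (hη : ∀ᵐ ω ∂P, ∀ t, K.noise t ω = cumul ψ t ω) (hκ : HasClass κ k) :
    K.CostPriceImpact 𝓕 P z n u κ ↔ InHInf 𝓕 P κ ∧ ((N : ℝ) - 1) • k
      = δ⁻¹ • opA hT K.cov (∑ i ∈ Finset.univ.erase n, y i - opC hT hnull (x + p))
        + (2 : ℝ) • opA hT K.cost (α + β - K.r • (x + p)) := by
  set Y := ∑ i ∈ Finset.univ.erase n, y i with hY
  have hpt : ∀ i {χ : VProc T Ω d} {c : HilbertProc 𝓕 P d}, HasClass χ c →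
      (K.CostPriceTaking 𝓕 P i (z i) κ χ ↔ ∀ w, discForm hT K.r (opC hT hnull w)
        (k - δ⁻¹ • opA hT K.cov (opC hT hnull c + y i))
          - 2 * discForm hT K.r w (opA hT K.cost c) = 0) := fun i χ c hχ => by
    rw [K.costPriceTaking_iff hcov hcost (by rw [htol]; exact hδ) (hz i) hκ hχ (hT := hT)
      (hnull := hnull), htol]
  have hsum : ∀ (c : Fin N → HilbertProc 𝓕 P d), (∀ i ∈ Finset.univ.erase n, ∀ w,
      discForm hT K.r (opC hT hnull w) (k - δ⁻¹ • opA hT K.cov (opC hT hnull (c i) + y i))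
        - 2 * discForm hT K.r w (opA hT K.cost (c i)) = 0) →
      ∀ w, discForm hT K.r (opC hT hnull w) (((N : ℝ) - 1) • k - δ⁻¹ • opA hT K.cov
        (opC hT hnull (∑ i ∈ Finset.univ.erase n, c i) + Y))
        - 2 * discForm hT K.r w (opA hT K.cost (∑ i ∈ Finset.univ.erase n, c i)) = 0 := by
    intro c hc w
    have h1 := Finset.sum_eq_zero fun i hi => hc i hi w
    rw [Finset.sum_sub_distrib, ← Finset.mul_sum, ← map_sum, ← map_sum, ← map_sum,
      Finset.sum_sub_distrib, ← Finset.smul_sum, ← map_sum, Finset.sum_add_distrib, ← map_sum,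
      Finset.sum_const, Finset.card_erase_of_mem (Finset.mem_univ n),
      Finset.card_univ, Fintype.card_fin, ← Nat.cast_smul_eq_nsmul ℝ, Nat.cast_sub (by omega),
      Nat.cast_one] at h1
    exact h1
  have hdrift : ∀ w, discForm hT K.r (opC hT hnull w)
      (opA hT K.cost (α + β - K.r • (x + p))) = - discForm hT K.r w (opA hT K.cost (x + p)) :=
    (hua.add hT hψb).discForm_eq (hu.add hψ) (ha.add hb) K.cost
  constructor
  · rintro ⟨hκi, χ, h1, h2⟩
    refine ⟨hκi, ?_⟩
    choose! c hc using fun i (hi : i ≠ n) => (h1 i hi).1.exists_rep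
    have hc' : ∀ i ∈ Finset.univ.erase n, HasClass (χ i) (c i) := fun i hi =>
      hc i (Finset.ne_of_mem_erase hi)
    have h3 := (cumul_clearing_iff _ hu hc' hψ hη hT hnull).1 h2
    -- The rivals' rates need not lie in 𝒜 individually, but their sum does, so integration by parts
    -- applies to the summed condition.
    have h4 : ∑ i ∈ Finset.univ.erase n, c i = -(x + p) := by
      linear_combination (norm := module) (1 : ℝ) • h3
    have h5 := hsum c fun i hi => (hpt i (hc' i hi)).1 (h1 i (Finset.ne_of_mem_erase hi))
    rw [← sub_eq_zero]
    refine eq_zero_of_forall_discForm_opC (hT := hT) (r := K.r) (hnull := hnull) fun w => ?_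
    have h6 := h5 w
    have h7 := hdrift w
    rw [h4] at h6
    simp only [map_add, map_sub, map_neg, map_smul, smul_eq_mul] at h6 h7 ⊢
    linarith
  · rintro ⟨hκi, h⟩
    choose χ c hχ hpt' using fun i => K.exists_costPriceTaking hT hnull hcov hcost
      (m := i) (by rw [htol]; exact hδ) (hz i) hκ
    refine ⟨hκi, χ, fun i _ => hpt' i, ?_⟩
    refine (cumul_clearing_iff _ hu (fun i _ => hχ i) hψ hη hT hnull).2 ?_
    have h5 := hsum c fun i _ => (hpt i (hχ i)).1 (hpt' i)
    -- The excess rate s solves the homogeneous weak equation. Testing it with s itself gives a sum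
    -- of two nonnegative terms equal to zero.
    obtain ⟨s, hs⟩ : ∃ s, s = x + ∑ i ∈ Finset.univ.erase n, c i + p := ⟨_, rfl⟩
    rw [← hs]
    have h4 : ∑ i ∈ Finset.univ.erase n, c i = s - (x + p) := by rw [hs]; abel
    have h6 := h5 s
    have h7 := hdrift s
    have h8 := discForm_opA_nonneg (hT := hT) (r := K.r) hcov (opC hT hnull s)
    refine eq_zero_of_discForm_opA_le (hT := hT) (r := K.r) hcost ?_
    rw [h4, h] at h6
    have h9 := mul_nonneg (inv_nonneg.2 hδ.le) h8
    simp only [map_add, map_sub, map_smul, smul_eq_mul] at h6 h7 h9 ⊢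
    linarith

set_option maxHeartbeats 1000000 in
/-- Best responses with transaction costs. -/
lemma Market.costBestResponse_iff (hN : 2 ≤ N) (hcov : K.cov.PosDef) (hcost : K.cost.PosDef)
    {δ : ℝ} (hδ : 0 < δ) (htol : ∀ m, K.tol m = δ) (n : Fin N) {z : Fin N → VProc T Ω d}
    {u a ψ b : VProc T Ω d} {y : Fin N → HilbertProc 𝓕 P d}
    {x α p β : HilbertProc 𝓕 P d} (hz : ∀ i, HasClass (z i) (y i))
    (hy : ∀ i, y i ∈ classInf 𝓕 P d)
    (hua : HasDrift 𝓕 P u a) (hu : HasClass u x) (ha : HasClass a α)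
    (hψb : HasDrift 𝓕 P ψ b) (hψ : HasClass ψ p) (hb : HasClass b β)
    (hη : ∀ᵐ ω ∂P, ∀ t, K.noise t ω = cumul ψ t ω) {c : ℝ} (hc : c = ((N : ℝ) - 1)⁻¹) :
    K.CostBestResponse 𝓕 P z n u ↔
      (c * δ⁻¹) • opA hT K.cov (∑ i ∈ Finset.univ.erase n, y i - opC hT hnull p
          - (2 : ℝ) • opC hT hnull x)
        - δ⁻¹ • opA hT K.cov (opC hT hnull x + y n)
        + (4 * c + 2) • opA hT K.cost (α - K.r • x) + (2 * c) • opA hT K.cost (β - K.r • p)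
        = 0 := by
  have hN1 : (0 : ℝ) < (N : ℝ) - 1 := by
    have : (2 : ℝ) ≤ N := by exact_mod_cast hN
    linarith
  have hc0 : 0 < c := by rw [hc]; positivity
  set Y := ∑ i ∈ Finset.univ.erase n, y i with hY
  -- The returns imposed by a strategic rate v with drift γ. `hk` records that they are bounded, as
  -- admissible price impacts must be.
  let k : HilbertProc 𝓕 P d → HilbertProc 𝓕 P d → HilbertProc 𝓕 P d := fun v γ =>
    c • (δ⁻¹ • opA hT K.cov (Y - opC hT hnull (v + p))
      + (2 : ℝ) • opA hT K.cost (γ + β - K.r • (v + p)))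
  have hpi : ∀ {v γ κ : VProc T Ω d} {q ρ l : HilbertProc 𝓕 P d}, HasDrift 𝓕 P v γ →
      HasClass v q → HasClass γ ρ → HasClass κ l →
      (K.CostPriceImpact 𝓕 P z n v κ ↔ InHInf 𝓕 P κ ∧ l = k q ρ) := by
    intro v γ κ q ρ l h1 h2 h3 h4
    rw [K.costPriceImpact_iff hN hcov hcost hδ htol n hz h1 h2 h3 hψb hψ hb hη h4 (hT := hT)
      (hnull := hnull)]
    simp only [k, hc]
    rw [eq_inv_smul_iff₀ hN1.ne']
  have hk : ∀ {v γ : VProc T Ω d} {q ρ : HilbertProc 𝓕 P d}, HasDrift 𝓕 P v γ →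
      HasClass v q → HasClass γ ρ → k q ρ ∈ classInf 𝓕 P d := by
    intro v γ q ρ h1 h2 h3
    have h4 := h2.mem_classInf h1.mem
    have h5 := h3.mem_classInf h1.drift_mem
    have h6 := hψ.mem_classInf hψb.mem
    have h7 := hb.mem_classInf hψb.drift_mem
    refine Submodule.smul_mem _ _ (Submodule.add_mem _ (Submodule.smul_mem _ _
      (opA_mem_classInf _ (Submodule.sub_mem _ (Submodule.sum_mem _ fun i _ => hy i)
        (opC_mem_classInf (Submodule.add_mem _ h4 h6))))) (Submodule.smul_mem _ _
      (opA_mem_classInf _ (Submodule.sub_mem _ (Submodule.add_mem _ h5 h7)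
        (Submodule.smul_mem _ _ (Submodule.add_mem _ h4 h6))))))
  -- The objective along the price impact. Integration by parts has traded the drift for a multiple
  -- of the trading cost, so this is a quadratic in the rate alone; own impact raises the cost
  -- weight from 1 to 2c + 1.
  let J : HilbertProc 𝓕 P d → ℝ := fun v =>
    discForm hT K.r (opC hT hnull v) ((c * δ⁻¹) • opA hT K.cov (Y - opC hT hnull (v + p)))
      - 2 * c * discForm hT K.r v (opA hT K.cost (v + p))
      - 1 / (2 * δ) * discForm hT K.r (opC hT hnull v + y n)
        (opA hT K.cov (opC hT hnull v + y n))
      - discForm hT K.r v (opA hT K.cost v)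
  have hobj : ∀ {v γ κ : VProc T Ω d} {q ρ : HilbertProc 𝓕 P d}, HasDrift 𝓕 P v γ →
      HasClass v q → HasClass γ ρ → HasClass κ (k q ρ) →
      K.costObjective P n (z n) κ v = J q := by
    intro v γ κ q ρ h1 h2 h3 h4
    rw [K.costObjective_eq (hT := hT) (hnull := hnull) n (hz n) h4 h2, htol]
    have h5 := (h1.add hT hψb).discForm_eq (r := K.r) (hT := hT) (hnull := hnull) (h2.add hψ)
      (h3.add hb) K.cost q
    simp only [J, k]
    rw [map_smul, map_add, map_smul, map_smul, map_smul, h5]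
    simp only [smul_eq_mul]
    ring
  have hxA : x ∈ classA (P := P) hT 𝓕 d := ⟨u, a, hua, hu⟩
  have h1 : K.CostBestResponse 𝓕 P z n u ↔ ∀ v ∈ classA (P := P) hT 𝓕 d, J v ≤ J x := by
    constructor
    · rintro ⟨-, μ, h2, h3⟩ v ⟨X, γ, hX, hXv⟩
      obtain ⟨m, hm⟩ := (h2.1.inH2 hT).exists_rep
      obtain ⟨ρ, hρ⟩ := (hX.drift_mem.inH2 hT).exists_rep
      obtain ⟨κ, hκ⟩ := exists_process (k v ρ)
      have h4 := h3 X κ (by obtain ⟨M, hM⟩ := hX; exact ⟨γ, M, hM⟩)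
        ((hpi hX hXv hρ hκ).2 ⟨hκ.inHInf (hk hX hXv hρ), rfl⟩)
      rw [((hpi hua hu ha hm).1 h2).2] at hm
      rwa [hobj hX hXv hρ hκ, hobj hua hu ha hm] at h4
    · intro h
      obtain ⟨μ, hμ⟩ := exists_process (k x α)
      refine ⟨by obtain ⟨M, hM⟩ := hua; exact ⟨a, M, hM⟩, μ,
        (hpi hua hu ha hμ).2 ⟨hμ.inHInf (hk hua hu ha), rfl⟩, ?_⟩
      rintro v κ ⟨γ, M, hM⟩ hκ
      have hvd : HasDrift 𝓕 P v γ := ⟨M, hM⟩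
      obtain ⟨q, hq⟩ := (hvd.mem.inH2 hT).exists_rep
      obtain ⟨ρ, hρ⟩ := (hvd.drift_mem.inH2 hT).exists_rep
      obtain ⟨l, hl⟩ := (hκ.1.inH2 hT).exists_rep
      rw [((hpi hvd hq hρ hl).1 hκ).2] at hl
      rw [hobj hvd hq hρ hl, hobj hua hu ha hμ]
      exact h q ⟨v, γ, hvd, hq⟩
  rw [h1, quadratic_max_iff (discForm hT K.r) (opC hT hnull) (opA hT K.cov) (opA hT K.cost)
    (discForm_opA_comm hcov.1) (discForm_opA_comm hcost.1) (discForm_opA_nonneg hcov)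
    (discForm_opA_nonneg hcost) (c := 1 / (2 * δ)) (e := c * δ⁻¹) (f := 2 * c + 1)
    (by positivity) (by positivity) (by positivity)
    ((c * δ⁻¹) • opA hT K.cov (Y - opC hT hnull p)) (-(2 * c) • opA hT K.cost p) (y n) _ (J := J)
    (fun v _ => ?_) hxA]
  · have h3 : 2 * (1 / (2 * δ)) = δ⁻¹ := by field_simp
    have h4 : ∀ w, discForm hT K.r (opC hT hnull w)
          ((c * δ⁻¹) • opA hT K.cov (Y - opC hT hnull p)
            - (2 * (c * δ⁻¹)) • opA hT K.cov (opC hT hnull x)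
            - (2 * (1 / (2 * δ))) • opA hT K.cov (opC hT hnull x + y n))
        + discForm hT K.r w (-(2 * c) • opA hT K.cost p - (2 * (2 * c + 1)) • opA hT K.cost x)
        = discForm hT K.r (opC hT hnull w)
          ((c * δ⁻¹) • opA hT K.cov (Y - opC hT hnull p - (2 : ℝ) • opC hT hnull x)
            - δ⁻¹ • opA hT K.cov (opC hT hnull x + y n)
            + (4 * c + 2) • opA hT K.cost (α - K.r • x)
            + (2 * c) • opA hT K.cost (β - K.r • p)) := by
      intro w
      have h5 := hua.discForm_eq (r := K.r) (hT := hT) (hnull := hnull) hu ha K.cost w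
      have h6 := hψb.discForm_eq (r := K.r) (hT := hT) (hnull := hnull) hψ hb K.cost w
      rw [h3]
      exact bilinear_gradient_eq h5 h6 _ _
    simp only [h4]
    constructor
    -- Only deviations in 𝒜 are admissible tests, but their primitives are dense.
    · exact fun h => eq_zero_of_forall_discForm_opC_classA h
    · intro h w _
      rw [h, map_zero]
  · simp only [J, map_add, map_sub, map_smul, smul_eq_mul]
    ring

end Costs

/-! ### Equilibrium with transaction costs -/

/-- Sum over the investors of the first order conditions for their best responses. -/
lemma sum_first_order_eq {H : Type*} [NormedAddCommGroup H] [InnerProductSpace ℝ H] {N : ℕ}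
    (hN : 2 ≤ N) {C S L : H →L[ℝ] H} {c δ : ℝ} (hδ : 0 < δ) (hc : c = ((N : ℝ) - 1)⁻¹)
    (x α ζ : Fin N → H) (n p β : H) (r : ℝ) :
    ∑ m, (n - δ⁻¹ • S ((1 + c) • C (x m) + ζ m) + (4 * c + 2) • L (α m - r • x m)
        + (2 * c) • L (β - r • p))
      = (N : ℝ) • (n - (((N : ℝ) * δ)⁻¹ • S (∑ i, ζ i - ((N : ℝ) / ((N : ℝ) - 1)) • C p)
          + (2 / ((N : ℝ) * ((N : ℝ) - 1))) • L (β - r • p)))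
        - (δ⁻¹ * (1 + c)) • S (C (∑ i, x i + p))
        + (4 * c + 2) • L ((∑ i, α i + β) - r • (∑ i, x i + p)) := by
  have hN2 : (2 : ℝ) ≤ N := by exact_mod_cast hN
  have hN0 : (N : ℝ) ≠ 0 := by linarith
  have hN1 : (N : ℝ) - 1 ≠ 0 := by linarith
  simp only [Finset.sum_add_distrib, Finset.sum_sub_distrib, ← Finset.smul_sum, map_add, map_sub,
    map_smul, map_sum, Finset.sum_const, Finset.card_univ, Fintype.card_fin,
    ← Nat.cast_smul_eq_nsmul ℝ]
  rw [hc]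
  match_scalars <;> field_simp <;> ring

section CostEquilibrium

variable {T : ℝ} {Ω : Type*} {d N : ℕ} [mΩ : MeasurableSpace Ω]
  {𝓕 : Filtration (Horizon T) mΩ} {P : Measure Ω} [IsProbabilityMeasure P]
  {K : Market T Ω d N} {hT : 0 < T} {hnull : ContainsNull 𝓕 P}

/-- Best responses to the exposures that clearing demands reveal. -/
lemma Market.costBestResponse_facedExpo_iff (hN : 2 ≤ N) (hcov : K.cov.PosDef)
    (hcost : K.cost.PosDef) {δ : ℝ} (hδ : 0 < δ) (htol : ∀ m, K.tol m = δ)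
    {ζ : Fin N → HilbertProc 𝓕 P d} (hζ : ∀ i, HasClass (K.expo i) (ζ i))
    (hexpo : ∀ i, InHInf 𝓕 P (K.expo i)) {ψ b : VProc T Ω d} {p β : HilbertProc 𝓕 P d}
    (hψb : HasDrift 𝓕 P ψ b) (hψ : HasClass ψ p) (hb : HasClass b β)
    (hη : ∀ᵐ ω ∂P, ∀ t, K.noise t ω = cumul ψ t ω) {c : ℝ} (hc : c = ((N : ℝ) - 1)⁻¹)
    {ν : VProc T Ω d} {n : HilbertProc 𝓕 P d} (hν : InHInf 𝓕 P ν) (hνn : HasClass ν n)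
    {u a : Fin N → VProc T Ω d} {x α : Fin N → HilbertProc 𝓕 P d}
    (hua : ∀ i, HasDrift 𝓕 P (u i) (a i)) (hu : ∀ i, HasClass (u i) (x i))
    (ha : ∀ i, HasClass (a i) (α i)) (hx : ∑ i, x i + p = 0) (m : Fin N) :
    K.CostBestResponse 𝓕 P (K.facedExpo ν (fun i => cumul (u i)) m) m (u m) ↔
      n - δ⁻¹ • opA hT K.cov ((1 + c) • opC hT hnull (x m) + ζ m)
        + (4 * c + 2) • opA hT K.cost (α m - K.r • x m)
        + (2 * c) • opA hT K.cost (β - K.r • p) = 0 := by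
  have hN1 : (N : ℝ) - 1 ≠ 0 := by
    have : (2 : ℝ) ≤ N := by exact_mod_cast hN
    linarith
  have hmem : ∀ i, (if i = m then ζ m else δ • opA hT K.cov⁻¹ n - opC hT hnull (x i))
      ∈ classInf 𝓕 P d := by
    intro i
    split_ifs
    · exact (hζ m).mem_classInf (hexpo m)
    · exact Submodule.sub_mem _ (Submodule.smul_mem _ _ (opA_mem_classInf _
        (hνn.mem_classInf hν))) (opC_mem_classInf ((hu i).mem_classInf (hua i).mem))
  have hclass : ∀ i, HasClass (K.facedExpo ν (fun i => cumul (u i)) m i)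
      (if i = m then ζ m else δ • opA hT K.cov⁻¹ n - opC hT hnull (x i)) := fun i => by
    have h := hνn.facedExpo (K := K) (fun j => (hu j).opC (hT := hT) (hnull := hnull)) hζ m hT i
    rwa [htol] at h
  have hC : ∑ i, opC hT hnull (x i) + opC hT hnull p = 0 := by
    rw [← map_sum, ← map_add, hx, map_zero]
  rw [K.costBestResponse_iff hN hcov hcost hδ htol m hclass hmem (hua m) (hu m) (ha m) hψb hψ hb
    hη hc (hT := hT) (hnull := hnull), sum_revealed_eq hN (fun i => opC hT hnull (x i)) ζ
    (δ • opA hT K.cov⁻¹ n) (opC hT hnull p) hC m, if_pos rfl]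
  -- Since c(N-1) = 1, the revealed exposures contribute exactly n, and the noise demand cancels.
  have h1 : (c * δ⁻¹) • opA hT K.cov (((N : ℝ) - 1) • δ • opA hT K.cov⁻¹ n
      + opC hT hnull (x m) + opC hT hnull p - opC hT hnull p - (2 : ℝ) • opC hT hnull (x m))
      = n - (c * δ⁻¹) • opA hT K.cov (opC hT hnull (x m)) := by
    have h2 : ((N : ℝ) - 1) • δ • opA hT K.cov⁻¹ n
      + opC hT hnull (x m) + opC hT hnull p - opC hT hnull p - (2 : ℝ) • opC hT hnull (x m)
      = (((N : ℝ) - 1) * δ) • opA hT K.cov⁻¹ n - opC hT hnull (x m) := by module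
    rw [h2, map_sub, map_smul, opA_opA_inv hcov, smul_sub, smul_smul, hc]
    rw [show ((N : ℝ) - 1)⁻¹ * δ⁻¹ * (((N : ℝ) - 1) * δ) = 1 by field_simp, one_smul]
  rw [h1]
  have h3 : n - (c * δ⁻¹) • opA hT K.cov (opC hT hnull (x m))
      - δ⁻¹ • opA hT K.cov (opC hT hnull (x m) + ζ m)
      = n - δ⁻¹ • opA hT K.cov ((1 + c) • opC hT hnull (x m) + ζ m) := by
    rw [map_add, map_add, map_smul]
    module
  rw [h3]

/-- The Nash equilibrium returns with transaction costs. -/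
lemma Market.hasClass_costNashFormula (hN : 2 ≤ N) {δ : ℝ} (hδ : 0 < δ)
    (htol : ∀ m, K.tol m = δ)
    {ζ : Fin N → HilbertProc 𝓕 P d} (hζ : ∀ i, HasClass (K.expo i) (ζ i))
    {ψ b : VProc T Ω d} {p β : HilbertProc 𝓕 P d} (hψ : HasClass ψ p) (hb : HasClass b β)
    (hη : ∀ᵐ ω ∂P, ∀ t, K.noise t ω = cumul ψ t ω) :
    HasClass (fun t ω => K.nashFormula t ω
        + ((2 : ℝ) / ((N : ℝ) * ((N : ℝ) - 1))) • act K.cost (b t ω - K.r • ψ t ω))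
      (((N : ℝ) * δ)⁻¹ • opA hT K.cov (∑ i, ζ i - ((N : ℝ) / ((N : ℝ) - 1)) • opC hT hnull p)
        + (2 / ((N : ℝ) * ((N : ℝ) - 1))) • opA hT K.cost (β - K.r • p)) := by
  have hnoise : HasClass K.noise (opC hT hnull p) :=
    hψ.opC.congr (AEEqProc.of_forall (hη.mono fun ω h t => (h t).symm))
  exact (Market.hasClass_nashFormula hN hδ htol hζ hnoise hT).add
    (((hb.sub (hψ.smul K.r)).opA K.cost).smul _)

/-- Uniqueness is the sum of the first-order conditions. Existence solves each condition separately
by the forward-backward equation, and clearing follows afterwards from the same sum. -/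
lemma IsStdBrownian.isCostNashReturns_iff {n' : ℕ} {W : VProc T Ω n'} (hW : IsStdBrownian P W)
    (hT : 0 < T) (hN : 2 ≤ N)
    (hcov : K.cov.PosDef) (hcost : K.cost.PosDef) (hdiag : K.cost.IsDiag)
    {δ : ℝ} (hδ : 0 < δ) (htol : ∀ m, K.tol m = δ)
    (hexpo : ∀ i, InHInf (augFiltration P W hW.measurable) P (K.expo i)) {ψ b : VProc T Ω d}
    (hψb : HasDrift (augFiltration P W hW.measurable) P ψ b)
    (hη : ∀ᵐ ω ∂P, ∀ t, K.noise t ω = cumul ψ t ω) :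
    InHInf (augFiltration P W hW.measurable) P (fun t ω => K.nashFormula t ω
        + ((2 : ℝ) / ((N : ℝ) * ((N : ℝ) - 1))) • act K.cost (b t ω - K.r • ψ t ω)) ∧
    ∀ ν, K.IsCostNashReturns (augFiltration P W hW.measurable) P ν ↔
      AEEqProc P ν (fun t ω => K.nashFormula t ω
        + ((2 : ℝ) / ((N : ℝ) * ((N : ℝ) - 1))) • act K.cost (b t ω - K.r • ψ t ω)) := by
  have hnull : ContainsNull (augFiltration P W hW.measurable) P :=
    containsNull_augFiltration P W hW.measurable
  set 𝓖 := augFiltration P W hW.measurable with h𝓖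
  have hN2 : (2 : ℝ) ≤ N := by exact_mod_cast hN
  obtain ⟨c, hc⟩ : ∃ c : ℝ, c = ((N : ℝ) - 1)⁻¹ := ⟨_, rfl⟩
  have hc0 : 0 < c := by rw [hc]; exact inv_pos.2 (by linarith)
  choose ζ hζ using fun i => ((hexpo i).inH2 hT).exists_rep
  obtain ⟨p, hψ⟩ := (hψb.mem.inH2 hT).exists_rep
  obtain ⟨β, hb⟩ := (hψb.drift_mem.inH2 hT).exists_rep
  have hform := Market.hasClass_costNashFormula (hT := hT) (hnull := hnull) hN hδ htol hζ hψ hb hη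
  set νΛ : VProc T Ω d := fun t ω => K.nashFormula t ω
        + ((2 : ℝ) / ((N : ℝ) * ((N : ℝ) - 1))) • act K.cost (b t ω - K.r • ψ t ω)
  set nΛ := ((N : ℝ) * δ)⁻¹ • opA hT K.cov
      (∑ i, ζ i - ((N : ℝ) / ((N : ℝ) - 1)) • opC hT hnull p)
    + (2 / ((N : ℝ) * ((N : ℝ) - 1))) • opA hT K.cost (β - K.r • p) with hnΛ
  clear_value nΛ
  have hp := hψ.mem_classInf hψb.mem
  have hβ := hb.mem_classInf hψb.drift_mem
  have hνΛ : InHInf 𝓖 P νΛ := by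
    refine hform.inHInf ?_
    rw [hnΛ]
    exact Submodule.add_mem _ (Submodule.smul_mem _ _ (opA_mem_classInf _ (Submodule.sub_mem _
      (Submodule.sum_mem _ fun i _ => (hζ i).mem_classInf (hexpo i))
      (Submodule.smul_mem _ _ (opC_mem_classInf hp))))) (Submodule.smul_mem _ _
      (opA_mem_classInf _ (Submodule.sub_mem _ hβ (Submodule.smul_mem _ _ hp))))
  have hclear : ∀ {u : Fin N → VProc T Ω d} {x : Fin N → HilbertProc 𝓖 P d},
      (∀ i, HasClass (u i) (x i)) →
      ((∀ᵐ ω ∂P, ∀ t, ∑ m, cumul (u m) t ω + K.noise t ω = 0) ↔ ∑ m, x m + p = 0) := by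
    intro u x hu
    have h := cumul_clearing_iff Finset.univ (HasClass.zero (𝓕 := 𝓖) (P := P))
      (fun i _ => hu i) hψ hη hT hnull
    have h0 : ∀ (t : Horizon T) (ω : Ω), cumul (fun _ _ => 0 : VProc T Ω d) t ω = 0 := by
      simp [cumul]
    simpa only [h0, zero_add] using h
  refine ⟨hνΛ, fun ν => ⟨?_, fun hν => ?_⟩⟩
  · rintro ⟨hν, u, hbr, hcl⟩
    obtain ⟨n, hn⟩ := (hν.inH2 hT).exists_rep
    choose a M hM using fun m => (hbr m).1
    have hua : ∀ m, HasDrift 𝓖 P (u m) (a m) := fun m => ⟨M m, hM m⟩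
    choose x hu using fun m => ((hua m).mem.inH2 hT).exists_rep
    choose α ha using fun m => ((hua m).drift_mem.inH2 hT).exists_rep
    have hx := (hclear hu).1 hcl
    -- The total rate is the zero element of 𝒜, and the drift of an element of 𝒜 is unique.
    have hα : ∑ m, α m + β = 0 := by
      refine HasDrift.class_eq_zero (hnull := hnull)
        ((HasDrift.sum hT Finset.univ fun m _ => hua m).add hT hψb) ?_
        ((HasClass.sum Finset.univ fun m _ => ha m).add hb) hT
      rw [← hx]
      exact (HasClass.sum Finset.univ fun m _ => hu m).add hψ
    have hsum := sum_first_order_eq hN (C := opC hT hnull) (S := opA hT K.cov)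
      (L := opA hT K.cost) hδ hc x α ζ n p β K.r
    rw [Finset.sum_eq_zero fun m _ => (Market.costBestResponse_facedExpo_iff hN hcov hcost hδ htol
      hζ hexpo hψb hψ hb hη hc hν hn hua hu ha hx m).1 (hbr m), hx, hα, ← hnΛ] at hsum
    simp only [map_zero, smul_zero, sub_zero, add_zero] at hsum
    have hn' : n = nΛ := sub_eq_zero.1
      ((smul_eq_zero.1 hsum.symm).resolve_left (by linarith))
    rw [hn'] at hn
    exact hn.aeEq hform
  · have hν' : InHInf 𝓖 P ν := hνΛ.congr (hν.mono fun _ h => h.symm)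
    have hn : HasClass ν nΛ := hform.congr (hν.mono fun _ h => h.symm)
    have hc2 : 0 < 4 * c + 2 := by linarith
    -- This inhomogeneity and the constant in `hκ` come from solving the first-order condition of
    -- investor m for her drift, dividing by (4c + 2)Λ.
    have hg : ∀ m, InHInf 𝓖 P fun t ω => (4 * c + 2)⁻¹ • act K.cost⁻¹
        ((ν t ω - δ⁻¹ • act K.cov (K.expo m t ω))
          + (2 * c) • act K.cost (b t ω - K.r • ψ t ω)) := fun m =>
      (((hν'.sub (((hexpo m).act K.cov).smul _)).add
        (((hψb.drift_mem.sub (hψb.mem.smul K.r)).act K.cost).smul _)).act _).smul _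
    have hκ : 0 < (1 + c) * δ⁻¹ / (4 * c + 2) := by positivity
    choose u a hua hae using fun m =>
      hW.exists_hasDrift hT K.r hκ hcov hcost hdiag (hg m)
    choose x hu using fun m => ((hua m).mem.inH2 hT).exists_rep
    choose α ha using fun m => ((hua m).drift_mem.inH2 hT).exists_rep
    have hfoc : ∀ m, nΛ - δ⁻¹ • opA hT K.cov ((1 + c) • opC hT hnull (x m) + ζ m)
        + (4 * c + 2) • opA hT K.cost (α m - K.r • x m)
        + (2 * c) • opA hT K.cost (β - K.r • p) = 0 := by
      intro m
      have h1 := (((hu m).smul K.r).add (((hu m).opC (hT := hT) (hnull := hnull)).opA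
        (hT := hT) (K.cost⁻¹ * K.cov) |>.smul ((1 + c) * δ⁻¹ / (4 * c + 2)))).sub
          ((((hn.sub (((hζ m).opA (hT := hT) K.cov).smul δ⁻¹)).add
            (((hb.sub (hψ.smul K.r)).opA (hT := hT) K.cost).smul (2 * c))).opA
              (hT := hT) K.cost⁻¹).smul (4 * c + 2)⁻¹)
      have h2 := (ha m).eq_of_aeEq h1 (hae m)
      have h3 : opA hT K.cost (α m - K.r • x m)
          = ((1 + c) * δ⁻¹ / (4 * c + 2)) • opA hT K.cov (opC hT hnull (x m))
            - (4 * c + 2)⁻¹ • ((nΛ - δ⁻¹ • opA hT K.cov (ζ m))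
              + (2 * c) • opA hT K.cost (β - K.r • p)) := by
        rw [h2, add_sub_assoc, add_sub_cancel_left, map_sub, map_smul, map_smul, ← opA_opA,
          opA_opA_inv hcost, opA_opA_inv hcost]
      rw [h3, map_add (opA hT K.cov), map_smul]
      match_scalars <;> field_simp <;> ring
    have hsum := sum_first_order_eq hN (C := opC hT hnull) (S := opA hT K.cov)
      (L := opA hT K.cost) hδ hc x α ζ nΛ p β K.r
    rw [Finset.sum_eq_zero fun m _ => hfoc m, ← hnΛ, sub_self, smul_zero, zero_sub] at hsum
    -- The excess rate s satisfies a homogeneous equation linking ΣCs to Λ(drift of s - rs). Pairing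
    -- it with Cs and integrating by parts gives nonnegative risk and cost terms that add up to
    -- zero.
    have hx : ∑ m, x m + p = 0 := by
      refine eq_zero_of_discForm_opA_le (hT := hT) (r := K.r) hcost ?_
      have h1 := ((HasDrift.sum hT Finset.univ fun m _ => hua m).add hT hψb).discForm_eq
        (hT := hT) (hnull := hnull) (r := K.r)
        ((HasClass.sum Finset.univ fun m _ => hu m).add hψ)
        ((HasClass.sum Finset.univ fun m _ => ha m).add hb) K.cost (∑ m, x m + p)
      have h2 := congrArg (discForm hT K.r (opC hT hnull (∑ m, x m + p))) hsum
      rw [map_zero, map_add, map_neg, map_smul, map_smul, h1] at h2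
      have h3 := discForm_opA_nonneg (hT := hT) (r := K.r) hcov (opC hT hnull (∑ m, x m + p))
      have h4 : 0 ≤ δ⁻¹ * (1 + c) * discForm hT K.r (opC hT hnull (∑ m, x m + p))
          (opA hT K.cov (opC hT hnull (∑ m, x m + p))) := mul_nonneg (by positivity) h3
      simp only [smul_eq_mul] at h2
      by_contra! h5
      have h6 := mul_pos hc2 h5
      linarith
    exact ⟨hν', u, fun m => (Market.costBestResponse_facedExpo_iff hN hcov hcost hδ htol
      hζ hexpo hψb hψ hb hη hc hν' hn hua hu ha hx m).2 (hfoc m), (hclear hu).2 hx⟩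

/-- Without noise traders, the transaction costs do not affect the equilibrium returns. -/
lemma Market.costNashFormula_aeEq_of_noise_eq_zero (hT : 0 < T) (hnull : ContainsNull 𝓕 P)
    {ψ b : VProc T Ω d} (hψb : HasDrift 𝓕 P ψ b)
    (hη : ∀ᵐ ω ∂P, ∀ t, K.noise t ω = cumul ψ t ω) (h0 : ∀ᵐ ω ∂P, ∀ t, K.noise t ω = 0)
    (c : ℝ) :
    AEEqProc P (fun t ω => K.nashFormula t ω + c • act K.cost (b t ω - K.r • ψ t ω))
      K.nashFormula := by
  obtain ⟨p, hψ⟩ := (hψb.mem.inH2 hT).exists_rep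
  obtain ⟨β, hb⟩ := (hψb.drift_mem.inH2 hT).exists_rep
  have hp : p = 0 := by
    refine opC_injective (hT := hT) (hnull := hnull) ?_
    refine hψ.opC.eq_of_aeEq HasClass.zero (AEEqProc.of_forall ?_)
    filter_upwards [hη, h0] with ω h1 h2 t
    rw [← h1 t, h2 t]
  subst hp
  have hβ : β = 0 := hψb.class_eq_zero (hnull := hnull) hψ hb hT
  subst hβ
  filter_upwards [hψ.aeEq HasClass.zero, hb.aeEq HasClass.zero] with q h1 h2
  rw [h1, h2, smul_zero, sub_zero, act, map_zero, smul_zero, add_zero]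

end CostEquilibrium

end

/-! ### The theorem -/

theorem theorem4p6 {Ω : Type*} [mΩ : MeasurableSpace Ω] (P : Measure Ω) [IsProbabilityMeasure P]
    (T : ℝ) (hT : 0 < T) (d N : ℕ) (hN : 2 ≤ N)
    (W : VProc T Ω d) (hW : IsStdBrownian P W)
    (𝓕 : Filtration (Horizon T) mΩ) (h𝓕 : 𝓕 = augFiltration P W hW.measurable)
    (K : Market T Ω d N) (hr : 0 ≤ K.r)
    (hcov : K.cov.PosDef) (hdiag : K.cost.IsDiag) (hcost : K.cost.PosDef)
    (δbar : ℝ) (hδbar : 0 < δbar) (htol : ∀ m, K.tol m = δbar)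
    (hexpo : ∀ m, InHInf 𝓕 P (K.expo m))
    (ψrate aψ Mψ : VProc T Ω d) (hψrate : IsClassA 𝓕 P ψrate aψ Mψ)
    (hψ : ∀ᵐ ω ∂P, ∀ t, K.noise t ω = cumul ψrate t ω)
    (νΛ : VProc T Ω d)
    (hνΛ : ∀ t ω, νΛ t ω = K.nashFormula t ω +
      ((2 : ℝ) / ((N : ℝ) * ((N : ℝ) - 1))) • act K.cost (aψ t ω - K.r • ψrate t ω)) :
    -- the frictionless Nash equilibrium returns exist, are unique and have the closed form
    (∀ ν, K.IsNashReturns 𝓕 P ν ↔ AEEqProc P ν K.nashFormula) ∧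
    -- so do the Nash equilibrium returns with transaction costs
    InHInf 𝓕 P νΛ ∧
    (∀ ν, K.IsCostNashReturns 𝓕 P ν ↔ AEEqProc P ν νΛ) ∧
    -- without noise traders, the equilibrium returns are not affected by transaction costs
    ((∀ᵐ ω ∂P, ∀ t, K.noise t ω = 0) →
      ∀ ν, K.IsCostNashReturns 𝓕 P ν ↔ K.IsNashReturns 𝓕 P ν) := by
  subst h𝓕
  have hnull := containsNull_augFiltration P W hW.measurable
  have hdrift : HasDrift (augFiltration P W hW.measurable) P ψrate aψ := ⟨Mψ, hψrate⟩
  obtain rfl : νΛ = fun t ω => K.nashFormula t ω +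
      ((2 : ℝ) / ((N : ℝ) * ((N : ℝ) - 1))) • act K.cost (aψ t ω - K.r • ψrate t ω) :=
    funext fun t => funext fun ω => hνΛ t ω
  obtain ⟨p, hp⟩ := (hdrift.mem.inH2 hT).exists_rep
  choose ζ hζ using fun m => ((hexpo m).inH2 hT).exists_rep
  have hnoise : HasClass K.noise (opC hT hnull p) :=
    hp.opC.congr (AEEqProc.of_forall (hψ.mono fun ω h t => (h t).symm))
  have hfree := Market.isNashReturns_iff hN hcov hδbar htol hζ hnoise hT
  obtain ⟨hmem, hiff⟩ :=
    hW.isCostNashReturns_iff hT hN hcov hcost hdiag hδbar htol hexpo hdrift hψ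
  refine ⟨hfree, hmem, hiff, fun h0 ν => ?_⟩
  have heq := Market.costNashFormula_aeEq_of_noise_eq_zero hT hnull hdrift hψ h0
    ((2 : ℝ) / ((N : ℝ) * ((N : ℝ) - 1)))
  rw [hiff, hfree]
  constructor
  · intro h
    filter_upwards [h, heq] with q h1 h2 using h1.trans h2
  · intro h
    filter_upwards [h, heq] with q h1 h2 using h1.trans h2.symm
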